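/- Conventions. A directed graph $G$ has a finite vertex set $V_G$ and an edge set $E_G\subseteq V_G\times V_G$; an edge $e$ goes from its origin $\alpha(e)$ to its end $\omega(e)$. The valence of a vertex is the number of edges having it as an extremity; a vertex is minimal (maximal) if it is the end (origin) of no edge; connectedness refers to the underlying undirected graph. A linear extension of $G$ is a word $w=w_1\cdots w_n$ containing each vertex exactly once and in which the origin of each edge comes before its end. In the field $\mathbb{Q}(x_v : v\in V_G)$ set $$\Psi(G)=\sum_{w}\ \prod_{i=1}^{n-1}\frac{1}{x_{w_i}-x_{w_{i+1}}},\qquad N(G)=\Psi(G)\prod_{e\in E_G}(x_{\alpha(e)}-x_{\omega(e)}),$$ where $w$ runs over the linear extensions of $G$. For a finite poset $P$, $\Psi_P$ is the same sum over the linear extensions of $P$ (words in which $a$ comes before $b$ whenever $a<_P b$), and $\mu_P$ is the Möbius function of $P$. A poset is connected if its Hasse diagram, directed upwards, is connected. A directed graph is planar if its vertices can be placed at distinct points of $\mathbb{R}\times\mathbb{R}$ so that, drawing edges as straight segments, the origin of each edge is strictly to the left of its end, an edge contains no vertex other than its extremities, and two distinct edges meet only at common extremities. It is strongly planar if the graph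 obtained by adding a vertex $0$ with an edge to each minimal vertex and a vertex $\infty$ with an edge from each maximal vertex is planar. A finite poset is planar if its Hasse diagram is strongly planar. A diamond is a connected directed graph $D$ with $|E_D|=|V_D|$ (that is, with exactly one undirected cycle), without vertices of valence $1$, with a unique minimal vertex $\min(D)$ and a unique maximal vertex $\max(D)$. A chain $c$ of $G$ is a sequence of at least two distinct vertices $V_c$ in which consecutive vertices $u,v$ form an edge $(u,v)$ of $G$. The regions of $G$ with respect to $c$ are the subgraphs of $G$ induced by $V_c\cup V_{G_i}$, where $G_1,\dots,G_k$ are the connected components of $G\setminus V_c$. Theorem. Let $P$ be a non-empty finite planar poset with Hasse diagram $G$. (1) If $P$ is connected, then there is a finite multiset of diamonds $D_1,\dots,D_m$ (subgraphs of $G$), obtained from $G$ by iterating the operations of replacing a graph by all its regions with respect to a chain and of pruning (erasing a vertex of valence $1$), where final graphs reduced to a single vertex are discarded, such that $$N(G)=\prod_{i=1}^m N(D_i),\qquad N(D_i)=x_{\min(D_i)}-x_{\max(D_i)}\quad(1\le i\le m).$$ (2) (Greene's formula) If $P$ is connected, then $$\Psi_P=\prod_{y,z\in P,\ y\ne z}(x_y-x_z)^{\mu_P(y,z)};$$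 if $P$ is not connected, then $\Psi_P=0$. -/

import Mathlib

namespace GreenePlanar

/-- A finite directed graph whose vertices lie in an ambient type `V` (which also indexes the
variables, so that a graph and its subgraphs have rational functions in the same field). -/
@[ext]
structure DGraph (V : Type*) where
  verts : Finset V
  edges : Finset (V × V)
  left_mem : ∀ e ∈ edges, e.1 ∈ verts
  right_mem : ∀ e ∈ edges, e.2 ∈ verts

section RationalFunctions

variable {V : Type*}

/-- The field `ℚ(x_v : v ∈ V)`. -/
abbrev RatFun (V : Type*) : Type _ := FractionRing (MvPolynomial V ℚ)

/-- The variable `x_v` as a rational function. -/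
noncomputable def var (v : V) : RatFun V :=
  algebraMap (MvPolynomial V ℚ) (RatFun V) (MvPolynomial.X v)

/-- `ψ_w = ∏ 1 / (x_{w_i} - x_{w_{i+1}})`, over the consecutive letters of the word `w`. -/
noncomputable def wordPsi (w : List V) : RatFun V :=
  (List.zipWith (fun a b => (var a - var b)⁻¹) w w.tail).prod

/-- The words containing each element of `S` exactly once, and no other letter. -/
def words (S : Finset V) : Finset (List V) :=
  ⟨Multiset.lists S.val, Multiset.lists_nodup_finset S⟩

theorem mem_words {S : Finset V} {w : List V} : w ∈ words S ↔ (w : Multiset V) = S.val :=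
  ⟨fun h => ((Multiset.mem_lists_iff _ _).1 h).symm,
    fun h => (Multiset.mem_lists_iff _ _).2 h.symm⟩

end RationalFunctions

namespace DGraph

variable {V : Type*} [DecidableEq V]

/-- Linear extensions of `G`: the words in which the origin of every edge comes before its end. -/
def linExt (G : DGraph V) : Finset (List V) :=
  (words G.verts).filter (fun w => ∀ e ∈ G.edges, w.idxOf e.1 ≤ w.idxOf e.2)

/-- `Ψ(G)`. -/
noncomputable def Psi (G : DGraph V) : RatFun V := ∑ w ∈ G.linExt, wordPsi w

/-- `N(G) = Ψ(G) ∏_{e} (x_{α(e)} - x_{ω(e)})`. -/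
noncomputable def N (G : DGraph V) : RatFun V := G.Psi * ∏ e ∈ G.edges, (var e.1 - var e.2)

/-- The underlying undirected simple graph, on the whole ambient type. -/
def skeleton (G : DGraph V) : SimpleGraph V := SimpleGraph.fromRel (fun u v => (u, v) ∈ G.edges)

def Connected (G : DGraph V) : Prop :=
  G.verts.Nonempty ∧ ∀ u ∈ G.verts, ∀ v ∈ G.verts, G.skeleton.Reachable u v

/-- The subgraph of `G` induced by the vertices of `G` lying in `S`. -/
def induce (G : DGraph V) (S : Finset V) : DGraph V where
  verts := G.verts ∩ S
  edges := G.edges.filter (fun e => e.1 ∈ S ∧ e.2 ∈ S)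
  left_mem e he := by
    rw [Finset.mem_filter] at he
    exact Finset.mem_inter.2 ⟨G.left_mem e he.1, he.2.1⟩
  right_mem e he := by
    rw [Finset.mem_filter] at he
    exact Finset.mem_inter.2 ⟨G.right_mem e he.1, he.2.2⟩

/-- The graph `G \ S` obtained by erasing the vertices in `S`. -/
def erase (G : DGraph V) (S : Finset V) : DGraph V := G.induce (G.verts \ S)

/-- Number of edges having `v` as an extremity. -/
def valence (G : DGraph V) (v : V) : ℕ := (G.edges.filter (fun e => e.1 = v ∨ e.2 = v)).card

/-- Vertices which are not the end of any edge. -/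
def minimals (G : DGraph V) : Finset V := G.verts.filter (fun v => ∀ e ∈ G.edges, e.2 ≠ v)

/-- Vertices which are not the origin of any edge. -/
def maximals (G : DGraph V) : Finset V := G.verts.filter (fun v => ∀ e ∈ G.edges, e.1 ≠ v)

/-- A diamond: a connected graph with cyclomatic number `|E| - |V| + 1` equal to `1`, without
vertices of valence `1`, with a unique minimal vertex and a unique maximal vertex. -/
structure IsDiamond (G : DGraph V) : Prop where
  connected : G.Connected
  one_cycle : G.edges.card = G.verts.card
  valence_ne_one : ∀ v ∈ G.verts, G.valence v ≠ 1
  unique_min : G.minimals.card = 1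
  unique_max : G.maximals.card = 1

/-- A chain of `G`, given by the list of its (distinct) successive vertices; it has at least one
edge. -/
def IsDirectedChain (G : DGraph V) (c : List V) : Prop :=
  2 ≤ c.length ∧ c.Nodup ∧ c.IsChain (fun u v => (u, v) ∈ G.edges)

open Classical in
/-- The connected component of `v` in `G`, as a set of vertices. -/
noncomputable def component (G : DGraph V) (v : V) : Finset V :=
  G.verts.filter (fun u => G.skeleton.Reachable v u)

open Classical in
/-- The regions of `G` with respect to the chain `c`: the subgraphs induced by `V_c ∪ G_i`, where
the `G_i` are the connected components of `G \ V_c`. -/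
noncomputable def regions (G : DGraph V) (c : List V) : Finset (DGraph V) :=
  (G.erase c.toFinset).verts.image
    (fun v => G.induce (c.toFinset ∪ (G.erase c.toFinset).component v))

/-- `ChainFactors G s`: iterating chain factorization (replacing a graph by all its regions with
respect to a chain) and pruning (erasing a vertex of valence `1`), starting from `G`, one ends up
with the multiset `s` of diamonds, all other final graphs being reduced to one point. -/
inductive ChainFactors : DGraph V → Multiset (DGraph V) → Prop
  | point (G : DGraph V) : G.verts.card = 1 → G.edges = ∅ → ChainFactors G 0
  | diamond (G : DGraph V) : G.IsDiamond → ChainFactors G {G}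
  | prune (G : DGraph V) (v : V) (s : Multiset (DGraph V)) :
      v ∈ G.verts → G.valence v = 1 → ChainFactors (G.erase {v}) s → ChainFactors G s
  | chain (G : DGraph V) (c : List V) (f : DGraph V → Multiset (DGraph V)) :
      G.IsDirectedChain c → (∀ R ∈ G.regions c, ChainFactors R (f R)) →
      ChainFactors G (∑ R ∈ G.regions c, f R)

/-- `p` is an ordered embedding of `G` in `ℝ × ℝ` without edge-crossings: distinct vertices are
distinct points, the origin of an edge is at the left of its end, edges are straight segments, an
edge contains no vertex other than its extremities, and two distinct edges meet only at common
extremities. -/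
structure IsPlanarDrawing (G : DGraph V) (p : V → ℝ × ℝ) : Prop where
  injOn : Set.InjOn p (G.verts : Set V)
  left_to_right : ∀ e ∈ G.edges, (p e.1).1 < (p e.2).1
  vertex_edge : ∀ v ∈ G.verts, ∀ e ∈ G.edges,
    p v ∈ segment ℝ (p e.1) (p e.2) → v = e.1 ∨ v = e.2
  edge_edge : ∀ e ∈ G.edges, ∀ f ∈ G.edges, e ≠ f →
    ∀ q, q ∈ segment ℝ (p e.1) (p e.2) → q ∈ segment ℝ (p f.1) (p f.2) →
      ∃ v, (v = e.1 ∨ v = e.2) ∧ (v = f.1 ∨ v = f.2) ∧ q = p v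

def IsPlanar (G : DGraph V) : Prop := ∃ p : V → ℝ × ℝ, G.IsPlanarDrawing p

/-- The graph `G_{0,∞}`; the vertices `0` and `∞` are `none` and `some none`, and the vertex `v`
of `G` is `some (some v)`. -/
def addMinMax (G : DGraph V) : DGraph (Option (Option V)) where
  verts := {none, some none} ∪ G.verts.image (fun v => some (some v))
  edges := G.edges.image (fun e => (some (some e.1), some (some e.2)))
    ∪ G.minimals.image (fun v => (none, some (some v)))
    ∪ G.maximals.image (fun v => (some (some v), some none))
  left_mem e he := by
    simp only [Finset.mem_union, Finset.mem_image, minimals, maximals, Finset.mem_filter] at he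
    rcases he with (⟨a, ha, rfl⟩ | ⟨a, ha, rfl⟩) | ⟨a, ha, rfl⟩
    · simp [G.left_mem a ha]
    · simp
    · simp [ha.1]
  right_mem e he := by
    simp only [Finset.mem_union, Finset.mem_image, minimals, maximals, Finset.mem_filter] at he
    rcases he with (⟨a, ha, rfl⟩ | ⟨a, ha, rfl⟩) | ⟨a, ha, rfl⟩
    · simp [G.right_mem a ha]
    · simp [ha.1]
    · simp

def StronglyPlanar (G : DGraph V) : Prop := G.addMinMax.IsPlanar

end DGraph

section Posets

variable (P : Type*) [Fintype P] [DecidableEq P] [PartialOrder P]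

open Classical in
/-- The Hasse diagram (minimal graph) of the finite poset `P`. -/
noncomputable def hasseGraph : DGraph P where
  verts := Finset.univ
  edges := Finset.univ.filter (fun e => e.1 ⋖ e.2)
  left_mem _ _ := Finset.mem_univ _
  right_mem _ _ := Finset.mem_univ _

open Classical in
/-- `Ψ_P`, the sum of `ψ_w` over the linear extensions `w` of the poset `P`. -/
noncomputable def posetPsi : RatFun P :=
  ∑ w ∈ (words (Finset.univ : Finset P)).filter
    (fun w => ∀ a b : P, a ≤ b → w.idxOf a ≤ w.idxOf b), wordPsi w

/-- The rational function of a poset is that of its Hasse diagram. -/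
theorem posetPsi_eq [LocallyFiniteOrder P] : posetPsi P = (hasseGraph P).Psi := by
  classical
  unfold posetPsi DGraph.Psi DGraph.linExt
  refine Finset.sum_congr ?_ fun _ _ => rfl
  ext w
  simp only [Finset.mem_filter, hasseGraph, Finset.mem_univ, true_and, Prod.forall]
  refine and_congr_right fun _ => ⟨fun h a b hab => h a b hab.le, fun h a b hab => ?_⟩
  rw [le_iff_reflTransGen_covBy] at hab
  induction hab with
  | refl => exact le_rfl
  | tail _ hbc ih => exact ih.trans (h _ _ hbc)

end Posets

end GreenePlanar

namespace GreenePlanar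

/-! ### Sums over linear extensions, and their behaviour under gluing along a chain. -/

section WordSums

variable {V : Type*}

/-! Gluing is the algebraic engine. Let two sets meet exactly in a chain `c`, with no relation
between their differences. Then Ψ of the union times ψ_c is the product of the two Ψ, and Ψ of the
union is 0 when `c` is empty. Splitting off the first letter of the words turns this into Lagrange
interpolation of the affine function a ↦ 1/ψ_{ac} (`Glued.sum_step`, `Glued.relPsiFrom_union`,
`Glued.relPsi_union`). It follows that N is multiplicative over the regions of a chain, that pruning
leaves N unchanged, that two chains with the same ends u, w have N = x_u - x_w, and that erasing an
element attached to the rest through one or two "gates" multiplies Ψ by an explicit factor.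

Planarity serves only to find an ear: a chain A all of whose relations with the rest pass through an
element u below and an element w above, while some t outside A also lies strictly between u and w.
With bounds added, two maximal chains whose broken lines exchange their vertical order share a
vertex, by the intermediate value theorem and the absence of crossings. Hence "below" makes sense
for incomparable elements, and together with the order it gives a linear order `SweepLt`. If a < c
and b is swept between them, then a < b or b < c; and two elements lying under two others can be
separated by a fifth. These two properties yield an ear (`exists_ear_of_rank`).

Both formulas are then proved together by induction over connected `Spanning` subsets, those to
which the drawing restricts. A chain is treated directly. Otherwise an ear is removed, and the rest
is again spanning and connected, thanks to t. For Greene's formula the ear is erased one element at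
a time: the Möbius function loses only the entries of the erased element, apart from a unit at (u,
w) when there are two gates, which matches the change in Ψ. For the diamonds, an ear with one free
end is pruned. If both ends are attached, one factors along a maximal chain through u, t, w: the ear
is one of the components, its region prunes to a single diamond, and the other regions are smaller
spanning connected sets. -/

theorem var_injective : Function.Injective (var : V → RatFun V) := fun _ _ h =>
  MvPolynomial.X_injective (IsFractionRing.injective (MvPolynomial V ℚ) (RatFun V) h)

theorem var_sub_ne_zero {a b : V} (h : a ≠ b) : var a - var b ≠ 0 :=
  sub_ne_zero.2 (fun h' => h (var_injective h'))

@[simp] theorem wordPsi_nil : wordPsi ([] : List V) = 1 := rfl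

@[simp] theorem wordPsi_singleton (a : V) : wordPsi [a] = 1 := rfl

@[simp] theorem wordPsi_cons_cons (a b : V) (w : List V) :
    wordPsi (a :: b :: w) = (var a - var b)⁻¹ * wordPsi (b :: w) := rfl

theorem wordPsi_ne_zero : ∀ {w : List V}, w.Nodup → wordPsi w ≠ 0
  | [], _ => one_ne_zero
  | [_], _ => one_ne_zero
  | a :: b :: w, h => by
    have hab : a ≠ b := by
      have := (List.nodup_cons.1 h).1
      simp only [List.mem_cons, not_or] at this
      exact this.1
    rw [wordPsi_cons_cons]
    exact mul_ne_zero (inv_ne_zero (var_sub_ne_zero hab)) (wordPsi_ne_zero h.tail)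

open Classical in
/-- The words on `S` in which `a` comes before `b` whenever `R a b`. -/
noncomputable def extensions (R : V → V → Prop) (S : Finset V) : Finset (List V) :=
  (words S).filter (fun w => w.Pairwise (fun a b => ¬ R b a))

/-- The sum of `ψ_w` over the linear extensions `w` of a relation on a finite set. -/
noncomputable def relPsi (R : V → V → Prop) (S : Finset V) : RatFun V :=
  ∑ w ∈ extensions R S, wordPsi w

/-- The sum of `ψ_{pw}` over the linear extensions `w` of a relation on a finite set. -/
noncomputable def relPsiFrom (R : V → V → Prop) (p : V) (S : Finset V) : RatFun V :=
  ∑ w ∈ extensions R S, wordPsi (p :: w)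

theorem mem_extensions {R : V → V → Prop} {S : Finset V} {w : List V} :
    w ∈ extensions R S ↔ (w : Multiset V) = S.val ∧ w.Pairwise (fun a b => ¬ R b a) := by
  simp only [extensions, Finset.mem_filter, mem_words]

theorem mem_iff_of_mem_extensions {R : V → V → Prop} {S : Finset V} {w : List V}
    (h : w ∈ extensions R S) (a : V) : a ∈ w ↔ a ∈ S := by
  rw [← Multiset.mem_coe, (mem_extensions.1 h).1, Finset.mem_val]

theorem extensions_empty (R : V → V → Prop) : extensions R ∅ = {[]} := by
  ext w
  rw [mem_extensions, Finset.mem_singleton]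
  constructor
  · rintro ⟨h, -⟩
    simpa using h
  · rintro rfl
    simp

@[simp] theorem relPsiFrom_empty (R : V → V → Prop) (p : V) : relPsiFrom R p ∅ = 1 := by
  simp [relPsiFrom, extensions_empty]

/-- Two finite sets glued along a chain `c` of a relation, without relations between the elements
outside `c`. -/
structure Glued (R : V → V → Prop) (S₁ S₂ : Finset V) (c : List V) : Prop where
  inter : ∀ a, a ∈ S₁ ∧ a ∈ S₂ ↔ a ∈ c
  nodup : c.Nodup
  chain : c.IsChain R
  not_rel₁₂ : ∀ a ∈ S₁, ∀ b ∈ S₂, a ∉ S₂ → b ∉ S₁ → ¬ R a b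
  not_rel₂₁ : ∀ a ∈ S₁, ∀ b ∈ S₂, a ∉ S₂ → b ∉ S₁ → ¬ R b a

theorem Glued.symm {R : V → V → Prop} {S₁ S₂ : Finset V} {c : List V} (h : Glued R S₁ S₂ c) :
    Glued R S₂ S₁ c :=
  ⟨fun a => by rw [and_comm, h.inter], h.nodup, h.chain,
    fun a ha b hb ha' hb' => h.not_rel₂₁ b hb a ha hb' ha',
    fun a ha b hb ha' hb' => h.not_rel₁₂ b hb a ha hb' ha'⟩

/-- The inverse of `ψ_{ac}` is an affine function of `x_a`. -/
theorem exists_wordPsi_cons_inv (c : List V) (hc : c.Nodup) : ∃ k₀ k₁ : RatFun V,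
    (∀ a, a ∉ c → k₁ * var a + k₀ = (wordPsi (a :: c))⁻¹) ∧
    (∀ x l, c = x :: l → k₁ * var x + k₀ = 0 ∧ k₁ = (wordPsi c)⁻¹) ∧
    (c = [] → k₁ = 0) := by
  cases c with
  -- For the empty chain ψ_a = 1, so the affine function is the constant 1. Its zero slope is the
  -- origin of the vanishing of Ψ on disconnected sets.
  | nil => exact ⟨1, 0, by simp, by simp, by simp⟩
  | cons x l =>
    refine ⟨- (wordPsi (x :: l))⁻¹ * var x, (wordPsi (x :: l))⁻¹, fun a _ => ?_, ?_, by simp⟩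
    · rw [wordPsi_cons_cons, mul_inv, inv_inv]
      ring
    · rintro y m h
      obtain ⟨rfl, rfl⟩ := List.cons.inj h
      exact ⟨by ring, rfl⟩

variable [DecidableEq V]

open Classical in
/-- The elements of `S` which may be the first letter of a linear extension. -/
noncomputable def sources (R : V → V → Prop) (S : Finset V) : Finset V :=
  S.filter (fun a => ∀ b ∈ S, b ≠ a → ¬ R b a)

theorem mem_sources {R : V → V → Prop} {S : Finset V} {a : V} :
    a ∈ sources R S ↔ a ∈ S ∧ ∀ b ∈ S, b ≠ a → ¬ R b a := by
  simp only [sources, Finset.mem_filter]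

/-- Stating the order condition with `List.Pairwise` makes the removal of the first letter
immediate, which is what every recursion on Ψ uses. -/
theorem cons_mem_extensions {R : V → V → Prop} {S : Finset V} {a : V} {w : List V} :
    a :: w ∈ extensions R S ↔ a ∈ sources R S ∧ w ∈ extensions R (S.erase a) := by
  rw [mem_sources]
  constructor
  · intro h
    have ha : a ∈ S := (mem_iff_of_mem_extensions h a).1 (by simp)
    have hw : (w : Multiset V) = (S.erase a).val := by
      rw [Finset.erase_val, ← (mem_extensions.1 h).1, ← Multiset.cons_coe, Multiset.erase_cons_head]
    have hp := List.pairwise_cons.1 (mem_extensions.1 h).2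
    refine ⟨⟨ha, fun b hb hba => hp.1 b ?_⟩, mem_extensions.2 ⟨hw, hp.2⟩⟩
    rw [← Multiset.mem_coe, hw, Finset.mem_val]
    exact Finset.mem_erase.2 ⟨hba, hb⟩
  · rintro ⟨⟨ha, hm⟩, hw⟩
    refine mem_extensions.2 ⟨?_, List.pairwise_cons.2 ⟨fun b hb => ?_, (mem_extensions.1 hw).2⟩⟩
    · rw [← Multiset.cons_coe, (mem_extensions.1 hw).1, Finset.erase_val, Multiset.cons_erase ha]
    · have := (mem_iff_of_mem_extensions hw b).1 hb
      exact hm b (Finset.mem_of_mem_erase this) (Finset.ne_of_mem_erase this)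

theorem sum_extensions (R : V → V → Prop) {S : Finset V} (hS : S.Nonempty)
    (g : List V → RatFun V) :
    ∑ w ∈ extensions R S, g w =
      ∑ a ∈ sources R S, ∑ w ∈ extensions R (S.erase a), g (a :: w) := by
  classical
  have : extensions R S =
      (sources R S).biUnion (fun a => (extensions R (S.erase a)).image (List.cons a)) := by
    ext w
    simp only [Finset.mem_biUnion, Finset.mem_image]
    constructor
    · intro h
      cases w with
      | nil =>
        obtain ⟨a, ha⟩ := hS
        simpa using (mem_iff_of_mem_extensions h a).2 ha
      | cons a w => exact ⟨a, (cons_mem_extensions.1 h).1, w, (cons_mem_extensions.1 h).2, rfl⟩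
    · rintro ⟨a, ha, w, hw, rfl⟩
      exact cons_mem_extensions.2 ⟨ha, hw⟩
  rw [this, Finset.sum_biUnion]
  · refine Finset.sum_congr rfl fun a _ => ?_
    rw [Finset.sum_image]
    intro x _ y _ h
    exact (List.cons.inj h).2
  · intro a _ b _ hab
    rw [Function.onFun, Finset.disjoint_left]
    intro w hw hw'
    obtain ⟨x, -, rfl⟩ := Finset.mem_image.1 hw
    obtain ⟨y, -, h⟩ := Finset.mem_image.1 hw'
    exact hab (List.cons.inj h).1.symm

theorem relPsi_eq_sum (R : V → V → Prop) {S : Finset V} (hS : S.Nonempty) :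
    relPsi R S = ∑ a ∈ sources R S, relPsiFrom R a (S.erase a) :=
  sum_extensions R hS _

theorem relPsiFrom_eq_sum (R : V → V → Prop) (p : V) {S : Finset V} (hS : S.Nonempty) :
    relPsiFrom R p S =
      ∑ a ∈ sources R S, (var p - var a)⁻¹ * relPsiFrom R a (S.erase a) := by
  rw [relPsiFrom, sum_extensions R hS]
  refine Finset.sum_congr rfl fun a _ => ?_
  rw [relPsiFrom, Finset.mul_sum]
  exact Finset.sum_congr rfl fun w _ => wordPsi_cons_cons _ _ _

theorem relPsi_singleton (R : V → V → Prop) (a : V) : relPsi R {a} = 1 := by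
  rw [relPsi_eq_sum R (Finset.singleton_nonempty a)]
  have : sources R {a} = {a} := by
    ext b
    rw [mem_sources]
    aesop
  simp [this]

theorem relPsi_pair {R : V → V → Prop} {a b : V} (hab : R a b) (hba : ¬ R b a) (hne : a ≠ b) :
    relPsi R {a, b} = (var a - var b)⁻¹ := by
  rw [relPsi_eq_sum R ⟨a, by simp⟩]
  have h1 : sources R {a, b} = {a} := by
    ext c
    simp only [mem_sources, Finset.mem_insert, Finset.mem_singleton]
    constructor
    · rintro ⟨rfl | rfl, h⟩
      · rfl
      · exact absurd hab (h a (Or.inl rfl) hne)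
    · rintro rfl
      refine ⟨Or.inl rfl, ?_⟩
      rintro d (rfl | rfl) h
      · exact absurd rfl h
      · exact hba
  have h2 : sources R {b} = {b} := by
    ext c
    rw [mem_sources]
    aesop
  have h3 : ({a, b} : Finset V).erase a = {b} := by
    rw [Finset.erase_insert]
    simpa using hne
  rw [h1, Finset.sum_singleton, h3, relPsiFrom_eq_sum R a (Finset.singleton_nonempty b), h2]
  simp

theorem Glued.erase_left {R : V → V → Prop} {S₁ S₂ : Finset V} {c : List V}
    (h : Glued R S₁ S₂ c) {a : V} (ha : a ∉ S₂) : Glued R (S₁.erase a) S₂ c where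
  inter b := by
    rw [← h.inter, Finset.mem_erase]
    constructor
    · rintro ⟨⟨_, h1⟩, h2⟩
      exact ⟨h1, h2⟩
    · rintro ⟨h1, h2⟩
      exact ⟨⟨fun e => ha (e ▸ h2), h1⟩, h2⟩
  nodup := h.nodup
  chain := h.chain
  not_rel₁₂ x hx y hy hx' hy' hxy := by
    have hxs := Finset.mem_of_mem_erase hx
    refine h.not_rel₁₂ x hxs y hy hx' (fun hys => hy' (Finset.mem_erase.2 ⟨?_, hys⟩)) hxy
    rintro rfl
    exact ha hy
  not_rel₂₁ x hx y hy hx' hy' hxy := by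
    have hxs := Finset.mem_of_mem_erase hx
    refine h.not_rel₂₁ x hxs y hy hx' (fun hys => hy' (Finset.mem_erase.2 ⟨?_, hys⟩)) hxy
    rintro rfl
    exact ha hy

theorem Glued.erase_both {R : V → V → Prop} {S₁ S₂ : Finset V} {a : V} {c : List V}
    (h : Glued R S₁ S₂ (a :: c)) : Glued R (S₁.erase a) (S₂.erase a) c where
  inter b := by
    have h1 := h.inter b
    have h2 := (List.nodup_cons.1 h.nodup).1
    simp only [List.mem_cons] at h1
    simp only [Finset.mem_erase]
    constructor
    · rintro ⟨⟨hb, h3⟩, -, h4⟩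
      exact (h1.1 ⟨h3, h4⟩).resolve_left hb
    · intro hb
      have h5 := h1.2 (Or.inr hb)
      have h6 : b ≠ a := fun e => h2 (e ▸ hb)
      exact ⟨⟨h6, h5.1⟩, h6, h5.2⟩
  nodup := h.nodup.of_cons
  chain := h.chain.tail
  not_rel₁₂ x hx y hy hx' hy' :=
    h.not_rel₁₂ x (Finset.mem_of_mem_erase hx) y (Finset.mem_of_mem_erase hy)
      (fun h' => hx' (Finset.mem_erase.2 ⟨Finset.ne_of_mem_erase hx, h'⟩))
      (fun h' => hy' (Finset.mem_erase.2 ⟨Finset.ne_of_mem_erase hy, h'⟩))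
  not_rel₂₁ x hx y hy hx' hy' :=
    h.not_rel₂₁ x (Finset.mem_of_mem_erase hx) y (Finset.mem_of_mem_erase hy)
      (fun h' => hx' (Finset.mem_erase.2 ⟨Finset.ne_of_mem_erase hx, h'⟩))
      (fun h' => hy' (Finset.mem_erase.2 ⟨Finset.ne_of_mem_erase hy, h'⟩))

/-- An element outside `S₂` has no predecessor in `S₂ \ S₁`, so only `S₁` can prevent it from coming
first. -/
theorem Glued.mem_sources_iff {R : V → V → Prop} {S₁ S₂ : Finset V} {c : List V}
    (h : Glued R S₁ S₂ c) {a : V} (ha : a ∈ S₁) (ha' : a ∉ S₂) :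
    a ∈ sources R (S₁ ∪ S₂) ↔ a ∈ sources R S₁ := by
  simp only [mem_sources, Finset.mem_union]
  constructor
  · rintro ⟨-, h1⟩
    exact ⟨ha, fun b hb => h1 b (Or.inl hb)⟩
  · rintro ⟨-, h1⟩
    refine ⟨Or.inl ha, fun b hb hba => ?_⟩
    by_cases hb1 : b ∈ S₁
    · exact h1 b hb1 hba
    · exact h.not_rel₂₁ a ha b (hb.resolve_left hb1) ha' hb1

theorem Glued.sources_union {R : V → V → Prop} {S₁ S₂ : Finset V} {c : List V}
    (h : Glued R S₁ S₂ c) :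
    sources R (S₁ ∪ S₂) = (sources R S₁).filter (· ∉ S₂) ∪
      ((sources R S₂).filter (· ∉ S₁) ∪ (sources R S₁ ∩ sources R S₂)) := by
  ext a
  simp only [Finset.mem_union, Finset.mem_filter, Finset.mem_inter]
  by_cases h1 : a ∈ S₁ <;> by_cases h2 : a ∈ S₂
  · simp only [h1, h2, not_true, and_false, false_or, mem_sources, Finset.mem_union, true_and,
      or_self]
    constructor
    · exact fun h => ⟨fun b hb => h b (Or.inl hb), fun b hb => h b (Or.inr hb)⟩
    · rintro ⟨h3, h4⟩ b (hb | hb)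
      exacts [h3 b hb, h4 b hb]
  · rw [h.mem_sources_iff h1 h2]
    have : a ∉ sources R S₂ := fun h => h2 (mem_sources.1 h).1
    simp [h2, this]
  · rw [Finset.union_comm, h.symm.mem_sources_iff h2 h1]
    have : a ∉ sources R S₁ := fun h => h1 (mem_sources.1 h).1
    simp [h1, this]
  · simp [h1, h2, mem_sources]

/-- A source lying in the common chain is its first element. -/
theorem Glued.eq_head_of_mem_sources {R : V → V → Prop} {S₁ S₂ : Finset V} {x a : V} {c : List V}
    (h : Glued R S₁ S₂ (x :: c)) (ha : a ∈ sources R S₁) (hac : a ∈ x :: c) : a = x := by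
  by_contra hne
  have h0 : a ∈ c := (List.mem_cons.1 hac).resolve_left hne
  -- An element of the chain other than its head has an immediate predecessor in the chain, hence in
  -- `S₁`.
  obtain ⟨b, hb, hba', hba⟩ : ∃ b ∈ x :: c, b ≠ a ∧ R b a := by
    have hch := h.chain
    have hnd := h.nodup
    clear ha hac hne h
    induction c generalizing x with
    | nil => simp at h0
    | cons y c ih =>
      rcases List.mem_cons.1 h0 with rfl | h1
      · refine ⟨x, by simp, ?_, (List.isChain_cons_cons.1 hch).1⟩
        rintro rfl
        simp at hnd
      · obtain ⟨b, hb, hba⟩ := ih h1 (List.isChain_cons_cons.1 hch).2 hnd.of_cons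
        exact ⟨b, List.mem_cons_of_mem _ hb, hba⟩
  exact (mem_sources.1 ha).2 b ((h.inter b).2 hb).1 hba' hba

/-- Summation over the possible first letters of the linear extensions of a glued set. -/
theorem Glued.sum_sources {R : V → V → Prop} {S₁ S₂ : Finset V} {c : List V}
    (h : Glued R S₁ S₂ c) (g : V → RatFun V) :
    ∑ a ∈ sources R (S₁ ∪ S₂), g a = ∑ a ∈ (sources R S₁).filter (· ∉ S₂), g a +
      (∑ a ∈ (sources R S₂).filter (· ∉ S₁), g a + ∑ a ∈ sources R S₁ ∩ sources R S₂, g a) := by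
  rw [h.sources_union, Finset.sum_union, Finset.sum_union]
  · rw [Finset.disjoint_left]
    intro a ha ha'
    exact (Finset.mem_filter.1 ha).2 (mem_sources.1 (Finset.mem_inter.1 ha').1).1
  · rw [Finset.disjoint_left]
    intro a ha ha'
    rcases Finset.mem_union.1 ha' with ha' | ha'
    · exact (Finset.mem_filter.1 ha').2 (mem_sources.1 (Finset.mem_filter.1 ha).1).1
    · exact (Finset.mem_filter.1 ha).2 (mem_sources.1 (Finset.mem_inter.1 ha').2).1

/-- The first step of the computation of `Ψ` of a glued set, from its values on smaller sets, which
are given by `hI₁`, `hI₂` and `hI₃`; the functions `k₁ x + k₀` and `κ` stand for the inverses of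
`ψ_{xc}` and of `ψ_c`. -/
theorem Glued.sum_step {R : V → V → Prop} {S₁ S₂ : Finset V} {c : List V}
    (h : Glued R S₁ S₂ c) (h₁ : S₁.Nonempty) (h₂ : S₂.Nonempty) (k₀ k₁ κ : RatFun V)
    (hk : ∀ a ∈ S₁, a ∈ S₂ → a ∈ sources R S₁ ∨ a ∈ sources R S₂ → k₁ * var a + k₀ = 0)
    (hI₁ : ∀ a ∈ sources R S₁, a ∉ S₂ → relPsiFrom R a ((S₁ ∪ S₂).erase a) =
      (k₁ * var a + k₀) * (relPsiFrom R a (S₁.erase a) * relPsiFrom R a S₂))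
    (hI₂ : ∀ b ∈ sources R S₂, b ∉ S₁ → relPsiFrom R b ((S₁ ∪ S₂).erase b) =
      (k₁ * var b + k₀) * (relPsiFrom R b S₁ * relPsiFrom R b (S₂.erase b)))
    (hI₃ : ∀ a ∈ sources R S₁, a ∈ sources R S₂ → relPsiFrom R a ((S₁ ∪ S₂).erase a) =
      κ * (relPsiFrom R a (S₁.erase a) * relPsiFrom R a (S₂.erase a)))
    (g : V → RatFun V) :
    ∑ a ∈ sources R (S₁ ∪ S₂), g a * relPsiFrom R a ((S₁ ∪ S₂).erase a) =
      ∑ a ∈ sources R S₁, ∑ b ∈ sources R S₂,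
        (g a * (k₁ * var a + k₀) * (var a - var b)⁻¹ + g b * (k₁ * var b + k₀) * (var b - var a)⁻¹
          + if a = b then g a * κ else 0) *
        (relPsiFrom R a (S₁.erase a) * relPsiFrom R b (S₂.erase b)) := by
  rw [h.sum_sources]
  simp only [add_mul, Finset.sum_add_distrib]
  rw [add_assoc]
  congr 1
  · rw [Finset.sum_filter]
    refine Finset.sum_congr rfl fun a ha => ?_
    split_ifs with ha'
    -- At a common source the affine coefficient vanishes, so the sum over the sources outside `S₂`
    -- may be extended to all sources of `S₁`. In the other case the sum over `b` comes from
    -- expanding the factor from which `a` was not erased.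
    · have := hk a (mem_sources.1 ha).1 ha' (Or.inl ha)
      simp only [this, mul_zero, zero_mul, Finset.sum_const_zero]
    · rw [hI₁ a ha ha', relPsiFrom_eq_sum R a h₂, Finset.mul_sum, Finset.mul_sum, Finset.mul_sum]
      exact Finset.sum_congr rfl fun b _ => by ring
  · congr 1
    · rw [Finset.sum_comm, Finset.sum_filter]
      refine Finset.sum_congr rfl fun b hb => ?_
      split_ifs with hb'
      · have := hk b hb' (mem_sources.1 hb).1 (Or.inr hb)
        simp only [this, mul_zero, zero_mul, Finset.sum_const_zero]
      · rw [hI₂ b hb hb', relPsiFrom_eq_sum R b h₁, Finset.sum_mul, Finset.mul_sum, Finset.mul_sum]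
        exact Finset.sum_congr rfl fun a _ => by ring
    · have : sources R S₁ ∩ sources R S₂ = (sources R S₁).filter (· ∈ sources R S₂) := by
        ext a; simp
      rw [this, Finset.sum_filter]
      refine Finset.sum_congr rfl fun a ha => ?_
      simp only [ite_mul, zero_mul]
      rw [Finset.sum_ite_eq]
      split_ifs with ha'
      · rw [hI₃ a ha ha']
        ring
      · rfl

/-- Induction on the total size. The first letter of a word becomes the new prefix `p` of a smaller
glued pair: it is erased from one set, or from both when it is the head of `c`. It remains to
compare the coefficients attached to each pair of sources. The prefix makes the statement meaningful
for empty `c` and empty sets, where the recursion stops. -/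
theorem Glued.relPsiFrom_union {R : V → V → Prop} {S₁ S₂ : Finset V} {c : List V} {p : V}
    (h : Glued R S₁ S₂ c) (hp₁ : p ∉ S₁) (hp₂ : p ∉ S₂) :
    relPsiFrom R p (S₁ ∪ S₂) * wordPsi (p :: c) = relPsiFrom R p S₁ * relPsiFrom R p S₂ := by
  induction hn : S₁.card + S₂.card using Nat.strong_induction_on generalizing S₁ S₂ c p with
  | _ n ih =>
  subst hn
  have hcS : ∀ a ∈ c, a ∈ S₁ ∧ a ∈ S₂ := fun a ha => (h.inter a).2 ha
  rcases S₁.eq_empty_or_nonempty with rfl | h₁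
  · have : c = [] := List.eq_nil_iff_forall_not_mem.2 fun a ha => by simpa using (hcS a ha).1
    simp [this]
  rcases S₂.eq_empty_or_nonempty with rfl | h₂
  · have : c = [] := List.eq_nil_iff_forall_not_mem.2 fun a ha => by simpa using (hcS a ha).2
    simp [this]
  have hpc : p ∉ c := fun hc => hp₁ (hcS p hc).1
  have hψ : ∀ a, a ∉ c → wordPsi (a :: c) ≠ 0 := fun a ha =>
    wordPsi_ne_zero (List.nodup_cons.2 ⟨ha, h.nodup⟩)
  obtain ⟨k₀, k₁, hk, hkx, -⟩ := exists_wordPsi_cons_inv c h.nodup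
  have key := h.sum_step h₁ h₂ k₀ k₁ (wordPsi c)⁻¹ ?_ ?_ ?_ ?_ (fun a => (var p - var a)⁻¹)
  · rw [relPsiFrom_eq_sum R p (h₁.mono Finset.subset_union_left), key, Finset.sum_mul,
      relPsiFrom_eq_sum R p h₁, relPsiFrom_eq_sum R p h₂, Finset.sum_mul_sum]
    refine Finset.sum_congr rfl fun a ha => ?_
    rw [Finset.sum_mul]
    refine Finset.sum_congr rfl fun b hb => ?_
    have ha1 := (mem_sources.1 ha).1
    have hb1 := (mem_sources.1 hb).1
    have hpa : var p - var a ≠ 0 := var_sub_ne_zero (fun e => hp₁ (e ▸ ha1))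
    have hpb : var p - var b ≠ 0 := var_sub_ne_zero (fun e => hp₂ (e ▸ hb1))
    have hpk := hk p hpc
    have hk1 : (k₁ * var p + k₀) * wordPsi (p :: c) = 1 := by
      rw [hpk, inv_mul_cancel₀ (hψ p hpc)]
    -- For a ≠ b this is Lagrange interpolation at x_a and x_b of the affine function k₁ x + k₀,
    -- evaluated at x_p and divided by (x_p - x_a)(x_p - x_b). For a = b this element is the head of
    -- `c`, a zero of the function, and the first two terms vanish (also `0⁻¹ = 0`).
    have hcoef : (var p - var a)⁻¹ * (k₁ * var a + k₀) * (var a - var b)⁻¹ +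
        (var p - var b)⁻¹ * (k₁ * var b + k₀) * (var b - var a)⁻¹ +
        (if a = b then (var p - var a)⁻¹ * (wordPsi c)⁻¹ else 0) =
        (k₁ * var p + k₀) * ((var p - var a)⁻¹ * (var p - var b)⁻¹) := by
      split_ifs with hab
      · subst hab
        have hac : a ∈ c := (h.inter a).1 ⟨ha1, hb1⟩
        cases c with
        | nil => simp at hac
        | cons x l =>
          have hax := h.eq_head_of_mem_sources ha hac
          subst hax
          obtain ⟨h3, h4⟩ := hkx a l rfl
          have : k₁ * var p + k₀ = k₁ * (var p - var a) := by linear_combination h3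
          rw [this, ← h4, sub_self, inv_zero]
          field_simp
          ring
      · have hab' : var a - var b ≠ 0 := var_sub_ne_zero hab
        have : (var b - var a)⁻¹ = -(var a - var b)⁻¹ := by rw [← neg_sub, inv_neg]
        rw [this]
        field_simp
        ring
    rw [hcoef]
    linear_combination ((var p - var a)⁻¹ * (var p - var b)⁻¹ * (relPsiFrom R a (S₁.erase a) *
      relPsiFrom R b (S₂.erase b))) * hk1
  · intro a ha1 ha2 hs
    have hac : a ∈ c := (h.inter a).1 ⟨ha1, ha2⟩
    cases c with
    | nil => simp at hac
    | cons x l =>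
      have hax : a = x := by
        rcases hs with hs | hs
        exacts [h.eq_head_of_mem_sources hs hac, h.symm.eq_head_of_mem_sources hs hac]
      subst hax
      exact (hkx a l rfl).1
  · intro a ha ha2
    have ha1 := (mem_sources.1 ha).1
    have hac : a ∉ c := fun hc => ha2 (hcS a hc).2
    have := ih _ (Nat.add_lt_add_right (Finset.card_erase_lt_of_mem ha1) _) (h.erase_left ha2)
      (Finset.notMem_erase a S₁) ha2 rfl
    rw [Finset.erase_union_distrib, Finset.erase_eq_of_notMem ha2, hk a hac, ← this]
    rw [mul_comm, mul_assoc, mul_inv_cancel₀ (hψ a hac), mul_one]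
  · intro b hb hb1
    have hb2 := (mem_sources.1 hb).1
    have hbc : b ∉ c := fun hc => hb1 (hcS b hc).1
    have := ih _ (Nat.add_lt_add_left (Finset.card_erase_lt_of_mem hb2) _)
      (h.symm.erase_left hb1).symm hb1 (Finset.notMem_erase b S₂) rfl
    rw [Finset.erase_union_distrib, Finset.erase_eq_of_notMem hb1, hk b hbc, ← this]
    rw [mul_comm, mul_assoc, mul_inv_cancel₀ (hψ b hbc), mul_one]
  · intro a ha hb
    have ha1 := (mem_sources.1 ha).1
    have hb1 := (mem_sources.1 hb).1
    have hac : a ∈ c := (h.inter a).1 ⟨ha1, hb1⟩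
    cases c with
    | nil => simp at hac
    | cons x l =>
      have hax := h.eq_head_of_mem_sources ha hac
      subst hax
      have := ih _ (Nat.add_lt_add (Finset.card_erase_lt_of_mem ha1)
        (Finset.card_erase_lt_of_mem hb1)) h.erase_both (Finset.notMem_erase a S₁)
        (Finset.notMem_erase a S₂) rfl
      rw [Finset.erase_union_distrib, ← this, mul_comm, mul_assoc,
        mul_inv_cancel₀ (wordPsi_ne_zero h.nodup), mul_one]

/-- `Ψ` of a set glued along a non-empty chain. -/
theorem Glued.relPsi_union {R : V → V → Prop} {S₁ S₂ : Finset V} {c : List V}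
    (h : Glued R S₁ S₂ c) (h₁ : S₁.Nonempty) (h₂ : S₂.Nonempty) :
    relPsi R (S₁ ∪ S₂) = (if c = [] then 0 else (wordPsi c)⁻¹) * (relPsi R S₁ * relPsi R S₂) := by
  have hcS : ∀ a ∈ c, a ∈ S₁ ∧ a ∈ S₂ := fun a ha => (h.inter a).2 ha
  have hψ : ∀ a, a ∉ c → wordPsi (a :: c) ≠ 0 := fun a ha =>
    wordPsi_ne_zero (List.nodup_cons.2 ⟨ha, h.nodup⟩)
  obtain ⟨k₀, k₁, hk, hkx, hk0⟩ := exists_wordPsi_cons_inv c h.nodup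
  have key := h.sum_step h₁ h₂ k₀ k₁ (wordPsi c)⁻¹ ?_ ?_ ?_ ?_ (fun _ => 1)
  · rw [relPsi_eq_sum R (h₁.mono Finset.subset_union_left)]
    simp only [one_mul] at key
    rw [key, relPsi_eq_sum R h₁, relPsi_eq_sum R h₂, Finset.sum_mul_sum, Finset.mul_sum]
    refine Finset.sum_congr rfl fun a ha => ?_
    rw [Finset.mul_sum]
    refine Finset.sum_congr rfl fun b hb => ?_
    have ha1 := (mem_sources.1 ha).1
    have hb1 := (mem_sources.1 hb).1
    congr 1
    -- Without a prefix the coefficient of a pair is the divided difference of the affine function,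
    -- that is its slope `k₁`; it is 1/ψ_c, or 0 for the empty chain.
    have hk1 : (if c = [] then 0 else (wordPsi c)⁻¹) = k₁ := by
      cases c with
      | nil => simp [hk0]
      | cons x l => simp [(hkx x l rfl).2]
    rw [hk1]
    split_ifs with hab
    · subst hab
      have hac : a ∈ c := (h.inter a).1 ⟨ha1, hb1⟩
      cases c with
      | nil => simp at hac
      | cons x l =>
        rw [(hkx x l rfl).2]
        simp
    · have hab' : var a - var b ≠ 0 := var_sub_ne_zero hab
      have : (var b - var a)⁻¹ = -(var a - var b)⁻¹ := by rw [← neg_sub, inv_neg]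
      rw [this]
      field_simp
      ring
  · intro a ha1 ha2 hs
    have hac : a ∈ c := (h.inter a).1 ⟨ha1, ha2⟩
    cases c with
    | nil => simp at hac
    | cons x l =>
      have hax : a = x := by
        rcases hs with hs | hs
        exacts [h.eq_head_of_mem_sources hs hac, h.symm.eq_head_of_mem_sources hs hac]
      subst hax
      exact (hkx a l rfl).1
  · intro a ha ha2
    have hac : a ∉ c := fun hc => ha2 (hcS a hc).2
    have := (h.erase_left ha2).relPsiFrom_union (Finset.notMem_erase a S₁) ha2
    rw [Finset.erase_union_distrib, Finset.erase_eq_of_notMem ha2, hk a hac, ← this]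
    rw [mul_comm, mul_assoc, mul_inv_cancel₀ (hψ a hac), mul_one]
  · intro b hb hb1
    have hbc : b ∉ c := fun hc => hb1 (hcS b hc).1
    have := (h.symm.erase_left hb1).symm.relPsiFrom_union hb1 (Finset.notMem_erase b S₂)
    rw [Finset.erase_union_distrib, Finset.erase_eq_of_notMem hb1, hk b hbc, ← this]
    rw [mul_comm, mul_assoc, mul_inv_cancel₀ (hψ b hbc), mul_one]
  · intro a ha hb
    have hac : a ∈ c := (h.inter a).1 ⟨(mem_sources.1 ha).1, (mem_sources.1 hb).1⟩
    cases c with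
    | nil => simp at hac
    | cons x l =>
      have hax := h.eq_head_of_mem_sources ha hac
      subst hax
      have := h.erase_both.relPsiFrom_union (Finset.notMem_erase a S₁) (Finset.notMem_erase a S₂)
      rw [Finset.erase_union_distrib, ← this, mul_comm, mul_assoc,
        mul_inv_cancel₀ (wordPsi_ne_zero h.nodup), mul_one]

/-- `Ψ` vanishes on a disconnected set. -/
theorem relPsi_union_eq_zero {R : V → V → Prop} {S₁ S₂ : Finset V} (h₁ : S₁.Nonempty)
    (h₂ : S₂.Nonempty) (hd : Disjoint S₁ S₂) (hR : ∀ a ∈ S₁, ∀ b ∈ S₂, ¬ R a b ∧ ¬ R b a) :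
    relPsi R (S₁ ∪ S₂) = 0 := by
  have h : Glued R S₁ S₂ [] := ⟨fun a => by simpa using fun h => Finset.disjoint_left.1 hd h,
    List.nodup_nil, List.isChain_nil, fun a ha b hb _ _ => (hR a ha b hb).1,
    fun a ha b hb _ _ => (hR a ha b hb).2⟩
  simp [h.relPsi_union h₁ h₂]

theorem pairwise_not_rel_iff {R : V → V → Prop} {w : List V} (hw : w.Nodup) :
    w.Pairwise (fun a b => ¬ R b a) ↔
      ∀ a ∈ w, ∀ b ∈ w, R a b → w.idxOf a ≤ w.idxOf b := by
  induction w with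
  | nil => simp
  | cons x w ih =>
    have hx := (List.nodup_cons.1 hw).1
    rw [List.pairwise_cons, ih hw.of_cons]
    have hne : ∀ a ∈ w, x ≠ a := fun a ha e => hx (e ▸ ha)
    constructor
    · rintro ⟨h1, h2⟩ a ha b hb hab
      rcases List.mem_cons.1 ha with rfl | ha'
      · simp
      rcases List.mem_cons.1 hb with rfl | hb'
      · exact absurd hab (h1 a ha')
      rw [List.idxOf_cons_ne _ (hne a ha'), List.idxOf_cons_ne _ (hne b hb')]
      exact Nat.succ_le_succ (h2 a ha' b hb' hab)
    · intro h
      refine ⟨fun b hb hbx => ?_, fun a ha b hb hab => ?_⟩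
      · have := h b (List.mem_cons_of_mem _ hb) x List.mem_cons_self hbx
        rw [List.idxOf_cons_ne _ (hne b hb), List.idxOf_cons_self] at this
        omega
      · have := h a (List.mem_cons_of_mem _ ha) b (List.mem_cons_of_mem _ hb) hab
        rw [List.idxOf_cons_ne _ (hne a ha), List.idxOf_cons_ne _ (hne b hb)] at this
        omega

theorem mem_extensions_iff_idxOf {R : V → V → Prop} {S : Finset V} {w : List V} :
    w ∈ extensions R S ↔ (w : Multiset V) = S.val ∧
      ∀ a ∈ S, ∀ b ∈ S, R a b → w.idxOf a ≤ w.idxOf b := by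
  rw [mem_extensions]
  refine and_congr_right fun h => ?_
  have hw : w.Nodup := by
    rw [← Multiset.coe_nodup, h]
    exact S.nodup
  have hm : ∀ a, a ∈ w ↔ a ∈ S := fun a => by
    rw [← Multiset.mem_coe, h, Finset.mem_val]
  rw [pairwise_not_rel_iff hw]
  simp only [hm]

/-- Linear extensions do not change when relations deduced by transitivity are added. -/
theorem relPsi_congr {R R' : V → V → Prop} {S : Finset V}
    (h : ∀ a ∈ S, ∀ b ∈ S, R a b → R' a b)
    (h' : ∀ a ∈ S, ∀ b ∈ S, R' a b →
      Relation.ReflTransGen (fun x y => x ∈ S ∧ y ∈ S ∧ R x y) a b) :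
    relPsi R S = relPsi R' S := by
  refine Finset.sum_congr (Finset.ext fun w => ?_) fun _ _ => rfl
  rw [mem_extensions_iff_idxOf, mem_extensions_iff_idxOf]
  refine and_congr_right fun _ => ⟨fun hw a ha b hb hab => ?_,
    fun hw a ha b hb hab => hw a ha b hb (h a ha b hb hab)⟩
  have := h' a ha b hb hab
  clear hab hb
  induction this with
  | refl => exact le_rfl
  | tail _ hxy ih => exact ih.trans (hw _ hxy.1 _ hxy.2.1 hxy.2.2)

end WordSums

/-! ### Existence of an ear in a bounded poset with a non-separating linear extension. -/

section Dismantling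

variable {Q : Type*} [PartialOrder Q] [BoundedOrder Q] [Finite Q]

/-- In a finite bounded poset with a non-separating linear extension `f` and the interpolation
property, there is an ear: a chain `A` of elements, all of whose relations with the elements outside
`A` go through two elements `u` and `w` which have something else between them. -/
theorem exists_ear_of_rank (f : Q → ℕ) (hfi : Function.Injective f)
    (hf : StrictMono f)
    (hns : ∀ a b c : Q, f a < f b → f b < f c → a < c → a < b ∨ b < c)
    (hint : ∀ a b p q : Q, a ≤ p → a ≤ q → b ≤ p → b ≤ q → ∃ e, a ≤ e ∧ b ≤ e ∧ e ≤ p ∧ e ≤ q)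
    (hchain : ∃ x y : Q, ¬ x ≤ y ∧ ¬ y ≤ x) :
    ∃ (A : Set Q) (u w t : Q), A.Nonempty ∧ IsChain (· ≤ ·) A ∧ u ∉ A ∧ w ∉ A ∧ t ∉ A ∧
      u < t ∧ t < w ∧ ∀ v ∈ A, ∀ x ∉ A, (x < v ↔ x ≤ u) ∧ (v < x ↔ w ≤ x) := by
  have hlt : ∀ {x y : Q}, x ≤ y → f x ≤ f y := fun h => hf.monotone h
  -- `b` is the first element in the order of `f` which is not above all its predecessors; those
  -- predecessors therefore form a chain.
  obtain ⟨b, ⟨a₀, hab₀, hnab₀⟩, hbmin⟩ : ∃ b : Q, (∃ a, f a < f b ∧ ¬ a < b) ∧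
      ∀ c, (∃ a, f a < f c ∧ ¬ a < c) → f b ≤ f c := by
    have hne : {b : Q | ∃ a, f a < f b ∧ ¬ a < b}.Nonempty := by
      obtain ⟨x, y, hxy, hyx⟩ := hchain
      have hne : f x ≠ f y := fun h => hxy (hfi h).le
      rcases lt_or_gt_of_ne hne with h | h
      exacts [⟨y, x, h, fun h => hxy h.le⟩, ⟨x, y, h, fun h => hyx h.le⟩]
    obtain ⟨b, hb, hb'⟩ := Set.exists_min_image _ f (Set.toFinite _) hne
    exact ⟨b, hb, fun c hc => hb' c hc⟩
  have hK : ∀ x y : Q, f x < f y → f y < f b → x < y := by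
    intro x y hxy hyb
    by_contra h
    exact absurd (hbmin y ⟨x, hxy, h⟩) (not_le.2 hyb)
  -- `a` is the immediate predecessor of `b` for `f`, the top of that chain; it is incomparable to
  -- `b`. The ear will be an upper segment of the chain ending at `a`.
  obtain ⟨a, hab, hamax⟩ := Set.exists_max_image {x : Q | f x < f b} f (Set.toFinite _) ⟨a₀, hab₀⟩
  have hab : f a < f b := hab
  have hamax : ∀ x, f x < f b → f x ≤ f a := hamax
  have hKa : ∀ x, f x < f b → x ≤ a := by
    intro x hx
    rcases (hamax x hx).eq_or_lt with h | h
    exacts [(hfi h).le, (hK _ _ h hab).le]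
  have hnab : ¬ a ≤ b := fun h =>
    hnab₀ ((hKa a₀ hab₀).trans_lt (lt_of_le_of_ne h fun e => by simp [e] at hab))
  have hnba : ¬ b ≤ a := fun h => absurd (hlt h) (not_le.2 hab)
  have hout : ∀ q, ¬ q ≤ a → f b ≤ f q := fun q hq => not_lt.1 fun h => hq (hKa q h)
  have hbq : ∀ q, a < q → b < q := by
    intro q hq
    have h1 : f b < f q := lt_of_le_of_ne (hout q hq.not_ge) fun e =>
      hnab ((hfi e) ▸ hq.le)
    exact (hns a b q hab h1 hq).resolve_left fun h => hnab h.le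
  have hatop : a < ⊤ := lt_of_le_of_ne le_top fun e => hnba (e ▸ le_top)
  -- By non-separation everything above `a` is above `b`. Interpolating between {a, b} and two
  -- elements above `a` then shows that a candidate of least rank is the least element above `a`.
  obtain ⟨w, haw, hwmin⟩ := Set.exists_min_image {q : Q | a < q} f (Set.toFinite _) ⟨⊤, hatop⟩
  have haw : a < w := haw
  have hw : ∀ q, a < q → w ≤ q := by
    intro q hq
    obtain ⟨e, hae, hbe, hew, heq⟩ := hint a b w q haw.le hq.le (hbq w haw).le (hbq q hq).le
    have hae' : a < e := lt_of_le_of_ne hae fun h => hnba (h ▸ hbe)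
    have : f w ≤ f e := hwmin e hae'
    have hwe : w = e := hfi (le_antisymm this (hlt hew))
    exact hwe ▸ heq
  have hbw := hbq w haw
  -- `u` is the last element of the chain from which one can leave towards something incomparable to
  -- `a`; `⊥` is a candidate because of `b`. Past `u` every ascending path either stays in the chain
  -- or goes above `a`, hence above `w`.
  obtain ⟨u, ⟨hua, y, huy, hya, hay⟩, humax⟩ := Set.exists_max_image
    {x : Q | x ≤ a ∧ ∃ y, x < y ∧ ¬ y ≤ a ∧ ¬ a ≤ y} f (Set.toFinite _)
    ⟨⊥, bot_le, b, lt_of_le_of_ne bot_le fun e => hnba (e ▸ bot_le), hnba, hnab⟩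
  have hua' : u < a := lt_of_le_of_ne hua fun e => hay (e ▸ huy.le)
  have hAexit : ∀ v, u < v → v ≤ a → ∀ x, v < x → x ≤ a ∨ a ≤ x := by
    intro v huv hva x hvx
    by_contra hcon
    rw [not_or] at hcon
    exact absurd (humax v ⟨hva, x, hvx, hcon⟩) (not_le.2 (hf huv))
  have hcomp : ∀ x y, x ≤ a → y ≤ a → x ≤ y ∨ y ≤ x := by
    intro x y hx hy
    have hx' := (hlt hx).trans_lt hab
    have hy' := (hlt hy).trans_lt hab
    rcases lt_trichotomy (f x) (f y) with h | h | h
    exacts [Or.inl (hK _ _ h hy').le, Or.inl (hfi h).le, Or.inr (hK _ _ h hx').le]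
  obtain ⟨t, hta, hut, htw⟩ : ∃ t, ¬ t ≤ a ∧ u < t ∧ t < w := by
    by_cases hub : u < b
    · exact ⟨b, hnba, hub, hbw⟩
    -- If `b` is not above `u`, non-separation of u < y puts `b` below `y`, and an element
    -- interpolated between {u, b} and {y, w} serves as `t`. It differs from `w` because `y` is not
    -- above `a`.
    have hby : f b < f y := lt_of_le_of_ne (hout y hya) fun e => hub (hfi e ▸ huy)
    have hfu : f u < f b := (hlt hua).trans_lt hab
    have hby' : b < y := (hns u b y hfu hby huy).resolve_left hub
    obtain ⟨e, hue, hbe, hey, hew⟩ := hint u b y w huy.le (hua.trans haw.le) hby'.le hbw.le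
    refine ⟨e, fun h => hnba (hbe.trans h), lt_of_le_of_ne hue ?_, lt_of_le_of_ne hew ?_⟩
    · rintro rfl
      exact absurd (hlt hbe) (not_le.2 hfu)
    · rintro rfl
      exact hay (haw.le.trans hey)
  refine ⟨{v | u < v ∧ v ≤ a}, u, w, t, ⟨a, hua', le_rfl⟩, ?_, fun h => lt_irrefl _ h.1,
    fun h => haw.not_ge h.2, fun h => hta h.2, hut, htw, ?_⟩
  · intro x hx y hy _
    exact hcomp x y hx.2 hy.2
  · rintro v ⟨huv, hva⟩ x hx
    refine ⟨⟨fun h => ?_, fun h => h.trans_lt huv⟩, ⟨fun h => ?_, fun h => (hva.trans_lt haw).trans_le h⟩⟩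
    · rcases hcomp x u (h.le.trans hva) hua with h' | h'
      · exact h'
      · by_contra hxu
        exact hx ⟨lt_of_le_of_ne h' fun e => hxu e.ge, h.le.trans hva⟩
    · rcases hAexit v huv hva x h with h' | h'
      · exact absurd ⟨huv.trans h, h'⟩ hx
      · exact hw x (lt_of_le_of_ne h' fun e => hx ⟨huv.trans h, e.ge⟩)

end Dismantling

/-! ### Broken lines drawn by saturated chains. -/

section PlanarDrawings

/-- The height at abscissa `t` of the line through the points `P` and `Q`. -/
noncomputable def lineThrough (P Q : ℝ × ℝ) (t : ℝ) : ℝ :=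
  P.2 + (t - P.1) / (Q.1 - P.1) * (Q.2 - P.2)

@[fun_prop]
theorem continuous_lineThrough (P Q : ℝ × ℝ) : Continuous (lineThrough P Q) := by
  unfold lineThrough
  fun_prop

theorem lineThrough_left (P Q : ℝ × ℝ) : lineThrough P Q P.1 = P.2 := by
  simp [lineThrough]

theorem lineThrough_right {P Q : ℝ × ℝ} (h : P.1 < Q.1) : lineThrough P Q Q.1 = Q.2 := by
  have : Q.1 - P.1 ≠ 0 := (sub_pos.2 h).ne'
  simp [lineThrough, this]

theorem lineThrough_mem_segment {P Q : ℝ × ℝ} (h : P.1 < Q.1) {t : ℝ} (h₁ : P.1 ≤ t)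
    (h₂ : t ≤ Q.1) : (t, lineThrough P Q t) ∈ segment ℝ P Q := by
  have h0 : 0 < Q.1 - P.1 := sub_pos.2 h
  rw [segment_eq_image']
  refine ⟨(t - P.1) / (Q.1 - P.1), ⟨div_nonneg (by linarith) h0.le, ?_⟩, ?_⟩
  · rw [div_le_one h0]
    linarith
  · ext
    · simp [div_mul_cancel₀ _ h0.ne']
    · simp [lineThrough]

variable {Q : Type*}

/-- The function whose graph is the broken line through the points of a list. -/
noncomputable def brokenLine (p : Q → ℝ × ℝ) : List Q → ℝ → ℝ
  | [], _ => 0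
  | [a], _ => (p a).2
  | a :: b :: l, t => if t ≤ (p b).1 then lineThrough (p a) (p b) t else brokenLine p (b :: l) t

variable [PartialOrder Q]

/-- A drawing of the Hasse diagram of a poset with straight segments from left to right, without
crossings. -/
structure HasseDrawing (p : Q → ℝ × ℝ) : Prop where
  left_to_right : ∀ a b : Q, a ⋖ b → (p a).1 < (p b).1
  vertex_edge : ∀ v a b : Q, a ⋖ b → p v ∈ segment ℝ (p a) (p b) → v = a ∨ v = b
  edge_edge : ∀ a b c d : Q, a ⋖ b → c ⋖ d → (a, b) ≠ (c, d) →
    ∀ q, q ∈ segment ℝ (p a) (p b) → q ∈ segment ℝ (p c) (p d) →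
      ∃ v, (v = a ∨ v = b) ∧ (v = c ∨ v = d) ∧ q = p v

variable {p : Q → ℝ × ℝ}

theorem brokenLine_head (hp : ∀ a b : Q, a ⋖ b → (p a).1 < (p b).1) {a : Q} {l : List Q}
    (h : (a :: l).IsChain (· ⋖ ·)) : brokenLine p (a :: l) (p a).1 = (p a).2 := by
  cases l with
  | nil => rfl
  | cons b l =>
    rw [brokenLine, if_pos (hp a b (List.isChain_cons_cons.1 h).1).le, lineThrough_left]

theorem continuous_brokenLine (hp : ∀ a b : Q, a ⋖ b → (p a).1 < (p b).1) :
    ∀ {l : List Q}, l.IsChain (· ⋖ ·) → Continuous (brokenLine p l)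
  | [], _ => continuous_const
  | [_], _ => continuous_const
  | a :: b :: l, h => by
    have hab := hp a b (List.isChain_cons_cons.1 h).1
    have h2 := (List.isChain_cons_cons.1 h).2
    have : brokenLine p (a :: b :: l) =
        fun t => if t ≤ (p b).1 then lineThrough (p a) (p b) t else brokenLine p (b :: l) t := rfl
    rw [this]
    refine Continuous.if_le (continuous_lineThrough _ _) (continuous_brokenLine hp h2)
      continuous_id continuous_const ?_
    rintro t rfl
    rw [brokenLine_head hp h2, lineThrough_right hab]

theorem head_le_of_isChain {a : Q} {l : List Q} (h : (a :: l).IsChain (· ⋖ ·)) :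
    ∀ b ∈ a :: l, a ≤ b := by
  have h1 : (a :: l).IsChain (· ≤ ·) := h.imp fun _ _ h => h.le
  intro b hb
  rcases List.mem_cons.1 hb with rfl | hb
  · exact le_rfl
  · exact List.rel_of_pairwise_cons h1.pairwise hb

variable [Finite Q]

theorem HasseDrawing.lt (hp : HasseDrawing p) {a b : Q} (h : a < b) : (p a).1 < (p b).1 := by
  cases nonempty_fintype Q
  classical
  have : LocallyFiniteOrder Q := Fintype.toLocallyFiniteOrder
  have h1 := transGen_covBy_of_lt h
  clear h
  induction h1 with
  | single h => exact hp.left_to_right _ _ h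
  | tail _ h ih => exact ih.trans (hp.left_to_right _ _ h)

theorem HasseDrawing.le (hp : HasseDrawing p) {a b : Q} (h : a ≤ b) : (p a).1 ≤ (p b).1 := by
  rcases h.eq_or_lt with rfl | h
  exacts [le_rfl, (hp.lt h).le]

theorem HasseDrawing.brokenLine_vertex (hp : HasseDrawing p) {l : List Q}
    (h : l.IsChain (· ⋖ ·)) {v : Q} (hv : v ∈ l) : brokenLine p l (p v).1 = (p v).2 := by
  induction l with
  | nil => simp at hv
  | cons a l ih =>
    rcases List.mem_cons.1 hv with rfl | hv'
    · exact brokenLine_head hp.left_to_right h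
    cases l with
    | nil => simp at hv'
    | cons b l =>
      have h2 := (List.isChain_cons_cons.1 h).2
      have hab := hp.left_to_right a b (List.isChain_cons_cons.1 h).1
      rw [brokenLine]
      split_ifs with hvb
      · have : b = v := by
          by_contra hne
          exact absurd hvb (not_le.2 (hp.lt (lt_of_le_of_ne (head_le_of_isChain h2 v hv') hne)))
        rw [← this, lineThrough_right hab]
      · exact ih h2 hv'

/-- On each abscissa in its range, a broken line coincides with an edge. -/
theorem HasseDrawing.exists_edge (hp : HasseDrawing p) {a : Q} {l : List Q}
    (h : (a :: l).IsChain (· ⋖ ·)) (hl : l ≠ []) {t : ℝ} (ht : (p a).1 ≤ t)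
    (ht' : t ≤ (p ((a :: l).getLast (List.cons_ne_nil a l))).1) :
    ∃ b c, b ∈ a :: l ∧ c ∈ a :: l ∧ b ⋖ c ∧ (p b).1 ≤ t ∧ t ≤ (p c).1 ∧
      ∀ s, (p b).1 ≤ s → s ≤ (p c).1 → brokenLine p (a :: l) s = lineThrough (p b) (p c) s := by
  induction l generalizing a with
  | nil => exact absurd rfl hl
  | cons b l ih =>
    have h2 := (List.isChain_cons_cons.1 h).2
    have hab := (List.isChain_cons_cons.1 h).1
    by_cases htb : t ≤ (p b).1
    · refine ⟨a, b, by simp, by simp, hab, ht, htb, fun s _ hs => ?_⟩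
      rw [brokenLine, if_pos hs]
    · rw [not_le] at htb
      have hl' : l ≠ [] := by
        rintro rfl
        simp at ht'
        linarith
      rw [List.getLast_cons (List.cons_ne_nil b l)] at ht'
      obtain ⟨c, d, hc, hd, hcd, hct, htd, hs⟩ := ih h2 hl' htb.le ht'
      refine ⟨c, d, List.mem_cons_of_mem _ hc, List.mem_cons_of_mem _ hd, hcd, hct, htd,
        fun s hs1 hs2 => ?_⟩
      rw [brokenLine, ← hs s hs1 hs2]
      split_ifs with hsb
      -- The two branches of the definition overlap only at the abscissa of the vertex `b`, where
      -- they agree.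
      · have hbc := hp.le (head_le_of_isChain h2 c hc)
        have : s = (p b).1 := le_antisymm hsb (hbc.trans hs1)
        rw [this, lineThrough_right (hp.left_to_right _ _ hab),
          brokenLine_head hp.left_to_right h2]
      · rfl

end PlanarDrawings

/-! ### Maximal chains of a planar drawing, the relation "below", and the sweep order. -/

section PlanarDrawings

variable {Q : Type*} [PartialOrder Q]

theorem exists_covBy_path_append {a b : Q} {l₁ l₂ : List Q} (h₁ : (a :: l₁).IsChain (· ⋖ ·))
    (hb : (a :: l₁).getLast (List.cons_ne_nil a l₁) = b) (h₂ : (b :: l₂).IsChain (· ⋖ ·)) :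
    (a :: (l₁ ++ l₂)).IsChain (· ⋖ ·) ∧
      (a :: (l₁ ++ l₂)).getLast (List.cons_ne_nil _ _) = (b :: l₂).getLast (List.cons_ne_nil _ _) ∧
      b ∈ a :: (l₁ ++ l₂) := by
  induction l₁ generalizing a with
  | nil =>
    obtain rfl : a = b := hb
    exact ⟨h₂, rfl, by simp⟩
  | cons c l ih =>
    rw [List.getLast_cons (List.cons_ne_nil c l)] at hb
    obtain ⟨h3, h4, h5⟩ := ih (List.isChain_cons_cons.1 h₁).2 hb
    refine ⟨List.isChain_cons_cons.2 ⟨(List.isChain_cons_cons.1 h₁).1, h3⟩, ?_,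
      List.mem_cons_of_mem _ h5⟩
    rw [← h4]
    exact List.getLast_cons _

variable [Finite Q]

theorem exists_covBy_path {a b : Q} (h : a ≤ b) : ∃ l : List Q, (a :: l).IsChain (· ⋖ ·) ∧
    (a :: l).getLast (List.cons_ne_nil a l) = b := by
  cases nonempty_fintype Q
  classical
  have : LocallyFiniteOrder Q := Fintype.toLocallyFiniteOrder
  exact List.exists_isChain_cons_of_relationReflTransGen (le_iff_reflTransGen_covBy.1 h)

variable [BoundedOrder Q]

/-- A list is a maximal chain from the bottom to the top element. -/
structure IsFullChain (C : List Q) : Prop where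
  chain : C.IsChain (· ⋖ ·)
  head : ∃ l, C = ⊥ :: l
  last : ⊤ ∈ C

omit [Finite Q] in
theorem IsFullChain.comparable {C : List Q} (h : IsFullChain C) {a b : Q} (ha : a ∈ C)
    (hb : b ∈ C) : a ≤ b ∨ b ≤ a := by
  have h1 : C.Pairwise (· ≤ ·) := (h.chain.imp (S := (· ≤ ·)) fun _ _ h => h.le).pairwise
  by_contra hcon
  have h2 : C.Pairwise (fun x y => x ≤ y ∨ y ≤ x) := h1.imp Or.inl
  by_cases hab : a = b
  · exact hcon (Or.inl hab.le)
  · have : Std.Symm (fun x y : Q => x ≤ y ∨ y ≤ x) := ⟨fun _ _ h => h.symm⟩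
    exact hcon (h2.forall ha hb hab)

theorem exists_isFullChain {x y : Q} (h : x ≤ y) : ∃ C : List Q, IsFullChain C ∧ x ∈ C ∧ y ∈ C := by
  obtain ⟨l₁, h₁, e₁⟩ := exists_covBy_path (bot_le : ⊥ ≤ x)
  obtain ⟨l₂, h₂, e₂⟩ := exists_covBy_path h
  obtain ⟨l₃, h₃, e₃⟩ := exists_covBy_path (le_top : y ≤ ⊤)
  obtain ⟨h4, e4, m4⟩ := exists_covBy_path_append h₂ e₂ h₃
  obtain ⟨h5, e5, m5⟩ := exists_covBy_path_append h₁ e₁ h4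
  have m6 : y ∈ ⊥ :: (l₁ ++ (l₂ ++ l₃)) := by
    rcases List.mem_cons.1 m4 with rfl | m4
    · exact m5
    · exact List.mem_cons_of_mem _ (List.mem_append_right _ m4)
  refine ⟨_, ⟨h5, ⟨_, rfl⟩, ?_⟩, m5, m6⟩
  have : (⊥ :: (l₁ ++ (l₂ ++ l₃))).getLast (List.cons_ne_nil _ _) = ⊤ := by rw [e5, e4, e₃]
  rw [← this]
  exact List.getLast_mem _

variable {p : Q → ℝ × ℝ}

theorem HasseDrawing.lt_of_mem (hp : HasseDrawing p) {C : List Q} (h : IsFullChain C) {a b : Q}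
    (ha : a ∈ C) (hb : b ∈ C) (hab : (p a).1 < (p b).1) : a < b := by
  rcases h.comparable ha hb with h1 | h1
  · exact lt_of_le_of_ne h1 fun e => by simp [e] at hab
  · exact absurd (hp.le h1) (not_le.2 hab)

theorem HasseDrawing.exists_edge_of_isFullChain [Nontrivial Q] (hp : HasseDrawing p) {C : List Q}
    (h : IsFullChain C) {t : ℝ} (ht : (p ⊥).1 ≤ t) (ht' : t ≤ (p ⊤).1) :
    ∃ b c, b ∈ C ∧ c ∈ C ∧ b ⋖ c ∧ (p b).1 ≤ t ∧ t ≤ (p c).1 ∧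
      ∀ s, (p b).1 ≤ s → s ≤ (p c).1 → brokenLine p C s = lineThrough (p b) (p c) s := by
  obtain ⟨l, rfl⟩ := h.head
  have hl : l ≠ [] := by
    rintro rfl
    exact bot_ne_top (List.mem_singleton.1 h.last).symm
  refine hp.exists_edge h.chain hl ht (ht'.trans (hp.le ?_))
  have h1 : (⊥ :: l).IsChain (· ≤ ·) := h.chain.imp fun _ _ h => h.le
  exact h1.pairwise.rel_getLast h.last

/-- A vertex on a broken line belongs to the corresponding chain. -/
theorem HasseDrawing.brokenLine_ne [Nontrivial Q] (hp : HasseDrawing p) {C : List Q}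
    (h : IsFullChain C) {v : Q} (hv : v ∉ C) : brokenLine p C (p v).1 ≠ (p v).2 := by
  intro he
  obtain ⟨b, c, hb, hc, hbc, h1, h2, h3⟩ :=
    hp.exists_edge_of_isFullChain h (hp.le bot_le : (p ⊥).1 ≤ (p v).1) (hp.le le_top)
  have h4 := lineThrough_mem_segment (hp.left_to_right _ _ hbc) h1 h2
  rw [← h3 _ h1 h2, he] at h4
  rcases hp.vertex_edge v b c hbc h4 with rfl | rfl
  exacts [hv hb, hv hc]

/-- Two chains which cross have a common vertex. -/
theorem HasseDrawing.exists_common [Nontrivial Q] (hp : HasseDrawing p) {C D : List Q}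
    (hC : IsFullChain C) (hD : IsFullChain D) {s t : ℝ} (hst : s < t) (hs : (p ⊥).1 ≤ s)
    (ht : t ≤ (p ⊤).1) (h₁ : brokenLine p C s < brokenLine p D s)
    (h₂ : brokenLine p D t < brokenLine p C t) :
    ∃ e, e ∈ C ∧ e ∈ D ∧ s < (p e).1 ∧ (p e).1 < t := by
  have hcont : Continuous (fun r => brokenLine p C r - brokenLine p D r) :=
    (continuous_brokenLine hp.left_to_right hC.chain).sub
      (continuous_brokenLine hp.left_to_right hD.chain)
  obtain ⟨r, ⟨hsr, hrt⟩, hr⟩ := intermediate_value_Ioo hst.le hcont.continuousOn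
    (show (0 : ℝ) ∈ Set.Ioo _ _ from ⟨sub_neg.2 h₁, sub_pos.2 h₂⟩)
  have hr : brokenLine p C r = brokenLine p D r := sub_eq_zero.1 hr
  have hr1 : (p ⊥).1 ≤ r := hs.trans hsr.le
  have hr2 : r ≤ (p ⊤).1 := hrt.le.trans ht
  obtain ⟨a, b, ha, hb, hab, h3, h4, h5⟩ := hp.exists_edge_of_isFullChain hC hr1 hr2
  obtain ⟨c, d, hc, hd, hcd, h6, h7, h8⟩ := hp.exists_edge_of_isFullChain hD hr1 hr2
  -- The lines meet at abscissa `r` on an edge of each. If it is the same edge, its origin lies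
  -- right of `s`, since otherwise the lines would already agree at `s`. Two distinct edges can meet
  -- only at a common vertex.
  by_cases he : (a, b) = (c, d)
  · obtain ⟨rfl, rfl⟩ := Prod.mk.inj he
    refine ⟨a, ha, hc, ?_, h3.trans_lt hrt⟩
    by_contra hcon
    rw [not_lt] at hcon
    rw [h5 s hcon (hsr.le.trans h4), h8 s hcon (hsr.le.trans h4)] at h₁
    exact lt_irrefl _ h₁
  · have q1 := lineThrough_mem_segment (hp.left_to_right _ _ hab) h3 h4
    have q2 := lineThrough_mem_segment (hp.left_to_right _ _ hcd) h6 h7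
    rw [← h5 r h3 h4, hr] at q1
    rw [← h8 r h6 h7] at q2
    obtain ⟨v, hv1, hv2, hv⟩ := hp.edge_edge a b c d hab hcd he _ q1 q2
    have hvr : (p v).1 = r := by rw [← hv]
    refine ⟨v, ?_, ?_, hvr ▸ hsr, hvr ▸ hrt⟩
    · rcases hv1 with rfl | rfl <;> assumption
    · rcases hv2 with rfl | rfl <;> assumption

/-- The chains of `C` and `D` do not cross between two vertices. -/
theorem HasseDrawing.exists_common_of_vertices [Nontrivial Q] (hp : HasseDrawing p) {C D : List Q}
    (hC : IsFullChain C) (hD : IsFullChain D) (x y : Q)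
    (h₁ : brokenLine p C (p x).1 < brokenLine p D (p x).1)
    (h₂ : brokenLine p D (p y).1 < brokenLine p C (p y).1) :
    ∃ e, e ∈ C ∧ e ∈ D ∧ ((p x).1 < (p e).1 ∧ (p e).1 < (p y).1 ∨
      (p y).1 < (p e).1 ∧ (p e).1 < (p x).1) := by
  rcases lt_trichotomy (p x).1 (p y).1 with h | h | h
  · obtain ⟨e, h1, h2, h3, h4⟩ := hp.exists_common hC hD h (hp.le bot_le) (hp.le le_top) h₁ h₂
    exact ⟨e, h1, h2, Or.inl ⟨h3, h4⟩⟩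
  · rw [h] at h₁
    exact absurd h₁ h₂.not_gt
  · obtain ⟨e, h1, h2, h3, h4⟩ := hp.exists_common hD hC h (hp.le bot_le) (hp.le le_top) h₂ h₁
    exact ⟨e, h2, h1, Or.inr ⟨h3, h4⟩⟩

/-- `x` lies below some maximal chain through `y`. -/
def LiesBelow (p : Q → ℝ × ℝ) (x y : Q) : Prop :=
  ∃ D : List Q, IsFullChain D ∧ y ∈ D ∧ (p x).2 < brokenLine p D (p x).1

section Incomparable

variable [Nontrivial Q] (hp : HasseDrawing p) {x y z : Q}

include hp

/-- If the two comparisons disagreed, the lines of `C` and `D` would cross between the abscissas of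
`x` and `y`, hence at a common element, which would then be between `x` and `y` in the order. Since
each side involves only one of the two chains, "below" will not depend on the chains chosen. -/
theorem HasseDrawing.below_aux {C D : List Q} (hC : IsFullChain C) (hD : IsFullChain D)
    (hxC : x ∈ C) (hyD : y ∈ D) (hxy : ¬ x ≤ y) (hyx : ¬ y ≤ x) :
    (p x).2 < brokenLine p D (p x).1 ↔ brokenLine p C (p y).1 < (p y).2 := by
  have hyC : y ∉ C := fun h => (hC.comparable hxC h).elim hxy hyx
  have hxD : x ∉ D := fun h => (hD.comparable h hyD).elim hxy hyx
  have key : ∀ e, e ∈ C → e ∈ D → ((p x).1 < (p e).1 ∧ (p e).1 < (p y).1 ∨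
      (p y).1 < (p e).1 ∧ (p e).1 < (p x).1) → False := by
    rintro e heC heD (⟨h1, h2⟩ | ⟨h1, h2⟩)
    · exact hxy ((hp.lt_of_mem hC hxC heC h1).trans (hp.lt_of_mem hD heD hyD h2)).le
    · exact hyx ((hp.lt_of_mem hD hyD heD h1).trans (hp.lt_of_mem hC heC hxC h2)).le
  rw [← hp.brokenLine_vertex hC.chain hxC, ← hp.brokenLine_vertex hD.chain hyD]
  have n1 : brokenLine p D (p x).1 ≠ brokenLine p C (p x).1 := by
    rw [hp.brokenLine_vertex hC.chain hxC]
    exact hp.brokenLine_ne hD hxD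
  have n2 : brokenLine p C (p y).1 ≠ brokenLine p D (p y).1 := by
    rw [hp.brokenLine_vertex hD.chain hyD]
    exact hp.brokenLine_ne hC hyC
  constructor
  · intro h
    by_contra h'
    obtain ⟨e, h1, h2, h3⟩ := hp.exists_common_of_vertices hC hD x y h
      (lt_of_le_of_ne (not_lt.1 h') n2.symm)
    exact key e h1 h2 h3
  · intro h
    by_contra h'
    obtain ⟨e, h1, h2, h3⟩ := hp.exists_common_of_vertices hC hD y x h
      (lt_of_le_of_ne (not_lt.1 h') n1)
    exact key e h1 h2 h3.symm

theorem HasseDrawing.liesBelow_iff_right {D : List Q} (hD : IsFullChain D) (hyD : y ∈ D)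
    (hxy : ¬ x ≤ y) (hyx : ¬ y ≤ x) :
    LiesBelow p x y ↔ (p x).2 < brokenLine p D (p x).1 := by
  refine ⟨?_, fun h => ⟨D, hD, hyD, h⟩⟩
  rintro ⟨D', hD', hyD', h⟩
  obtain ⟨C, hC, hxC, -⟩ := exists_isFullChain (le_refl x)
  rw [hp.below_aux hC hD hxC hyD hxy hyx]
  rwa [hp.below_aux hC hD' hxC hyD' hxy hyx] at h

theorem HasseDrawing.liesBelow_iff_left {C : List Q} (hC : IsFullChain C) (hxC : x ∈ C)
    (hxy : ¬ x ≤ y) (hyx : ¬ y ≤ x) :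
    LiesBelow p x y ↔ brokenLine p C (p y).1 < (p y).2 := by
  obtain ⟨D, hD, hyD, -⟩ := exists_isFullChain (le_refl y)
  rw [hp.liesBelow_iff_right hD hyD hxy hyx, hp.below_aux hC hD hxC hyD hxy hyx]

/-- Both relations can be tested on one line through `x`, and `y` is not on it. -/
theorem HasseDrawing.liesBelow_total (hxy : ¬ x ≤ y) (hyx : ¬ y ≤ x) :
    LiesBelow p y x ↔ ¬ LiesBelow p x y := by
  obtain ⟨C, hC, hxC, -⟩ := exists_isFullChain (le_refl x)
  rw [hp.liesBelow_iff_left hC hxC hxy hyx, hp.liesBelow_iff_right hC hxC hyx hxy, not_lt]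
  have hyC : y ∉ C := fun h => (hC.comparable hxC h).elim hxy hyx
  exact ⟨le_of_lt, fun h => lt_of_le_of_ne h (hp.brokenLine_ne hC hyC).symm⟩

/-- A chain through both `x` and `z` would pass from below to above the line of a chain through `y`.
At their common element, which lies between `x` and `z` and is comparable to `y`, one gets a
comparison of `y` with `x` or with `z`. -/
theorem HasseDrawing.not_lt_of_liesBelow (hxy : ¬ x ≤ y) (hyx : ¬ y ≤ x) (hyz : ¬ y ≤ z)
    (hzy : ¬ z ≤ y) (h₁ : LiesBelow p x y) (h₂ : LiesBelow p y z) : ¬ x ≤ z ∧ ¬ z ≤ x := by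
  obtain ⟨D, hD, hyD, -⟩ := exists_isFullChain (le_refl y)
  rw [hp.liesBelow_iff_right hD hyD hxy hyx] at h₁
  rw [hp.liesBelow_iff_left hD hyD hyz hzy] at h₂
  have key : ∀ C, IsFullChain C → x ∈ C → z ∈ C → False := by
    intro C hC hxC hzC
    rw [← hp.brokenLine_vertex hC.chain hxC] at h₁
    rw [← hp.brokenLine_vertex hC.chain hzC] at h₂
    obtain ⟨e, heC, heD, ⟨h1, h2⟩ | ⟨h1, h2⟩⟩ := hp.exists_common_of_vertices hC hD x z h₁ h₂
    · have h3 := hp.lt_of_mem hC hxC heC h1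
      have h4 := hp.lt_of_mem hC heC hzC h2
      rcases hD.comparable heD hyD with h | h
      exacts [hxy (h3.le.trans h), hyz (h.trans h4.le)]
    · have h3 := hp.lt_of_mem hC hzC heC h1
      have h4 := hp.lt_of_mem hC heC hxC h2
      rcases hD.comparable heD hyD with h | h
      exacts [hzy (h3.le.trans h), hyx (h.trans h4.le)]
  constructor
  · intro h
    obtain ⟨C, hC, hxC, hzC⟩ := exists_isFullChain h
    exact key C hC hxC hzC
  · intro h
    obtain ⟨C, hC, hzC, hxC⟩ := exists_isFullChain h
    exact key C hC hxC hzC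

/-- Here `y` has the median abscissa. The chain of `z` passes below the chain of `x` at `x`, but
above it at `y`, so they share an element whose abscissa is strictly between those of `x` and `y`.
Following one chain and then the other through that element compares `x` with `z`. -/
theorem HasseDrawing.not_cycle_aux (hxy : ¬ x ≤ y) (hyx : ¬ y ≤ x) (hyz : ¬ y ≤ z) (hzy : ¬ z ≤ y)
    (hxz : ¬ x ≤ z) (hzx : ¬ z ≤ x) (h₁ : LiesBelow p x y) (h₂ : LiesBelow p y z)
    (h₃ : LiesBelow p z x)
    (hm : (p x).1 ≤ (p y).1 ∧ (p y).1 ≤ (p z).1 ∨ (p z).1 ≤ (p y).1 ∧ (p y).1 ≤ (p x).1) :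
    False := by
  obtain ⟨C, hC, hxC, -⟩ := exists_isFullChain (le_refl x)
  obtain ⟨E, hE, hzE, -⟩ := exists_isFullChain (le_refl z)
  have e1 := (hp.liesBelow_iff_left hC hxC hxy hyx).1 h₁
  have e2 := (hp.liesBelow_iff_right hE hzE hyz hzy).1 h₂
  have e3 := (hp.liesBelow_iff_left hE hzE hzx hxz).1 h₃
  have e4 := (hp.liesBelow_iff_right hC hxC hzx hxz).1 h₃
  rw [← hp.brokenLine_vertex hC.chain hxC] at e3
  rw [← hp.brokenLine_vertex hE.chain hzE] at e4
  have e5 := e1.trans e2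
  obtain ⟨a, haE, haC, ha⟩ := hp.exists_common_of_vertices hE hC x y e3 e5
  rcases hm with ⟨m1, m2⟩ | ⟨m1, m2⟩
  · have ha' : (p x).1 < (p a).1 := by rcases ha with h | h <;> linarith [h.1, h.2]
    have hb' : (p a).1 < (p z).1 := by rcases ha with h | h <;> linarith [h.1, h.2]
    exact hxz ((hp.lt_of_mem hC hxC haC ha').trans (hp.lt_of_mem hE haE hzE hb')).le
  · have ha' : (p a).1 < (p x).1 := by rcases ha with h | h <;> linarith [h.1, h.2]
    have hb' : (p z).1 < (p a).1 := by rcases ha with h | h <;> linarith [h.1, h.2]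
    exact hzx ((hp.lt_of_mem hE hzE haE hb').trans (hp.lt_of_mem hC haC hxC ha')).le

theorem HasseDrawing.not_cycle (hxy : ¬ x ≤ y) (hyx : ¬ y ≤ x) (hyz : ¬ y ≤ z) (hzy : ¬ z ≤ y)
    (hxz : ¬ x ≤ z) (hzx : ¬ z ≤ x) (h₁ : LiesBelow p x y) (h₂ : LiesBelow p y z) :
    LiesBelow p x z := by
  by_contra h
  have h₃ := (hp.liesBelow_total hxz hzx).2 h
  -- One of the three elements has the median abscissa; rotating the cycle makes it the middle one.
  rcases le_total (p x).1 (p y).1 with a | a <;> rcases le_total (p y).1 (p z).1 with b | b <;>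
    rcases le_total (p z).1 (p x).1 with c | c
  all_goals first
    | exact hp.not_cycle_aux hxy hyx hyz hzy hxz hzx h₁ h₂ h₃ (Or.inl ⟨a, b⟩)
    | exact hp.not_cycle_aux hxy hyx hyz hzy hxz hzx h₁ h₂ h₃ (Or.inr ⟨b, a⟩)
    | exact hp.not_cycle_aux hyz hzy hzx hxz hyx hxy h₂ h₃ h₁ (Or.inl ⟨b, c⟩)
    | exact hp.not_cycle_aux hyz hzy hzx hxz hyx hxy h₂ h₃ h₁ (Or.inr ⟨c, b⟩)
    | exact hp.not_cycle_aux hzx hxz hxy hyx hzy hyz h₃ h₁ h₂ (Or.inl ⟨c, a⟩)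
    | exact hp.not_cycle_aux hzx hxz hxy hyx hzy hyz h₃ h₁ h₂ (Or.inr ⟨a, c⟩)

/-- Two elements which are both smaller than two other ones are separated by some element. -/
theorem HasseDrawing.interpolate_aux {a b p' q : Q} (hab : ¬ a ≤ b) (hba : ¬ b ≤ a)
    (hpq : ¬ p' ≤ q) (hqp : ¬ q ≤ p') (hap : a < p') (haq : a < q) (hbp : b < p') (hbq : b < q)
    (h₁ : LiesBelow p a b) (h₂ : LiesBelow p p' q) :
    ∃ e, a ≤ e ∧ b ≤ e ∧ e ≤ p' ∧ e ≤ q := by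
  obtain ⟨C, hC, haC, hqC⟩ := exists_isFullChain haq.le
  obtain ⟨D, hD, hbD, hpD⟩ := exists_isFullChain hbp.le
  have e1 := (hp.liesBelow_iff_left hC haC hab hba).1 h₁
  have e2 := (hp.liesBelow_iff_right hD hbD hab hba).1 h₁
  have e3 := (hp.liesBelow_iff_left hD hpD hpq hqp).1 h₂
  have e4 := (hp.liesBelow_iff_right hC hqC hpq hqp).1 h₂
  rw [← hp.brokenLine_vertex hD.chain hbD] at e1
  rw [← hp.brokenLine_vertex hC.chain haC] at e2
  rw [← hp.brokenLine_vertex hC.chain hqC] at e3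
  rw [← hp.brokenLine_vertex hD.chain hpD] at e4
  -- `C` joins the lower origin `a` to the upper end `q`, and `D` joins `b` to `p'`, so they must
  -- cross. Between the larger abscissa of the origins and the smaller one of the ends, the common
  -- element is comparable in the right sense to all four.
  have s1 : brokenLine p C (max (p a).1 (p b).1) < brokenLine p D (max (p a).1 (p b).1) := by
    rcases max_choice (p a).1 (p b).1 with h | h <;> rw [h] <;> assumption
  have s2 : brokenLine p D (min (p p').1 (p q).1) < brokenLine p C (min (p p').1 (p q).1) := by
    rcases min_choice (p p').1 (p q).1 with h | h <;> rw [h] <;> assumption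
  have hst : max (p a).1 (p b).1 < min (p p').1 (p q).1 := by
    rw [max_lt_iff, lt_min_iff, lt_min_iff]
    exact ⟨⟨hp.lt hap, hp.lt haq⟩, hp.lt hbp, hp.lt hbq⟩
  obtain ⟨e, heC, heD, h3, h4⟩ := hp.exists_common hC hD hst
    ((hp.le bot_le).trans (le_max_left _ _)) ((min_le_left _ _).trans (hp.le le_top)) s1 s2
  rw [max_lt_iff] at h3
  rw [lt_min_iff] at h4
  exact ⟨e, (hp.lt_of_mem hC haC heC h3.1).le, (hp.lt_of_mem hD hbD heD h3.2).le,
    (hp.lt_of_mem hD heD hpD h4.1).le, (hp.lt_of_mem hC heC hqC h4.2).le⟩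

theorem HasseDrawing.interpolate {a b p' q : Q} (hap : a ≤ p') (haq : a ≤ q) (hbp : b ≤ p')
    (hbq : b ≤ q) : ∃ e, a ≤ e ∧ b ≤ e ∧ e ≤ p' ∧ e ≤ q := by
  by_cases hab : a ≤ b
  · exact ⟨b, hab, le_rfl, hbp, hbq⟩
  by_cases hba : b ≤ a
  · exact ⟨a, le_rfl, hba, hap, haq⟩
  by_cases hpq : p' ≤ q
  · exact ⟨p', hap, hbp, le_rfl, hpq⟩
  by_cases hqp : q ≤ p'
  · exact ⟨q, haq, hbq, hqp, le_rfl⟩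
  have hap' : a < p' := lt_of_le_of_ne hap fun e => hba (e ▸ hbp)
  have haq' : a < q := lt_of_le_of_ne haq fun e => hba (e ▸ hbq)
  have hbp' : b < p' := lt_of_le_of_ne hbp fun e => hab (e ▸ hap)
  have hbq' : b < q := lt_of_le_of_ne hbq fun e => hab (e ▸ haq)
  by_cases h₁ : LiesBelow p a b
  · by_cases h₂ : LiesBelow p p' q
    · exact hp.interpolate_aux hab hba hpq hqp hap' haq' hbp' hbq' h₁ h₂
    · obtain ⟨e, h1, h2, h3, h4⟩ := hp.interpolate_aux hab hba hqp hpq haq' hap' hbq' hbp' h₁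
        ((hp.liesBelow_total hpq hqp).2 h₂)
      exact ⟨e, h1, h2, h4, h3⟩
  · have h₁' := (hp.liesBelow_total hab hba).2 h₁
    by_cases h₂ : LiesBelow p p' q
    · obtain ⟨e, h1, h2, h3, h4⟩ := hp.interpolate_aux hba hab hpq hqp hbp' hbq' hap' haq' h₁' h₂
      exact ⟨e, h2, h1, h3, h4⟩
    · obtain ⟨e, h1, h2, h3, h4⟩ := hp.interpolate_aux hba hab hqp hpq hbq' hbp' haq' hap' h₁'
        ((hp.liesBelow_total hpq hqp).2 h₂)
      exact ⟨e, h2, h1, h4, h3⟩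

end Incomparable

/-- The linear extension of a planar poset in which incomparable elements are enumerated upwards. -/
def SweepLt (p : Q → ℝ × ℝ) (x y : Q) : Prop :=
  x < y ∨ (¬ x ≤ y ∧ ¬ y ≤ x ∧ LiesBelow p x y)

theorem HasseDrawing.sweepLt_trichotomous [Nontrivial Q] (hp : HasseDrawing p) {x y : Q}
    (h : x ≠ y) : SweepLt p x y ∨ SweepLt p y x := by
  by_cases hxy : x ≤ y
  · exact Or.inl (Or.inl (lt_of_le_of_ne hxy h))
  by_cases hyx : y ≤ x
  · exact Or.inr (Or.inl (lt_of_le_of_ne hyx h.symm))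
  by_cases h₁ : LiesBelow p x y
  · exact Or.inl (Or.inr ⟨hxy, hyx, h₁⟩)
  · exact Or.inr (Or.inr ⟨hyx, hxy, (hp.liesBelow_total hxy hyx).2 h₁⟩)

omit [Finite Q] in
theorem sweepLt_irrefl (x : Q) : ¬ SweepLt p x x := by
  rintro (h | h)
  exacts [lt_irrefl _ h, h.1 le_rfl]

/-- When exactly one of the two steps is an order relation, a chain containing its two elements can
be used to test "below" for either of them. When both elements are passed upwards, incomparability
persists and cycles are excluded. -/
theorem HasseDrawing.sweepLt_trans [Nontrivial Q] (hp : HasseDrawing p) {x y z : Q}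
    (h₁ : SweepLt p x y) (h₂ : SweepLt p y z) : SweepLt p x z := by
  rcases h₁ with h₁ | ⟨hxy, hyx, h₁⟩ <;> rcases h₂ with h₂ | ⟨hyz, hzy, h₂⟩
  · exact Or.inl (h₁.trans h₂)
  · have hzx : ¬ z ≤ x := fun h => hzy (h.trans h₁.le)
    by_cases hxz : x ≤ z
    · exact Or.inl (lt_of_le_of_ne hxz fun e => hzx e.ge)
    obtain ⟨C, hC, hxC, hyC⟩ := exists_isFullChain h₁.le
    exact Or.inr ⟨hxz, hzx, (hp.liesBelow_iff_left hC hxC hxz hzx).2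
      ((hp.liesBelow_iff_left hC hyC hyz hzy).1 h₂)⟩
  · have hzx : ¬ z ≤ x := fun h => hyx (h₂.le.trans h)
    by_cases hxz : x ≤ z
    · exact Or.inl (lt_of_le_of_ne hxz fun e => hzx e.ge)
    obtain ⟨D, hD, hyD, hzD⟩ := exists_isFullChain h₂.le
    exact Or.inr ⟨hxz, hzx, D, hD, hzD, (hp.liesBelow_iff_right hD hyD hxy hyx).1 h₁⟩
  · obtain ⟨hxz, hzx⟩ := hp.not_lt_of_liesBelow hxy hyx hyz hzy h₁ h₂
    exact Or.inr ⟨hxz, hzx, hp.not_cycle hxy hyx hyz hzy hxz hzx h₁ h₂⟩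

/-- A bounded poset with a planar drawing which is not a chain has an ear. -/
theorem HasseDrawing.exists_ear (hp : HasseDrawing p) (hchain : ∃ x y : Q, ¬ x ≤ y ∧ ¬ y ≤ x) :
    ∃ (A : Set Q) (u w t : Q), A.Nonempty ∧ IsChain (· ≤ ·) A ∧ u ∉ A ∧ w ∉ A ∧ t ∉ A ∧
      u < t ∧ t < w ∧ ∀ v ∈ A, ∀ x ∉ A, (x < v ↔ x ≤ u) ∧ (v < x ↔ w ≤ x) := by
  classical
  have : Nontrivial Q := by
    obtain ⟨x, y, hxy, -⟩ := hchain
    exact ⟨x, y, fun e => hxy e.le⟩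
  cases nonempty_fintype Q
  -- The rank in the sweep order, as a number of predecessors.
  let f : Q → ℕ := fun x => (Finset.univ.filter (fun y => SweepLt p y x)).card
  have hmono : ∀ x y, SweepLt p x y → f x < f y := by
    intro x y h
    refine Finset.card_lt_card ((Finset.ssubset_iff_of_subset ?_).2 ⟨x, ?_, ?_⟩)
    · intro z hz
      simp only [Finset.mem_filter, Finset.mem_univ, true_and] at hz ⊢
      exact hp.sweepLt_trans hz h
    · simpa using h
    · simpa using sweepLt_irrefl x
  have hmono' : ∀ x y, f x < f y → SweepLt p x y := by
    intro x y h
    have hne : x ≠ y := fun e => by simp [e] at h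
    exact (hp.sweepLt_trichotomous hne).resolve_right fun h' => (hmono y x h').not_gt h
  refine exists_ear_of_rank f ?_ (fun x y h => hmono x y (Or.inl h)) ?_
    (fun a b p' q h1 h2 h3 h4 => hp.interpolate h1 h2 h3 h4) hchain
  · intro x y h
    by_contra hne
    rcases hp.sweepLt_trichotomous hne with h' | h'
    exacts [(hmono _ _ h').ne h, (hmono _ _ h').ne h.symm]
  -- Non-separation: otherwise `a` lies below `b` and `b` below `c`, and then `a` and `c` are
  -- incomparable.
  · intro a b c hab hbc hac
    rcases hmono' a b hab with h₁ | ⟨hab, hba, h₁⟩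
    · exact Or.inl h₁
    rcases hmono' b c hbc with h₂ | ⟨hbc, hcb, h₂⟩
    · exact Or.inr h₂
    exact absurd hac.le (hp.not_lt_of_liesBelow hab hba hbc hcb h₁ h₂).1

end PlanarDrawings

/-! ### Spanning subsets of a planar poset and their ears. -/

section ConvexSubsets

variable {P : Type*} [PartialOrder P]

/-- The order induced on `S` is generated by covering relations of the ambient poset. -/
structure Saturated (S : Finset P) : Prop where
  exists_covBy_right : ∀ x ∈ S, ∀ y ∈ S, x < y → ∃ z ∈ S, x ⋖ z ∧ z ≤ y
  exists_covBy_left : ∀ x ∈ S, ∀ y ∈ S, x < y → ∃ z ∈ S, x ≤ z ∧ z ⋖ y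

/-- Saturated subsets whose minimal and maximal elements are minimal and maximal in the ambient
poset. -/
structure Spanning (S : Finset P) : Prop extends Saturated S where
  isMin : ∀ x ∈ S, (∀ y ∈ S, ¬ y < x) → IsMin x
  isMax : ∀ x ∈ S, (∀ y ∈ S, ¬ x < y) → IsMax x

/-- Connectedness of `S` for the comparability relation. -/
def OrderConnected (S : Finset P) : Prop :=
  S.Nonempty ∧ ∀ T ⊆ S, T.Nonempty → T ≠ S → ∃ x ∈ T, ∃ y ∈ S, y ∉ T ∧ (x < y ∨ y < x)

/-- All relations between elements of `A` and smaller elements of `S \ A` go through `u`. -/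
def LowerGate (S A : Finset P) (u : P) : Prop :=
  u ∈ S ∧ u ∉ A ∧ ∀ v ∈ A, ∀ x ∈ S, x ∉ A → (x < v ↔ x ≤ u)

/-- All relations between elements of `A` and greater elements of `S \ A` go through `w`. -/
def UpperGate (S A : Finset P) (w : P) : Prop :=
  w ∈ S ∧ w ∉ A ∧ ∀ v ∈ A, ∀ x ∈ S, x ∉ A → (v < x ↔ w ≤ x)

/-- Takes the place of `LowerGate` when the gate found after adding bounds is the bottom element;
`NoUpper` does the same for the top element. -/
def NoLower (S A : Finset P) : Prop := ∀ v ∈ A, ∀ x ∈ S, x ∉ A → ¬ x < v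

def NoUpper (S A : Finset P) : Prop := ∀ v ∈ A, ∀ x ∈ S, x ∉ A → ¬ v < x

section

variable [Fintype P] [DecidableEq P]

omit [DecidableEq P] in
theorem mem_edges_hasseGraph {a b : P} : (a, b) ∈ (hasseGraph P).edges ↔ a ⋖ b := by
  simp [hasseGraph]

theorem mem_minimals_hasseGraph {a : P} (h : IsMin a) : a ∈ (hasseGraph P).minimals := by
  simp only [DGraph.minimals, Finset.mem_filter]
  refine ⟨Finset.mem_univ _, ?_⟩
  rintro ⟨b, c⟩ he rfl
  exact h.not_lt (mem_edges_hasseGraph.1 he).lt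

theorem mem_maximals_hasseGraph {a : P} (h : IsMax a) : a ∈ (hasseGraph P).maximals := by
  simp only [DGraph.maximals, Finset.mem_filter]
  refine ⟨Finset.mem_univ _, ?_⟩
  rintro ⟨b, c⟩ he rfl
  exact h.not_lt (mem_edges_hasseGraph.1 he).lt

/-- The inclusion of a bounded subset in the vertices of the bounded graph. -/
def boundedIncl (S : Finset P) (a : WithBot (WithTop S)) : Option (Option P) :=
  Option.map (Option.map Subtype.val) a

omit [PartialOrder P] [Fintype P] [DecidableEq P] in
theorem boundedIncl_injective (S : Finset P) : Function.Injective (boundedIncl S) :=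
  Option.map_injective (Option.map_injective Subtype.val_injective)

/-- This is the purpose of `Spanning`: covers inside `S` are covers of `P`, and the covers of the
added bounds come from extremal elements of `P`. As `WithBot (WithTop S)` unfolds to `Option (Option
S)`, the bounds are sent to the vertices 0 and ∞ of `addMinMax`, so the drawing of the bounded graph
of `P` restricts to `S`. -/
theorem Spanning.mem_edges {S : Finset P} (hS : Spanning S) (hne : S.Nonempty)
    {a b : WithBot (WithTop S)} (h : a ⋖ b) :
    (boundedIncl S a, boundedIncl S b) ∈ (hasseGraph P).addMinMax.edges := by
  simp only [DGraph.addMinMax, Finset.mem_union, Finset.mem_image]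
  obtain ⟨x₀, hx₀⟩ := hne
  induction b using WithBot.recBotCoe with
  | bot => exact absurd h.lt not_lt_bot
  | coe b =>
  induction a using WithBot.recBotCoe with
  | bot =>
    rw [WithBot.bot_covBy_coe] at h
    induction b using WithTop.recTopCoe with
    | top =>
      have := h (b := ((⟨x₀, hx₀⟩ : S) : WithTop S)) le_top
      exact absurd this (WithTop.coe_lt_top _).not_ge
    | coe x =>
      refine Or.inl (Or.inr ⟨x.1, mem_minimals_hasseGraph (hS.isMin x.1 x.2 fun y hy hyx => ?_),
        rfl⟩)
      have := h (b := ((⟨y, hy⟩ : S) : WithTop S)) (WithTop.coe_le_coe.2 hyx.le)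
      have h2 : x ≤ ⟨y, hy⟩ := WithTop.coe_le_coe.1 this
      exact hyx.not_ge h2
  | coe a =>
    rw [WithBot.coe_covBy_coe] at h
    induction a using WithTop.recTopCoe with
    | top => exact absurd h.lt not_top_lt
    | coe x =>
    induction b using WithTop.recTopCoe with
    | top =>
      rw [WithTop.coe_covBy_top] at h
      refine Or.inr ⟨x.1, mem_maximals_hasseGraph (hS.isMax x.1 x.2 fun y hy hxy => ?_), rfl⟩
      exact hxy.not_ge (h (b := ⟨y, hy⟩) hxy.le)
    | coe y =>
      rw [WithTop.coe_covBy_coe] at h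
      refine Or.inl (Or.inl ⟨(x.1, y.1), mem_edges_hasseGraph.2 ?_, rfl⟩)
      obtain ⟨z, hz, hxz, hzy⟩ := hS.exists_covBy_right x.1 x.2 y.1 y.2 h.lt
      have : z = y.1 := by
        by_contra hne
        have h2 : z < y.1 := lt_of_le_of_ne hzy hne
        exact h.2 (c := ⟨z, hz⟩) hxz.lt h2
      exact this ▸ hxz

theorem Spanning.hasseDrawing {S : Finset P} (hS : Spanning S) (hne : S.Nonempty)
    {p : Option (Option P) → ℝ × ℝ} (hp : (hasseGraph P).addMinMax.IsPlanarDrawing p) :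
    HasseDrawing (p ∘ boundedIncl S) := by
  have hinj := boundedIncl_injective S
  have hmem : ∀ v : Option (Option P), v ∈ (hasseGraph P).addMinMax.verts := by
    rintro (_ | _ | v) <;> simp [DGraph.addMinMax, hasseGraph]
  refine ⟨fun a b h => hp.left_to_right _ (hS.mem_edges hne h), fun v a b h hv => ?_,
    fun a b c d hab hcd hne' q h1 h2 => ?_⟩
  · rcases hp.vertex_edge _ (hmem _) _ (hS.mem_edges hne h) hv with h' | h'
    exacts [Or.inl (hinj h'), Or.inr (hinj h')]
  · obtain ⟨v, hv1, hv2, hv⟩ := hp.edge_edge _ (hS.mem_edges hne hab) _ (hS.mem_edges hne hcd)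
      (fun e => hne' (Prod.ext (hinj (congrArg Prod.fst e)) (hinj (congrArg Prod.snd e)))) q h1 h2
    rcases hv1 with rfl | rfl
    · exact ⟨a, Or.inl rfl, hv2.imp (fun h => hinj h) (fun h => hinj h), hv⟩
    · exact ⟨b, Or.inr rfl, hv2.imp (fun h => hinj h) (fun h => hinj h), hv⟩

/-- A spanning subset of a planar poset which is not a chain has an ear `A`. -/
theorem Spanning.exists_ear {S : Finset P} (hS : Spanning S)
    (hP : (hasseGraph P).StronglyPlanar) (hchain : ∃ x ∈ S, ∃ y ∈ S, ¬ x ≤ y ∧ ¬ y ≤ x) :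
    ∃ A ⊆ S, A.Nonempty ∧ IsChain (· ≤ ·) (A : Set P) ∧ ∃ t ∈ S, t ∉ A ∧
      ((∃ u, LowerGate S A u ∧ u < t) ∨ NoLower S A) ∧
      ((∃ w, UpperGate S A w ∧ t < w) ∨ NoUpper S A) := by
  classical
  obtain ⟨p, hp⟩ := hP
  obtain ⟨x₀, hx₀, y₀, hy₀, h₀⟩ := hchain
  have hd := hS.hasseDrawing ⟨x₀, hx₀⟩ hp
  let i : S → WithBot (WithTop S) := fun x => ((x : WithTop S) : WithBot (WithTop S))
  have hle : ∀ x y : S, i x ≤ i y ↔ x.1 ≤ y.1 := fun x y =>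
    WithBot.coe_le_coe.trans WithTop.coe_le_coe
  have hlt : ∀ x y : S, i x < i y ↔ x.1 < y.1 := fun x y =>
    WithBot.coe_lt_coe.trans WithTop.coe_lt_coe
  have hcases : ∀ x : WithBot (WithTop S), x = ⊥ ∨ x = ⊤ ∨ ∃ y, x = i y := by
    intro x
    induction x using WithBot.recBotCoe with
    | bot => exact Or.inl rfl
    | coe x =>
      induction x using WithTop.recTopCoe with
      | top => exact Or.inr (Or.inl rfl)
      | coe x => exact Or.inr (Or.inr ⟨x, rfl⟩)
  obtain ⟨A, u, w, t, hA, hAc, hu, hw, ht, hut, htw, hAx⟩ := hd.exists_ear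
    ⟨i ⟨x₀, hx₀⟩, i ⟨y₀, hy₀⟩, fun h => h₀.1 ((hle _ _).1 h), fun h => h₀.2 ((hle _ _).1 h)⟩
  -- If a bound were in the ear, its relation with `t` would have to pass through `w` (or `u`),
  -- contradicting u < t < w. So the ear consists of elements of `S`.
  have hbot : ⊥ ∉ A := fun h =>
    htw.not_ge ((hAx _ h t ht).2.1 (bot_le.trans_lt hut))
  have htop : ⊤ ∉ A := fun h =>
    hut.not_ge ((hAx _ h t ht).1.1 (htw.trans_le le_top))
  obtain ⟨t', rfl⟩ : ∃ t', t = i t' := by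
    rcases hcases t with rfl | rfl | h
    · exact absurd hut not_lt_bot
    · exact absurd htw not_top_lt
    · exact h
  have hmem : ∀ x : S, x.1 ∈ S.filter (fun x => ∃ h : x ∈ S, i ⟨x, h⟩ ∈ A) ↔ i x ∈ A := by
    intro x
    rw [Finset.mem_filter]
    exact ⟨fun ⟨_, _, h⟩ => h, fun h => ⟨x.2, x.2, h⟩⟩
  refine ⟨S.filter (fun x => ∃ h : x ∈ S, i ⟨x, h⟩ ∈ A), Finset.filter_subset _ _, ?_, ?_, t'.1,
    t'.2, fun h => ht ((hmem t').1 h), ?_, ?_⟩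
  · obtain ⟨a, ha⟩ := hA
    rcases hcases a with rfl | rfl | ⟨a', rfl⟩
    · exact absurd ha hbot
    · exact absurd ha htop
    · exact ⟨a'.1, (hmem a').2 ha⟩
  · intro x hx y hy hxy
    obtain ⟨hxS, hx'⟩ := (Finset.mem_filter.1 (Finset.mem_coe.1 hx)).2
    obtain ⟨hyS, hy'⟩ := (Finset.mem_filter.1 (Finset.mem_coe.1 hy)).2
    by_cases he : i ⟨x, hxS⟩ = i ⟨y, hyS⟩
    · exact Or.inl ((hle ⟨x, hxS⟩ ⟨y, hyS⟩).1 he.le)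
    · rcases hAc hx' hy' he with h | h
      exacts [Or.inl ((hle ⟨x, hxS⟩ ⟨y, hyS⟩).1 h), Or.inr ((hle ⟨y, hyS⟩ ⟨x, hxS⟩).1 h)]
  · rcases hcases u with rfl | rfl | ⟨u', rfl⟩
    · refine Or.inr fun v hv x hx hxA hxv => ?_
      obtain ⟨hvS, hv'⟩ := (Finset.mem_filter.1 hv).2
      have h1 : i ⟨x, hx⟩ ∉ A := fun h => hxA ((hmem ⟨x, hx⟩).2 h)
      have h2 := (hAx _ hv' _ h1).1.1 ((hlt ⟨x, hx⟩ ⟨v, hvS⟩).2 hxv)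
      rw [le_bot_iff] at h2
      exact WithBot.coe_ne_bot h2
    · exact absurd hut not_top_lt
    · refine Or.inl ⟨u'.1, ⟨u'.2, fun h => hu ((hmem u').1 h), fun v hv x hx hxA => ?_⟩,
        (hlt _ _).1 hut⟩
      obtain ⟨hvS, hv'⟩ := (Finset.mem_filter.1 hv).2
      have h1 : i ⟨x, hx⟩ ∉ A := fun h => hxA ((hmem ⟨x, hx⟩).2 h)
      exact (hlt ⟨x, hx⟩ ⟨v, hvS⟩).symm.trans ((hAx _ hv' _ h1).1.trans (hle ⟨x, hx⟩ u'))
  · rcases hcases w with rfl | rfl | ⟨w', rfl⟩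
    · exact absurd htw not_lt_bot
    · refine Or.inr fun v hv x hx hxA hvx => ?_
      obtain ⟨hvS, hv'⟩ := (Finset.mem_filter.1 hv).2
      have h1 : i ⟨x, hx⟩ ∉ A := fun h => hxA ((hmem ⟨x, hx⟩).2 h)
      have h2 := (hAx _ hv' _ h1).2.1 ((hlt ⟨v, hvS⟩ ⟨x, hx⟩).2 hvx)
      rw [top_le_iff] at h2
      exact WithTop.coe_ne_top (WithBot.coe_injective h2)
    · refine Or.inl ⟨w'.1, ⟨w'.2, fun h => hw ((hmem w').1 h), fun v hv x hx hxA => ?_⟩,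
        (hlt _ _).1 htw⟩
      obtain ⟨hvS, hv'⟩ := (Finset.mem_filter.1 hv).2
      have h1 : i ⟨x, hx⟩ ∉ A := fun h => hxA ((hmem ⟨x, hx⟩).2 h)
      exact (hlt ⟨v, hvS⟩ ⟨x, hx⟩).symm.trans ((hAx _ hv' _ h1).2.trans (hle w' ⟨x, hx⟩))

end

end ConvexSubsets

/-! ### Erasing an ear, globally and element by element. -/

section ConvexSubsets

variable {P : Type*} [PartialOrder P]

/-- Climb from `x` towards `y` by covers inside `S` and stop at the first one that leaves `C`. -/
theorem Saturated.exists_exit_right [Finite P] {S C : Finset P} (hS : Saturated S) (hC : C ⊆ S)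
    {x y : P} (hx : x ∈ C) (hy : y ∈ S) (hyC : y ∉ C) (hxy : x < y) :
    ∃ x₁ ∈ C, ∃ y₁ ∈ S, y₁ ∉ C ∧ x ≤ x₁ ∧ x₁ ⋖ y₁ ∧ y₁ ≤ y := by
  induction x using WellFoundedGT.induction with
  | _ x ih =>
  obtain ⟨z, hz, hxz, hzy⟩ := hS.exists_covBy_right x (hC hx) y hy hxy
  by_cases hzC : z ∈ C
  · obtain ⟨x₁, h1, y₁, h2, h3, h4, h5⟩ := ih z hxz.lt hzC
      (lt_of_le_of_ne hzy fun e => hyC (e ▸ hzC))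
    exact ⟨x₁, h1, y₁, h2, h3, hxz.le.trans h4, h5⟩
  · exact ⟨x, hx, z, hz, hzC, le_rfl, hxz, hzy⟩

variable [DecidableEq P]

theorem Saturated.exists_exit_left [Finite P] {S C : Finset P} (hS : Saturated S)
    {x y : P} (hx : x ∈ C) (hxS : x ∈ S) (hy : y ∈ S) (hyC : y ∉ C) (hyx : y < x) :
    ∃ x₁ ∈ C, ∃ y₁ ∈ S, y₁ ∉ C ∧ x₁ ≤ x ∧ y₁ ⋖ x₁ ∧ y ≤ y₁ := by
  -- Entering `C` from below is the same as leaving `S \ C` upwards.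
  obtain ⟨y₁, h1, x₁, h2, h3, h4, h5, h6⟩ := hS.exists_exit_right (C := S \ C) Finset.sdiff_subset
    (Finset.mem_sdiff.2 ⟨hy, hyC⟩) hxS (fun h => (Finset.mem_sdiff.1 h).2 hx) hyx
  rw [Finset.mem_sdiff] at h1 h3
  exact ⟨x₁, not_not.1 fun h => h3 ⟨h2, h⟩, y₁, h1.1, h1.2, h6, h5, h4⟩

/-- The set obtained by erasing an ear is again spanning. -/
theorem Spanning.sdiff {S A : Finset P} (hS : Spanning S) {t : P} (ht : t ∈ S) (htA : t ∉ A)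
    (hL : (∃ u, LowerGate S A u ∧ u < t) ∨ NoLower S A)
    (hU : (∃ w, UpperGate S A w ∧ t < w) ∨ NoUpper S A) : Spanning (S \ A) := by
  -- `t` is a bypass: what lies outside `A` and below (above) an element of `A` lies below (above)
  -- `t`. A covering step into the ear is thus replaced by a step towards or from `t`, and `t`
  -- itself is incomparable to the ear.
  have hlow : ∀ v ∈ A, ∀ x ∈ S, x ∉ A → x < v → x < t := by
    intro v hv x hx hxA hxv
    rcases hL with ⟨u, hu, hut⟩ | hL
    · exact ((hu.2.2 v hv x hx hxA).1 hxv).trans_lt hut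
    · exact absurd hxv (hL v hv x hx hxA)
  have hupp : ∀ v ∈ A, ∀ x ∈ S, x ∉ A → v < x → t < x := by
    intro v hv x hx hxA hxv
    rcases hU with ⟨w, hw, htw⟩ | hU
    · exact htw.trans_le ((hw.2.2 v hv x hx hxA).1 hxv)
    · exact absurd hxv (hU v hv x hx hxA)
  have htA1 : ∀ v ∈ A, ¬ v < t := fun v hv h => lt_irrefl _ (hupp v hv t ht htA h)
  have htA2 : ∀ v ∈ A, ¬ t < v := fun v hv h => lt_irrefl _ (hlow v hv t ht htA h)
  refine ⟨⟨fun x hx y hy hxy => ?_, fun x hx y hy hxy => ?_⟩, fun x hx h => ?_, fun x hx h => ?_⟩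
  · rw [Finset.mem_sdiff] at hx hy
    obtain ⟨z, hz, hxz, hzy⟩ := hS.exists_covBy_right x hx.1 y hy.1 hxy
    by_cases hzA : z ∈ A
    · obtain ⟨z', hz', hxz', hzt⟩ := hS.exists_covBy_right x hx.1 t ht
        (hlow z hzA x hx.1 hx.2 hxz.lt)
      refine ⟨z', Finset.mem_sdiff.2 ⟨hz', fun hA => ?_⟩, hxz', ?_⟩
      · exact htA1 z' hA (lt_of_le_of_ne hzt fun e => htA (e ▸ hA))
      · exact hzt.trans
          (hupp z hzA y hy.1 hy.2 (lt_of_le_of_ne hzy fun e => hy.2 (e ▸ hzA))).le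
    · exact ⟨z, Finset.mem_sdiff.2 ⟨hz, hzA⟩, hxz, hzy⟩
  · rw [Finset.mem_sdiff] at hx hy
    obtain ⟨z, hz, hxz, hzy⟩ := hS.exists_covBy_left x hx.1 y hy.1 hxy
    by_cases hzA : z ∈ A
    · obtain ⟨z', hz', htz, hzy'⟩ := hS.exists_covBy_left t ht y hy.1
        (hupp z hzA y hy.1 hy.2 hzy.lt)
      refine ⟨z', Finset.mem_sdiff.2 ⟨hz', fun hA => ?_⟩, ?_, hzy'⟩
      · exact htA2 z' hA (lt_of_le_of_ne htz fun e => htA (e ▸ hA))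
      · exact (hlow z hzA x hx.1 hx.2 (lt_of_le_of_ne hxz fun e => hx.2 (e ▸ hzA))).le.trans htz
    · exact ⟨z, Finset.mem_sdiff.2 ⟨hz, hzA⟩, hxz, hzy⟩
  · rw [Finset.mem_sdiff] at hx
    refine hS.isMin x hx.1 fun y hy hyx => ?_
    by_cases hyA : y ∈ A
    · exact h t (Finset.mem_sdiff.2 ⟨ht, htA⟩) (hupp y hyA x hx.1 hx.2 hyx)
    · exact h y (Finset.mem_sdiff.2 ⟨hy, hyA⟩) hyx
  · rw [Finset.mem_sdiff] at hx
    refine hS.isMax x hx.1 fun y hy hyx => ?_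
    by_cases hyA : y ∈ A
    · exact h t (Finset.mem_sdiff.2 ⟨ht, htA⟩) (hlow y hyA x hx.1 hx.2 hyx)
    · exact h y (Finset.mem_sdiff.2 ⟨hy, hyA⟩) hyx

/-- The gates form a chain. If a part `T` contains some but not all of them, two gates give the
required relation. If it contains them all, `A` may be added to `T`, and if it contains none, `T` is
used as it is: a relation found in `S` that involves `A` is then replaced by a relation with a gate.
-/
theorem OrderConnected.sdiff_of_gates {S A G : Finset P} (hS : OrderConnected S) (hA : A ⊆ S)
    (hne : (S \ A).Nonempty) (hGS : G ⊆ S \ A)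
    (hG : ∀ g ∈ G, ∀ g' ∈ G, g ≠ g' → g < g' ∨ g' < g)
    (hAG : ∀ v ∈ A, ∀ x ∈ S, x ∉ A → (x < v ∨ v < x) → ∃ g ∈ G, x = g ∨ x < g ∨ g < x) :
    OrderConnected (S \ A) := by
  refine ⟨hne, fun T hT hTne hTS => ?_⟩
  have hTS' : T ⊆ S := hT.trans Finset.sdiff_subset
  by_cases h1 : ∃ g ∈ G, g ∈ T
  · by_cases h2 : ∃ g ∈ G, g ∉ T
    · obtain ⟨g, hg, hgT⟩ := h1
      obtain ⟨g', hg', hgT'⟩ := h2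
      exact ⟨g, hgT, g', hGS hg', hgT', hG g hg g' hg' fun e => hgT' (e ▸ hgT)⟩
    · push Not at h2
      have hne' : T ∪ A ≠ S := by
        rintro rfl
        refine hTS (Finset.Subset.antisymm hT fun x hx => ?_)
        rw [Finset.mem_sdiff, Finset.mem_union] at hx
        exact hx.1.resolve_right hx.2
      obtain ⟨x, hx, y, hy, hyT, hxy⟩ := hS.2 (T ∪ A) (Finset.union_subset hTS' hA)
        (hTne.mono Finset.subset_union_left) hne'
      rw [Finset.mem_union, not_or] at hyT
      have hyS : y ∈ S \ A := Finset.mem_sdiff.2 ⟨hy, hyT.2⟩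
      rcases Finset.mem_union.1 hx with hx | hx
      · exact ⟨x, hx, y, hyS, hyT.1, hxy⟩
      · obtain ⟨g, hg, h⟩ := hAG x hx y hy hyT.2 hxy.symm
        rcases h with rfl | h | h
        · exact absurd (h2 _ hg) hyT.1
        · exact ⟨g, h2 g hg, y, hyS, hyT.1, Or.inr h⟩
        · exact ⟨g, h2 g hg, y, hyS, hyT.1, Or.inl h⟩
  · push Not at h1
    have hne' : T ≠ S := by
      rintro rfl
      exact hTS (Finset.Subset.antisymm hT Finset.sdiff_subset)
    obtain ⟨x, hx, y, hy, hyT, hxy⟩ := hS.2 T hTS' hTne hne'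
    by_cases hyA : y ∈ A
    · have hx' := Finset.mem_sdiff.1 (hT hx)
      obtain ⟨g, hg, h⟩ := hAG y hyA x hx'.1 hx'.2 hxy
      rcases h with rfl | h
      · exact absurd hx (h1 _ hg)
      · exact ⟨x, hx, g, hGS hg, h1 g hg, h⟩
    · exact ⟨x, hx, y, Finset.mem_sdiff.2 ⟨hy, hyA⟩, hyT, hxy⟩

/-- The set obtained by erasing an ear is again connected. -/
theorem OrderConnected.sdiff {S A : Finset P} (hS : OrderConnected S) (hA : A ⊆ S) {t : P}
    (ht : t ∈ S) (htA : t ∉ A) (hL : (∃ u, LowerGate S A u ∧ u < t) ∨ NoLower S A)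
    (hU : (∃ w, UpperGate S A w ∧ t < w) ∨ NoUpper S A) : OrderConnected (S \ A) := by
  have hne : (S \ A).Nonempty := ⟨t, Finset.mem_sdiff.2 ⟨ht, htA⟩⟩
  rcases hL with ⟨u, ⟨hu, huA, hu'⟩, hut⟩ | hL <;> rcases hU with ⟨w, ⟨hw, hwA, hw'⟩, htw⟩ | hU
  · refine hS.sdiff_of_gates hA hne (G := {u, w}) ?_ ?_ fun v hv x hx hxA h => ?_
    · intro g hg
      rcases Finset.mem_insert.1 hg with rfl | hg
      · exact Finset.mem_sdiff.2 ⟨hu, huA⟩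
      · exact Finset.mem_sdiff.2 (Finset.mem_singleton.1 hg ▸ ⟨hw, hwA⟩)
    · intro g hg g' hg' hne'
      simp only [Finset.mem_insert, Finset.mem_singleton] at hg hg'
      rcases hg with rfl | rfl <;> rcases hg' with rfl | rfl
      exacts [absurd rfl hne', Or.inl (hut.trans htw), Or.inr (hut.trans htw), absurd rfl hne']
    · rcases h with h | h
      · exact ⟨u, by simp, (((hu' v hv x hx hxA).1 h).eq_or_lt).imp_right Or.inl⟩
      · exact ⟨w, by simp, (((hw' v hv x hx hxA).1 h).eq_or_lt).imp Eq.symm Or.inr⟩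
  · refine hS.sdiff_of_gates hA hne (G := {u}) ?_ ?_ fun v hv x hx hxA h => ?_
    · intro g hg
      exact Finset.mem_sdiff.2 (Finset.mem_singleton.1 hg ▸ ⟨hu, huA⟩)
    · intro g hg g' hg' hne'
      exact absurd ((Finset.mem_singleton.1 hg).trans (Finset.mem_singleton.1 hg').symm) hne'
    · rcases h with h | h
      · exact ⟨u, by simp, (((hu' v hv x hx hxA).1 h).eq_or_lt).imp_right Or.inl⟩
      · exact absurd h (hU v hv x hx hxA)
  · refine hS.sdiff_of_gates hA hne (G := {w}) ?_ ?_ fun v hv x hx hxA h => ?_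
    · intro g hg
      exact Finset.mem_sdiff.2 (Finset.mem_singleton.1 hg ▸ ⟨hw, hwA⟩)
    · intro g hg g' hg' hne'
      exact absurd ((Finset.mem_singleton.1 hg).trans (Finset.mem_singleton.1 hg').symm) hne'
    · rcases h with h | h
      · exact absurd h (hL v hv x hx hxA)
      · exact ⟨w, by simp, (((hw' v hv x hx hxA).1 h).eq_or_lt).imp Eq.symm Or.inr⟩
  · refine hS.sdiff_of_gates hA hne (G := ∅) (by simp) (by simp) fun v hv x hx hxA h => ?_
    exact (h.elim (hL v hv x hx hxA) (hU v hv x hx hxA)).elim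

omit [DecidableEq P] in
/-- An ear of a connected set is attached to the rest of the set. -/
theorem OrderConnected.not_isolated {S A : Finset P} (hS : OrderConnected S) (hA : A ⊆ S)
    (hne : A.Nonempty) {t : P} (ht : t ∈ S) (htA : t ∉ A) (hL : NoLower S A) (hU : NoUpper S A) :
    False := by
  obtain ⟨x, hx, y, hy, hyA, hxy⟩ := hS.2 A hA hne fun e => htA (e ▸ ht)
  exact hxy.elim (hU x hx y hy hyA) (hL x hx y hy hyA)

/-! ### Erasing the elements of an ear one at a time -/

omit [DecidableEq P] in
theorem exists_min_of_isChain {A : Finset P} (hne : A.Nonempty)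
    (hc : IsChain (· ≤ ·) (A : Set P)) : ∃ m ∈ A, ∀ x ∈ A, m ≤ x := by
  obtain ⟨m, hm⟩ := A.exists_minimal hne
  refine ⟨m, hm.prop, fun x hx => ?_⟩
  rcases hc.total hm.prop hx with h | h
  exacts [h, hm.le_of_le hx h]

omit [DecidableEq P] in
theorem exists_max_of_isChain {A : Finset P} (hne : A.Nonempty)
    (hc : IsChain (· ≤ ·) (A : Set P)) : ∃ m ∈ A, ∀ x ∈ A, x ≤ m := by
  obtain ⟨m, hm⟩ := A.exists_maximal hne
  refine ⟨m, hm.prop, fun x hx => ?_⟩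
  rcases hc.total hm.prop hx with h | h
  exacts [hm.le_of_ge hx h, h]

/-- The gate is the next element of the ear, or `w` itself when `m` is alone in the ear. -/
theorem UpperGate.exists_of_min {S A : Finset P} (hA : A ⊆ S)
    (hc : IsChain (· ≤ ·) (A : Set P)) {w m : P} (hw : UpperGate S A w) (hm : m ∈ A)
    (hmin : ∀ x ∈ A, m ≤ x) : ∃ w', UpperGate S {m} w' := by
  by_cases h : (A.erase m).Nonempty
  · obtain ⟨w', hw', hmin'⟩ := exists_min_of_isChain h (hc.mono (by simp))
    have hw'A := Finset.mem_of_mem_erase hw'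
    have hmw' : m < w' := lt_of_le_of_ne (hmin w' hw'A) (Finset.ne_of_mem_erase hw').symm
    refine ⟨w', hA hw'A, by simpa using hmw'.ne', fun v hv x hx hxm => ?_⟩
    rw [Finset.mem_singleton] at hv hxm
    subst hv
    refine ⟨fun hvx => ?_, fun h => hmw'.trans_le h⟩
    by_cases hxA : x ∈ A
    · exact hmin' x (Finset.mem_erase.2 ⟨hxm, hxA⟩)
    · exact ((hw.2.2 w' hw'A x hx hxA).2 ((hw.2.2 v hm x hx hxA).1 hvx)).le
  · have hAm : ∀ x ∈ A, x = m := fun x hx => by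
      by_contra hne
      exact h ⟨x, Finset.mem_erase.2 ⟨hne, hx⟩⟩
    refine ⟨w, hw.1, fun h' => hw.2.1 ?_, fun v hv x hx hxm => ?_⟩
    · rwa [Finset.mem_singleton.1 h']
    · rw [Finset.mem_singleton] at hv hxm
      subst hv
      exact hw.2.2 v hm x hx fun hxA => hxm (hAm x hxA)

theorem LowerGate.exists_of_max {S A : Finset P} (hA : A ⊆ S)
    (hc : IsChain (· ≤ ·) (A : Set P)) {u m : P} (hu : LowerGate S A u) (hm : m ∈ A)
    (hmax : ∀ x ∈ A, x ≤ m) : ∃ u', LowerGate S {m} u' := by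
  by_cases h : (A.erase m).Nonempty
  · obtain ⟨u', hu', hmax'⟩ := exists_max_of_isChain h (hc.mono (by simp))
    have hu'A := Finset.mem_of_mem_erase hu'
    have hmu' : u' < m := lt_of_le_of_ne (hmax u' hu'A) (Finset.ne_of_mem_erase hu')
    refine ⟨u', hA hu'A, by simpa using hmu'.ne, fun v hv x hx hxm => ?_⟩
    rw [Finset.mem_singleton] at hv hxm
    subst hv
    refine ⟨fun hvx => ?_, fun h => h.trans_lt hmu'⟩
    by_cases hxA : x ∈ A
    · exact hmax' x (Finset.mem_erase.2 ⟨hxm, hxA⟩)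
    · exact ((hu.2.2 u' hu'A x hx hxA).2 ((hu.2.2 v hm x hx hxA).1 hvx)).le
  · have hAm : ∀ x ∈ A, x = m := fun x hx => by
      by_contra hne
      exact h ⟨x, Finset.mem_erase.2 ⟨hne, hx⟩⟩
    refine ⟨u, hu.1, fun h' => hu.2.1 ?_, fun v hv x hx hxm => ?_⟩
    · rwa [Finset.mem_singleton.1 h']
    · rw [Finset.mem_singleton] at hv hxm
      subst hv
      exact hu.2.2 v hm x hx fun hxA => hxm (hAm x hxA)

theorem NoLower.singleton_min {S A : Finset P} (h : NoLower S A) {m : P} (hm : m ∈ A)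
    (hmin : ∀ x ∈ A, m ≤ x) : NoLower S {m} := by
  intro v hv x hx _ hxv
  obtain rfl := Finset.mem_singleton.1 hv
  by_cases hxA : x ∈ A
  · exact (hmin x hxA).not_gt hxv
  · exact h v hm x hx hxA hxv

theorem NoUpper.singleton_max {S A : Finset P} (h : NoUpper S A) {m : P} (hm : m ∈ A)
    (hmax : ∀ x ∈ A, x ≤ m) : NoUpper S {m} := by
  intro v hv x hx _ hxv
  obtain rfl := Finset.mem_singleton.1 hv
  by_cases hxA : x ∈ A
  · exact (hmax x hxA).not_gt hxv
  · exact h v hm x hx hxA hxv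

theorem LowerGate.singleton_min {S A : Finset P} {u : P} (h : LowerGate S A u) {m : P}
    (hm : m ∈ A) (hmin : ∀ x ∈ A, m ≤ x) : LowerGate S {m} u := by
  refine ⟨h.1, fun h' => h.2.1 (by rwa [Finset.mem_singleton.1 h']), fun v hv x hx hxm => ?_⟩
  obtain rfl := Finset.mem_singleton.1 hv
  by_cases hxA : x ∈ A
  · refine ⟨fun h' => absurd h' (hmin x hxA).not_gt, fun h' => absurd ?_ (hmin x hxA).not_gt⟩
    exact h'.trans_lt ((h.2.2 v hm u h.1 h.2.1).2 le_rfl)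
  · exact h.2.2 v hm x hx hxA

omit [PartialOrder P] in
theorem mem_of_mem_erase_of_notMem {S A : Finset P} {m x : P} (hx : x ∈ S.erase m)
    (hxA : x ∉ A.erase m) : x ∉ A :=
  fun h => hxA (Finset.mem_erase.2 ⟨Finset.ne_of_mem_erase hx, h⟩)

theorem LowerGate.erase {S A : Finset P} {u : P} (h : LowerGate S A u) {m : P} (hm : m ∈ A) :
    LowerGate (S.erase m) (A.erase m) u :=
  ⟨Finset.mem_erase.2 ⟨fun e => h.2.1 (e ▸ hm), h.1⟩, fun h' => h.2.1 (Finset.mem_of_mem_erase h'),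
    fun v hv x hx hxA => h.2.2 v (Finset.mem_of_mem_erase hv) x (Finset.mem_of_mem_erase hx)
      (mem_of_mem_erase_of_notMem hx hxA)⟩

theorem UpperGate.erase {S A : Finset P} {w : P} (h : UpperGate S A w) {m : P} (hm : m ∈ A) :
    UpperGate (S.erase m) (A.erase m) w :=
  ⟨Finset.mem_erase.2 ⟨fun e => h.2.1 (e ▸ hm), h.1⟩, fun h' => h.2.1 (Finset.mem_of_mem_erase h'),
    fun v hv x hx hxA => h.2.2 v (Finset.mem_of_mem_erase hv) x (Finset.mem_of_mem_erase hx)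
      (mem_of_mem_erase_of_notMem hx hxA)⟩

theorem NoLower.erase {S A : Finset P} (h : NoLower S A) (m : P) :
    NoLower (S.erase m) (A.erase m) := fun v hv x hx hxA =>
  h v (Finset.mem_of_mem_erase hv) x (Finset.mem_of_mem_erase hx)
    (mem_of_mem_erase_of_notMem hx hxA)

theorem NoUpper.erase {S A : Finset P} (h : NoUpper S A) (m : P) :
    NoUpper (S.erase m) (A.erase m) := fun v hv x hx hxA =>
  h v (Finset.mem_of_mem_erase hv) x (Finset.mem_of_mem_erase hx)
    (mem_of_mem_erase_of_notMem hx hxA)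

theorem Saturated.erase_minimal {S : Finset P} (hS : Saturated S) {v : P}
    (hv : NoLower S {v}) : Saturated (S.erase v) := by
  have hv' : ∀ x ∈ S, ¬ x < v := fun x hx hxv =>
    hv v (by simp) x hx (by simpa using hxv.ne) hxv
  refine ⟨fun x hx y hy hxy => ?_, fun x hx y hy hxy => ?_⟩ <;> rw [Finset.mem_erase] at hx hy
  · obtain ⟨z, hz, h1, h2⟩ := hS.exists_covBy_right x hx.2 y hy.2 hxy
    exact ⟨z, Finset.mem_erase.2 ⟨fun e => hv' x hx.2 (e ▸ h1.lt), hz⟩, h1, h2⟩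
  · obtain ⟨z, hz, h1, h2⟩ := hS.exists_covBy_left x hx.2 y hy.2 hxy
    refine ⟨z, Finset.mem_erase.2 ⟨?_, hz⟩, h1, h2⟩
    rintro rfl
    exact hv' x hx.2 (lt_of_le_of_ne h1 hx.1)

theorem Saturated.erase_maximal {S : Finset P} (hS : Saturated S) {v : P}
    (hv : NoUpper S {v}) : Saturated (S.erase v) := by
  have hv' : ∀ x ∈ S, ¬ v < x := fun x hx hxv =>
    hv v (by simp) x hx (by simpa using hxv.ne') hxv
  refine ⟨fun x hx y hy hxy => ?_, fun x hx y hy hxy => ?_⟩ <;> rw [Finset.mem_erase] at hx hy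
  · obtain ⟨z, hz, h1, h2⟩ := hS.exists_covBy_right x hx.2 y hy.2 hxy
    refine ⟨z, Finset.mem_erase.2 ⟨?_, hz⟩, h1, h2⟩
    rintro rfl
    exact hv' y hy.2 (lt_of_le_of_ne h2 hy.1.symm)
  · obtain ⟨z, hz, h1, h2⟩ := hS.exists_covBy_left x hx.2 y hy.2 hxy
    exact ⟨z, Finset.mem_erase.2 ⟨fun e => hv' y hy.2 (e ▸ h2.lt), hz⟩, h1, h2⟩

omit [PartialOrder P] in
theorem sdiff_eq_erase_sdiff_erase {S A : Finset P} {m : P} (hm : m ∈ A) :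
    S \ A = S.erase m \ A.erase m := by
  ext x
  simp only [Finset.mem_sdiff, Finset.mem_erase]
  constructor
  · rintro ⟨h1, h2⟩
    exact ⟨⟨fun e => h2 (e ▸ hm), h1⟩, fun h => h2 h.2⟩
  · rintro ⟨⟨h1, h2⟩, h3⟩
    exact ⟨h2, fun h => h3 ⟨h1, h⟩⟩

/-- Induction on a pending chain hanging below the rest of the set. -/
theorem lower_tail_induction {motive : Finset P → Prop}
    (step : ∀ (S : Finset P) (v w : P), Saturated S → v ∈ S → NoLower S {v} → UpperGate S {v} w →
      motive (S.erase v) → motive S)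
    {S A : Finset P} {w : P} (hS : Saturated S) (hA : A ⊆ S) (hc : IsChain (· ≤ ·) (A : Set P))
    (hL : NoLower S A) (hU : UpperGate S A w) (h : motive (S \ A)) : motive S := by
  induction hn : A.card generalizing S A with
  | zero =>
    rw [Finset.card_eq_zero] at hn
    subst hn
    simpa using h
  | succ n ih =>
    obtain ⟨m, hm, hmin⟩ := exists_min_of_isChain (Finset.card_pos.1 (by omega)) hc
    obtain ⟨w', hw'⟩ := hU.exists_of_min hA hc hm hmin
    have hm' := hL.singleton_min hm hmin
    refine step S m w' hS (hA hm) hm' hw' ?_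
    refine ih (hS.erase_minimal hm') (Finset.erase_subset_erase _ hA) (hc.mono (by simp))
      (hL.erase m) (hU.erase hm) ?_ (by rw [Finset.card_erase_of_mem hm]; omega)
    rwa [← sdiff_eq_erase_sdiff_erase hm]

/-- Induction on a pending chain hanging above the rest of the set. -/
theorem upper_tail_induction {motive : Finset P → Prop}
    (step : ∀ (S : Finset P) (v u : P), Saturated S → v ∈ S → NoUpper S {v} → LowerGate S {v} u →
      motive (S.erase v) → motive S)
    {S A : Finset P} {u : P} (hS : Saturated S) (hA : A ⊆ S) (hc : IsChain (· ≤ ·) (A : Set P))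
    (hU : NoUpper S A) (hL : LowerGate S A u) (h : motive (S \ A)) : motive S := by
  induction hn : A.card generalizing S A with
  | zero =>
    rw [Finset.card_eq_zero] at hn
    subst hn
    simpa using h
  | succ n ih =>
    obtain ⟨m, hm, hmax⟩ := exists_max_of_isChain (Finset.card_pos.1 (by omega)) hc
    obtain ⟨u', hu'⟩ := hL.exists_of_max hA hc hm hmax
    have hm' := hU.singleton_max hm hmax
    refine step S m u' hS (hA hm) hm' hu' ?_
    refine ih (hS.erase_maximal hm') (Finset.erase_subset_erase _ hA) (hc.mono (by simp))
      (hU.erase m) (hL.erase hm) ?_ (by rw [Finset.card_erase_of_mem hm]; omega)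
    rwa [← sdiff_eq_erase_sdiff_erase hm]

/-- Induction on the elements of an ear attached at both ends. -/
theorem ear_induction {motive : Finset P → Prop}
    (step : ∀ (S : Finset P) (v u w : P), v ∈ S → LowerGate S {v} u → UpperGate S {v} w →
      motive (S.erase v) → motive S)
    {S A : Finset P} {u w : P} (hA : A ⊆ S) (hc : IsChain (· ≤ ·) (A : Set P))
    (hL : LowerGate S A u) (hU : UpperGate S A w) (h : motive (S \ A)) : motive S := by
  induction hn : A.card generalizing S A with
  | zero =>
    rw [Finset.card_eq_zero] at hn
    subst hn
    simpa using h
  | succ n ih =>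
    obtain ⟨m, hm, hmin⟩ := exists_min_of_isChain (Finset.card_pos.1 (by omega)) hc
    obtain ⟨w', hw'⟩ := hU.exists_of_min hA hc hm hmin
    -- While part of the ear remains, erasing `m` destroys saturation: `u` and `w'` become
    -- neighbours without being related by a cover of the ambient order. Hence `step` does not
    -- assume `Saturated`.
    refine step S m u w' (hA hm) (hL.singleton_min hm hmin) hw' ?_
    refine ih (Finset.erase_subset_erase _ hA) (hc.mono (by simp))
      (hL.erase hm) (hU.erase hm) ?_ (by rw [Finset.card_erase_of_mem hm]; omega)
    rwa [← sdiff_eq_erase_sdiff_erase hm]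

end ConvexSubsets

/-! ### Linear extensions of a chain. -/

section WordSums

variable {V : Type*} [DecidableEq V]

/-- The head is the only possible first letter at each stage, so the list is the only linear
extension. -/
theorem relPsiFrom_of_isChain {R : V → V → Prop} {l : List V} (hn : l.Nodup)
    (hc : l.IsChain R) (hr : l.Pairwise (fun a b => ¬ R b a)) (p : V) :
    relPsiFrom R p l.toFinset = wordPsi (p :: l) := by
  induction l generalizing p with
  | nil => simp
  | cons a l ih =>
    -- Gluing the set to itself along the whole list gives access to the uniqueness of a source
    -- lying in the common chain.
    have hg : Glued R (a :: l).toFinset (a :: l).toFinset (a :: l) :=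
      ⟨fun x => by simp, hn, hc, fun x hx _ _ hx' => absurd hx hx', fun x hx _ _ hx' => absurd hx hx'⟩
    have hs : sources R (a :: l).toFinset = {a} := by
      ext x
      rw [Finset.mem_singleton]
      constructor
      · intro hx
        exact hg.eq_head_of_mem_sources hx (List.mem_toFinset.1 (mem_sources.1 hx).1)
      · rintro rfl
        refine mem_sources.2 ⟨by simp, fun b hb hbx => ?_⟩
        exact (List.pairwise_cons.1 hr).1 b
          ((List.mem_cons.1 (List.mem_toFinset.1 hb)).resolve_left hbx)
    have he : (a :: l).toFinset.erase a = l.toFinset := by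
      rw [List.toFinset_cons, Finset.erase_insert]
      simpa using (List.nodup_cons.1 hn).1
    rw [relPsiFrom_eq_sum R p ⟨a, by simp⟩, hs, Finset.sum_singleton, he,
      ih hn.of_cons hc.tail (List.pairwise_cons.1 hr).2 a, wordPsi_cons_cons]

theorem relPsi_of_isChain {R : V → V → Prop} {l : List V} (hn : l.Nodup)
    (hc : l.IsChain R) (hr : l.Pairwise (fun a b => ¬ R b a)) :
    relPsi R l.toFinset = wordPsi l := by
  cases l with
  | nil => simp [relPsi, extensions_empty]
  | cons a l =>
    have hg : Glued R (a :: l).toFinset (a :: l).toFinset (a :: l) :=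
      ⟨fun x => by simp, hn, hc, fun x hx _ _ hx' => absurd hx hx', fun x hx _ _ hx' => absurd hx hx'⟩
    have hs : sources R (a :: l).toFinset = {a} := by
      ext x
      rw [Finset.mem_singleton]
      constructor
      · intro hx
        exact hg.eq_head_of_mem_sources hx (List.mem_toFinset.1 (mem_sources.1 hx).1)
      · rintro rfl
        refine mem_sources.2 ⟨by simp, fun b hb hbx => ?_⟩
        exact (List.pairwise_cons.1 hr).1 b
          ((List.mem_cons.1 (List.mem_toFinset.1 hb)).resolve_left hbx)
    have he : (a :: l).toFinset.erase a = l.toFinset := by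
      rw [List.toFinset_cons, Finset.erase_insert]
      simpa using (List.nodup_cons.1 hn).1
    rw [relPsi_eq_sum R ⟨a, by simp⟩, hs, Finset.sum_singleton, he,
      relPsiFrom_of_isChain hn.of_cons hc.tail (List.pairwise_cons.1 hr).2 a]

end WordSums

/-! ### Effect on Ψ of erasing one element. -/

section Erasing

variable {P : Type*} [PartialOrder P] [DecidableEq P]

omit [PartialOrder P] in
theorem union_insert_erase {S T : Finset P} {v : P} (hv : v ∈ S) (hT : T ⊆ S) :
    S.erase v ∪ insert v T = S := by
  ext x
  simp only [Finset.mem_union, Finset.mem_erase, Finset.mem_insert]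
  constructor
  · rintro (h | rfl | h)
    exacts [h.2, hv, hT h]
  · intro h
    by_cases hx : x = v
    exacts [Or.inr (Or.inl hx), Or.inl ⟨hx, h⟩]

/-- Erasing a minimal element all of whose relations go through `w`. -/
theorem relPsi_erase_of_upperGate {S : Finset P} {v w : P} (hv : v ∈ S) (hL : NoLower S {v})
    (hU : UpperGate S {v} w) :
    relPsi (· < ·) S = (var v - var w)⁻¹ * relPsi (· < ·) (S.erase v) := by
  have hwv : w ≠ v := by simpa using hU.2.1
  have hvw : v < w := (hU.2.2 v (by simp) w hU.1 hU.2.1).2 le_rfl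
  have hL' : ∀ x ∈ S, ¬ x < v := fun x hx hxv => hL v (by simp) x hx (by simpa using hxv.ne) hxv
  have hU' : ∀ x ∈ S, v < x → w ≤ x := fun x hx hvx =>
    (hU.2.2 v (by simp) x hx (by simpa using hvx.ne')).1 hvx
  -- All relations of `v` except v < w are dropped; they follow by transitivity, so the linear
  -- extensions are the same. For `R` the set is glued from `S.erase v` and {v, w} along the single
  -- point `w`.
  let R : P → P → Prop := fun a b => a < b ∧ b ≠ v ∧ (a = v → b = w)
  have h1 : relPsi (· < ·) S = relPsi R S := by
    refine (relPsi_congr (fun a _ b _ h => h.1) fun a ha b hb hab => ?_).symm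
    have hbv : b ≠ v := by
      rintro rfl
      exact hL' a ha hab
    by_cases hav : a = v
    · subst hav
      have h2 : Relation.ReflTransGen (fun x y => x ∈ S ∧ y ∈ S ∧ R x y) a w :=
        Relation.ReflTransGen.single ⟨hv, hU.1, hvw, hwv, fun _ => rfl⟩
      rcases (hU' b hb hab).eq_or_lt with rfl | hwb
      · exact h2
      · exact h2.tail ⟨hU.1, hb, hwb, hbv, fun h => absurd h hwv⟩
    · exact Relation.ReflTransGen.single ⟨ha, hb, hab, hbv, fun h => absurd h hav⟩
  have h2 : relPsi (· < ·) (S.erase v) = relPsi R (S.erase v) := by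
    refine (relPsi_congr (fun a _ b _ h => h.1) fun a ha b hb hab => ?_).symm
    exact Relation.ReflTransGen.single ⟨ha, hb, hab, Finset.ne_of_mem_erase hb,
      fun h => absurd h (Finset.ne_of_mem_erase ha)⟩
  have hg : Glued R (S.erase v) {v, w} [w] := by
    refine ⟨fun a => ?_, by simp, by simp, fun a ha b hb ha' hb' h => ?_,
      fun a ha b hb ha' hb' h => ?_⟩
    · simp only [Finset.mem_erase, Finset.mem_insert, Finset.mem_singleton, List.mem_singleton]
      constructor
      · rintro ⟨⟨h1, -⟩, h2⟩
        exact h2.resolve_left h1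
      · rintro rfl
        exact ⟨⟨hwv, hU.1⟩, Or.inr rfl⟩
    all_goals
      have hbv : b = v := by
        rcases Finset.mem_insert.1 hb with rfl | hb
        · rfl
        · rw [Finset.mem_singleton.1 hb] at hb'
          exact absurd (Finset.mem_erase.2 ⟨hwv, hU.1⟩) hb'
    · exact h.2.1 hbv
    · exact ha' (by simp [h.2.2 hbv])
  have h3 := hg.relPsi_union ⟨w, Finset.mem_erase.2 ⟨hwv, hU.1⟩⟩ ⟨w, by simp⟩
  rw [union_insert_erase hv (by simpa using hU.1), relPsi_pair ⟨hvw, hwv, fun _ => rfl⟩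
    (fun h => h.1.asymm hvw) hwv.symm] at h3
  rw [h1, h2, h3]
  simp [mul_comm]

/-- Erasing a maximal element all of whose relations go through `u`. -/
theorem relPsi_erase_of_lowerGate {S : Finset P} {v u : P} (hv : v ∈ S) (hU : NoUpper S {v})
    (hL : LowerGate S {v} u) :
    relPsi (· < ·) S = (var u - var v)⁻¹ * relPsi (· < ·) (S.erase v) := by
  have huv : u ≠ v := by simpa using hL.2.1
  have huv' : u < v := (hL.2.2 v (by simp) u hL.1 hL.2.1).2 le_rfl
  have hU' : ∀ x ∈ S, ¬ v < x := fun x hx hxv => hU v (by simp) x hx (by simpa using hxv.ne') hxv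
  have hL' : ∀ x ∈ S, x < v → x ≤ u := fun x hx hvx =>
    (hL.2.2 v (by simp) x hx (by simpa using hvx.ne)).1 hvx
  let R : P → P → Prop := fun a b => a < b ∧ a ≠ v ∧ (b = v → a = u)
  have h1 : relPsi (· < ·) S = relPsi R S := by
    refine (relPsi_congr (fun a _ b _ h => h.1) fun a ha b hb hab => ?_).symm
    have hav : a ≠ v := by
      rintro rfl
      exact hU' b hb hab
    by_cases hbv : b = v
    · subst hbv
      have h2 : (fun x y => x ∈ S ∧ y ∈ S ∧ R x y) u b := ⟨hL.1, hv, huv', huv, fun _ => rfl⟩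
      rcases (hL' a ha hab).eq_or_lt with rfl | hau
      · exact Relation.ReflTransGen.single h2
      · exact (Relation.ReflTransGen.single
          ⟨ha, hL.1, hau, hav, fun h => absurd h huv⟩).tail h2
    · exact Relation.ReflTransGen.single ⟨ha, hb, hab, hav, fun h => absurd h hbv⟩
  have h2 : relPsi (· < ·) (S.erase v) = relPsi R (S.erase v) := by
    refine (relPsi_congr (fun a _ b _ h => h.1) fun a ha b hb hab => ?_).symm
    exact Relation.ReflTransGen.single ⟨ha, hb, hab, Finset.ne_of_mem_erase ha,
      fun h => absurd h (Finset.ne_of_mem_erase hb)⟩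
  have hg : Glued R (S.erase v) {v, u} [u] := by
    refine ⟨fun a => ?_, by simp, by simp, fun a ha b hb ha' hb' h => ?_,
      fun a ha b hb ha' hb' h => ?_⟩
    · simp only [Finset.mem_erase, Finset.mem_insert, Finset.mem_singleton, List.mem_singleton]
      constructor
      · rintro ⟨⟨h1, -⟩, h2⟩
        exact h2.resolve_left h1
      · rintro rfl
        exact ⟨⟨huv, hL.1⟩, Or.inr rfl⟩
    all_goals
      have hbv : b = v := by
        rcases Finset.mem_insert.1 hb with rfl | hb
        · rfl
        · rw [Finset.mem_singleton.1 hb] at hb'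
          exact absurd (Finset.mem_erase.2 ⟨huv, hL.1⟩) hb'
    · exact ha' (by simp [h.2.2 hbv])
    · exact h.2.1 hbv
  have h3 := hg.relPsi_union ⟨u, Finset.mem_erase.2 ⟨huv, hL.1⟩⟩ ⟨u, by simp⟩
  rw [union_insert_erase hv (by simpa using hL.1), Finset.pair_comm,
    relPsi_pair ⟨huv', huv, fun _ => rfl⟩ (fun h => h.1.asymm huv') huv] at h3
  rw [h1, h2, h3]
  simp [mul_comm]

/-- Erasing an element all of whose relations go through `u` and `w`. -/
theorem relPsi_erase_of_gates {S : Finset P} {v u w : P} (hv : v ∈ S) (hL : LowerGate S {v} u)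
    (hU : UpperGate S {v} w) :
    relPsi (· < ·) S = (var u - var v)⁻¹ * (var v - var w)⁻¹ * (var u - var w) *
      relPsi (· < ·) (S.erase v) := by
  have huv : u ≠ v := by simpa using hL.2.1
  have huv' : u < v := (hL.2.2 v (by simp) u hL.1 hL.2.1).2 le_rfl
  have hL' : ∀ x ∈ S, x < v → x ≤ u := fun x hx hvx =>
    (hL.2.2 v (by simp) x hx (by simpa using hvx.ne)).1 hvx
  have hwv : w ≠ v := by simpa using hU.2.1
  have hvw : v < w := (hU.2.2 v (by simp) w hU.1 hU.2.1).2 le_rfl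
  have hU' : ∀ x ∈ S, v < x → w ≤ x := fun x hx hvx =>
    (hU.2.2 v (by simp) x hx (by simpa using hvx.ne')).1 hvx
  have huw := huv'.trans hvw
  -- Only u < v < w is kept at `v`. The set is then glued from `S.erase v` and the chain u, v, w
  -- along u, w, and the factor is ψ_{uvw}/ψ_{uw}.
  let R : P → P → Prop := fun a b => a < b ∧ (a = v → b = w) ∧ (b = v → a = u)
  have h1 : relPsi (· < ·) S = relPsi R S := by
    refine (relPsi_congr (fun a _ b _ h => h.1) fun a ha b hb hab => ?_).symm
    by_cases hav : a = v
    · subst hav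
      have h2 : Relation.ReflTransGen (fun x y => x ∈ S ∧ y ∈ S ∧ R x y) a w :=
        Relation.ReflTransGen.single ⟨hv, hU.1, hvw, fun _ => rfl, fun h => absurd h hwv⟩
      rcases (hU' b hb hab).eq_or_lt with rfl | hwb
      · exact h2
      · exact h2.tail ⟨hU.1, hb, hwb, fun h => absurd h hwv, fun h => absurd h hab.ne'⟩
    by_cases hbv : b = v
    · subst hbv
      have h2 : (fun x y => x ∈ S ∧ y ∈ S ∧ R x y) u b :=
        ⟨hL.1, hv, huv', fun h => absurd h huv, fun _ => rfl⟩
      rcases (hL' a ha hab).eq_or_lt with rfl | hau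
      · exact Relation.ReflTransGen.single h2
      · exact (Relation.ReflTransGen.single
          ⟨ha, hL.1, hau, fun h => absurd h hav, fun h => absurd h huv⟩).tail h2
    · exact Relation.ReflTransGen.single ⟨ha, hb, hab, fun h => absurd h hav, fun h => absurd h hbv⟩
  have h2 : relPsi (· < ·) (S.erase v) = relPsi R (S.erase v) := by
    refine (relPsi_congr (fun a _ b _ h => h.1) fun a ha b hb hab => ?_).symm
    exact Relation.ReflTransGen.single ⟨ha, hb, hab, fun h => absurd h (Finset.ne_of_mem_erase ha),
      fun h => absurd h (Finset.ne_of_mem_erase hb)⟩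
  have hg : Glued R (S.erase v) {v, u, w} [u, w] := by
    refine ⟨fun a => ?_, by simpa using huw.ne, ?_, fun a ha b hb ha' hb' h => ?_,
      fun a ha b hb ha' hb' h => ?_⟩
    · simp only [Finset.mem_erase, Finset.mem_insert, Finset.mem_singleton, List.mem_cons,
        List.not_mem_nil, or_false]
      constructor
      · rintro ⟨⟨h1, -⟩, h2⟩
        exact h2.resolve_left h1
      · rintro (rfl | rfl)
        exacts [⟨⟨huv, hL.1⟩, Or.inr (Or.inl rfl)⟩, ⟨⟨hwv, hU.1⟩, Or.inr (Or.inr rfl)⟩]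
    · simpa using ⟨huw, fun h => absurd h huv, fun h => absurd h hwv⟩
    all_goals
      have hbv : b = v := by
        simp only [Finset.mem_insert, Finset.mem_singleton] at hb
        rcases hb with rfl | rfl | rfl
        · rfl
        · exact absurd (Finset.mem_erase.2 ⟨huv, hL.1⟩) hb'
        · exact absurd (Finset.mem_erase.2 ⟨hwv, hU.1⟩) hb'
    · exact ha' (by simp [h.2.2 hbv])
    · exact ha' (by simp [h.2.1 hbv])
  have h3 := hg.relPsi_union ⟨u, Finset.mem_erase.2 ⟨huv, hL.1⟩⟩ ⟨u, by simp⟩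
  have h4 : relPsi R ({v, u, w} : Finset P) = (var u - var v)⁻¹ * (var v - var w)⁻¹ := by
    have h5 := relPsi_of_isChain (R := R) (l := [u, v, w])
      (by simpa using ⟨⟨huv, huw.ne⟩, hwv.symm⟩)
      (by simpa using ⟨⟨huv', fun h => absurd h huv, fun _ => rfl⟩,
        ⟨hvw, fun _ => rfl, fun h => absurd h hwv⟩⟩)
      (by simpa using ⟨⟨fun h => (h.1.asymm huv').elim, fun h => (h.1.asymm huw).elim⟩,
        fun h => (h.1.asymm hvw).elim⟩)
    have h6 : ([u, v, w] : List P).toFinset = {v, u, w} := by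
      ext x
      simp only [List.mem_toFinset, List.mem_cons, List.not_mem_nil, or_false, Finset.mem_insert,
        Finset.mem_singleton]
      tauto
    rw [← h6, h5]
    simp
  have hsub : ({u, w} : Finset P) ⊆ S := by
    intro x hx
    rcases Finset.mem_insert.1 hx with rfl | hx
    exacts [hL.1, Finset.mem_singleton.1 hx ▸ hU.1]
  rw [union_insert_erase hv hsub, h4] at h3
  rw [h1, h2, h3]
  simp
  ring

end Erasing

/-! ### The Möbius function and Greene's product under erasing an element. -/

section Greene

variable {P : Type*} [PartialOrder P]

open Classical in
/-- `m` is the Möbius function of the order induced on `S`. -/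
def IsMobius (S : Finset P) (m : P → P → ℤ) : Prop :=
  ∀ y ∈ S, ∀ z ∈ S, y ≤ z →
    ∑ t ∈ S.filter (fun t => y ≤ t ∧ t ≤ z), m y t = if y = z then 1 else 0

open Classical in
/-- Greene's product over the relations of `S`. -/
noncomputable def mobiusProd (S : Finset P) (m : P → P → ℤ) : RatFun P :=
  ∏ e ∈ (S ×ˢ S).filter (fun e => e.1 < e.2), (var e.1 - var e.2) ^ m e.1 e.2

/-- Greene's formula for the order induced on `S`. -/
def GreeneFormula (S : Finset P) : Prop :=
  ∀ m, IsMobius S m → relPsi (· < ·) S = mobiusProd S m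

variable [DecidableEq P]

omit [DecidableEq P] in
theorem IsMobius.apply_self {S : Finset P} {m : P → P → ℤ} (hm : IsMobius S m) {y : P}
    (hy : y ∈ S) : m y y = 1 := by
  classical
  have h := hm y hy y hy le_rfl
  have h1 : S.filter (fun t => y ≤ t ∧ t ≤ y) = {y} := by
    ext t
    simp only [Finset.mem_filter, Finset.mem_singleton]
    refine ⟨fun h => le_antisymm h.2.2 h.2.1, ?_⟩
    rintro rfl
    exact ⟨hy, le_rfl, le_rfl⟩
  rwa [h1, Finset.sum_singleton, if_pos rfl] at h

/-- The interval from `y` to `v` is the one from `y` to `u` with `v` added, and the sum over the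
latter is already 1 or 0 according to whether y = u. -/
theorem IsMobius.apply_of_lowerGate {S : Finset P} {m : P → P → ℤ} (hm : IsMobius S m) {y u v : P}
    (hv : v ∈ S) (hL : LowerGate S {v} u) (hy : y ∈ S) (hyv : y < v) :
    m y v = if y = u then -1 else 0 := by
  classical
  have huv : u < v := (hL.2.2 v (by simp) u hL.1 hL.2.1).2 le_rfl
  have hL' : ∀ x ∈ S, x < v → x ≤ u := fun x hx hvx =>
    (hL.2.2 v (by simp) x hx (by simpa using hvx.ne)).1 hvx
  have h := hm y hy v hv hyv.le
  have h1 : S.filter (fun t => y ≤ t ∧ t ≤ v) =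
      insert v (S.filter (fun t => y ≤ t ∧ t ≤ u)) := by
    ext t
    simp only [Finset.mem_filter, Finset.mem_insert]
    constructor
    · rintro ⟨h1, h2, h3⟩
      rcases h3.eq_or_lt with h3 | h3
      exacts [Or.inl h3, Or.inr ⟨h1, h2, hL' t h1 h3⟩]
    · rintro (rfl | ⟨h1, h2, h3⟩)
      exacts [⟨hv, hyv.le, le_rfl⟩, ⟨h1, h2, h3.trans huv.le⟩]
  rw [h1, Finset.sum_insert (by simpa using fun _ _ => huv.not_ge),
    hm y hy u hL.1 (hL' y hy hyv), if_neg hyv.ne] at h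
  split_ifs at h ⊢ <;> linarith

/-- `IsMobius` sums over the second variable, so here an induction on `z` is needed: among the
elements from `w` up to but excluding `z`, only `w` contributes, by -1, cancelling the 1 at `v`. -/
theorem IsMobius.apply_of_upperGate [Finite P] {S : Finset P} {m : P → P → ℤ} (hm : IsMobius S m)
    {z w v : P} (hv : v ∈ S) (hU : UpperGate S {v} w) (hz : z ∈ S) (hvz : v < z) :
    m v z = if z = w then -1 else 0 := by
  classical
  have hvw : v < w := (hU.2.2 v (by simp) w hU.1 hU.2.1).2 le_rfl
  have hU' : ∀ x ∈ S, v < x → w ≤ x := fun x hx hvx =>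
    (hU.2.2 v (by simp) x hx (by simpa using hvx.ne')).1 hvx
  induction z using WellFoundedLT.induction with
  | _ z ih =>
  have h := hm v hv z hz hvz.le
  have hwz := hU' z hz hvz
  have h1 : S.filter (fun t => v ≤ t ∧ t ≤ z) =
      insert v (insert z (S.filter (fun t => w ≤ t ∧ t < z))) := by
    ext t
    simp only [Finset.mem_filter, Finset.mem_insert]
    constructor
    · rintro ⟨h1, h2, h3⟩
      rcases h2.eq_or_lt with h2 | h2
      · exact Or.inl h2.symm
      rcases h3.eq_or_lt with h3 | h3
      exacts [Or.inr (Or.inl h3), Or.inr (Or.inr ⟨h1, hU' t h1 h2, h3⟩)]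
    · rintro (rfl | rfl | ⟨h1, h2, h3⟩)
      exacts [⟨hv, le_rfl, hvz.le⟩, ⟨hz, hvz.le, le_rfl⟩, ⟨h1, hvw.le.trans h2, h3.le⟩]
  have h2 : ∑ t ∈ S.filter (fun t => w ≤ t ∧ t < z), m v t = if z = w then 0 else -1 := by
    rw [Finset.sum_congr rfl (g := fun t => if t = w then (-1 : ℤ) else 0), Finset.sum_ite_eq']
    · by_cases hzw : z = w
      · simp [hzw]
      · have : w < z := lt_of_le_of_ne hwz (Ne.symm hzw)
        simp [hzw, hU.1, this]
    · intro t ht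
      rw [Finset.mem_filter] at ht
      exact ih t ht.2.2 ht.1 (hvw.trans_le ht.2.1)
  rw [h1, Finset.sum_insert, Finset.sum_insert (by simp), h2, hm.apply_self hv,
    if_neg hvz.ne] at h
  · split_ifs at h ⊢ <;> linarith
  · simp only [Finset.mem_insert, Finset.mem_filter, not_or, not_and]
    exact ⟨hvz.ne, fun _ h => absurd h hvw.not_ge⟩

open Classical in
/-- Greene's product, with the factors involving a given element set apart. -/
theorem mobiusProd_erase {S : Finset P} {v : P} (hv : v ∈ S) (m : P → P → ℤ) :
    mobiusProd S m = mobiusProd (S.erase v) m *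
      (∏ y ∈ S.filter (· < v), (var y - var v) ^ m y v) *
      ∏ z ∈ S.filter (v < ·), (var v - var z) ^ m v z := by
  classical
  have h1 : (S ×ˢ S).filter (fun e => e.1 < e.2) =
      ((S.erase v ×ˢ S.erase v).filter (fun e => e.1 < e.2) ∪
        (S.filter (· < v)).image (fun y => (y, v))) ∪ (S.filter (v < ·)).image (fun z => (v, z)) := by
    ext ⟨a, b⟩
    simp only [Finset.mem_filter, Finset.mem_product, Finset.mem_union, Finset.mem_image,
      Finset.mem_erase, Prod.mk.injEq]
    constructor
    · rintro ⟨⟨ha, hb⟩, hab⟩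
      by_cases hav : a = v
      · exact Or.inr ⟨b, ⟨hb, hav ▸ hab⟩, hav.symm, rfl⟩
      by_cases hbv : b = v
      · exact Or.inl (Or.inr ⟨a, ⟨ha, hbv ▸ hab⟩, rfl, hbv.symm⟩)
      · exact Or.inl (Or.inl ⟨⟨⟨hav, ha⟩, hbv, hb⟩, hab⟩)
    · rintro ((⟨⟨⟨_, ha⟩, _, hb⟩, hab⟩ | ⟨y, ⟨hy, hyv⟩, rfl, rfl⟩) | ⟨y, ⟨hy, hyv⟩, rfl, rfl⟩)
      exacts [⟨⟨ha, hb⟩, hab⟩, ⟨⟨hy, hv⟩, hyv⟩, ⟨⟨hv, hy⟩, hyv⟩]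
  unfold mobiusProd
  rw [h1, Finset.prod_union, Finset.prod_union, Finset.prod_image, Finset.prod_image]
  · simp
  · intro a _ b _ h
    exact (Prod.mk.inj h).1
  · rw [Finset.disjoint_left]
    rintro ⟨a, b⟩ h h'
    simp only [Finset.mem_filter, Finset.mem_product, Finset.mem_image,
      Finset.mem_erase, Prod.mk.injEq] at h h'
    obtain ⟨y, -, -, rfl⟩ := h'
    exact h.1.2.1 rfl
  · rw [Finset.disjoint_left]
    rintro ⟨a, b⟩ h h'
    simp only [Finset.mem_filter, Finset.mem_product, Finset.mem_image, Finset.mem_union,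
      Finset.mem_erase, Prod.mk.injEq] at h h'
    obtain ⟨y, hy, rfl, rfl⟩ := h'
    rcases h with h | ⟨x, hx, rfl, rfl⟩
    · exact h.1.1.1 rfl
    · exact lt_irrefl _ hy.2

open Classical in
theorem prod_lowerGate {S : Finset P} {m : P → P → ℤ} (hm : IsMobius S m) {u v : P}
    (hv : v ∈ S) (hL : LowerGate S {v} u) :
    ∏ y ∈ S.filter (· < v), (var y - var v) ^ m y v = (var u - var v)⁻¹ := by
  have huv : u < v := (hL.2.2 v (by simp) u hL.1 hL.2.1).2 le_rfl
  rw [Finset.prod_eq_single u]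
  · rw [hm.apply_of_lowerGate hv hL hL.1 huv, if_pos rfl, zpow_neg_one]
  · intro y hy hyu
    rw [Finset.mem_filter] at hy
    rw [hm.apply_of_lowerGate hv hL hy.1 hy.2, if_neg hyu, zpow_zero]
  · intro h
    exact absurd (Finset.mem_filter.2 ⟨hL.1, huv⟩) h

open Classical in
theorem prod_upperGate [Finite P] {S : Finset P} {m : P → P → ℤ} (hm : IsMobius S m) {w v : P}
    (hv : v ∈ S) (hU : UpperGate S {v} w) :
    ∏ z ∈ S.filter (v < ·), (var v - var z) ^ m v z = (var v - var w)⁻¹ := by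
  have hvw : v < w := (hU.2.2 v (by simp) w hU.1 hU.2.1).2 le_rfl
  rw [Finset.prod_eq_single w]
  · rw [hm.apply_of_upperGate hv hU hU.1 hvw, if_pos rfl, zpow_neg_one]
  · intro y hy hyu
    rw [Finset.mem_filter] at hy
    rw [hm.apply_of_upperGate hv hU hy.1 hy.2, if_neg hyu, zpow_zero]
  · intro h
    exact absurd (Finset.mem_filter.2 ⟨hU.1, hvw⟩) h

/-- An element not strictly between two others lies in no interval of the remaining set. -/
theorem IsMobius.erase {S : Finset P} {m : P → P → ℤ} (hm : IsMobius S m) {v : P}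
    (hv : ∀ y ∈ S, ∀ z ∈ S, y < v → ¬ v < z) : IsMobius (S.erase v) m := by
  classical
  intro y hy z hz hyz
  rw [Finset.mem_erase] at hy hz
  rw [← hm y hy.2 z hz.2 hyz]
  refine Finset.sum_congr (Finset.ext fun t => ?_) fun _ _ => rfl
  simp only [Finset.mem_filter, Finset.mem_erase]
  constructor
  · rintro ⟨⟨h1, h2⟩, h3⟩
    exact ⟨h2, h3⟩
  · rintro ⟨h2, h3⟩
    refine ⟨⟨?_, h2⟩, h3⟩
    rintro rfl
    exact hv y hy.2 z hz.2 (lt_of_le_of_ne h3.1 hy.1) (lt_of_le_of_ne h3.2 hz.1.symm)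

/-- Erasing `v` takes `m y v` out of the intervals containing it, which is -1 precisely when y = u.
Each such interval also contains `w`, so lowering the value at (u, w) by 1 restores all the sums. -/
theorem IsMobius.erase_of_gates {S : Finset P} {m : P → P → ℤ} (hm : IsMobius S m) {u v w : P}
    (hv : v ∈ S) (hL : LowerGate S {v} u) (hU : UpperGate S {v} w) :
    IsMobius (S.erase v) (fun y z => m y z - if y = u ∧ z = w then 1 else 0) := by
  classical
  intro y hy z hz hyz
  have huv : u < v := (hL.2.2 v (by simp) u hL.1 hL.2.1).2 le_rfl
  have hvw : v < w := (hU.2.2 v (by simp) w hU.1 hU.2.1).2 le_rfl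
  rw [Finset.mem_erase] at hy hz
  have h1 : (S.erase v).filter (fun t => y ≤ t ∧ t ≤ z) =
      (S.filter (fun t => y ≤ t ∧ t ≤ z)).erase v := by
    ext t
    simp only [Finset.mem_filter, Finset.mem_erase, and_assoc]
  have h2 : ∑ t ∈ (S.erase v).filter (fun t => y ≤ t ∧ t ≤ z), (if y = u ∧ t = w then (1 : ℤ) else 0)
      = if y = u ∧ w ≤ z then 1 else 0 := by
    by_cases hyu : y = u
    · subst hyu
      simp only [true_and]
      rw [Finset.sum_ite_eq']
      simp [hvw.ne', hU.1, (huv.trans hvw).le]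
    · simp [hyu]
  rw [Finset.sum_sub_distrib, h2, h1]
  by_cases hvm : y ≤ v ∧ v ≤ z
  · have hyv : y < v := lt_of_le_of_ne hvm.1 hy.1
    have hvz : v < z := lt_of_le_of_ne hvm.2 hz.1.symm
    have hwz : w ≤ z := (hU.2.2 v (by simp) z hz.2 (by simpa using hz.1)).1 hvz
    rw [Finset.sum_erase_eq_sub (Finset.mem_filter.2 ⟨hv, hvm⟩), hm y hy.2 z hz.2 hyz,
      hm.apply_of_lowerGate hv hL hy.2 hyv]
    simp only [hwz, and_true]
    split_ifs <;> simp
  · have hn : v ∉ S.filter (fun t => y ≤ t ∧ t ≤ z) := fun h => hvm (Finset.mem_filter.1 h).2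
    rw [Finset.erase_eq_of_notMem hn, hm y hy.2 z hz.2 hyz]
    have hn' : ¬ (y = u ∧ w ≤ z) := by
      rintro ⟨rfl, hwz⟩
      exact hvm ⟨huv.le, hvw.le.trans hwz⟩
    rw [if_neg hn', sub_zero]

theorem GreeneFormula.of_erase_minimal [Finite P] {S : Finset P} {v w : P} (hv : v ∈ S)
    (hL : NoLower S {v}) (hU : UpperGate S {v} w) (h : GreeneFormula (S.erase v)) :
    GreeneFormula S := by
  classical
  intro m hm
  have hL' : ∀ x ∈ S, ¬ x < v := fun x hx hxv => hL v (by simp) x hx (by simpa using hxv.ne) hxv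
  rw [relPsi_erase_of_upperGate hv hL hU, h m (hm.erase fun y hy _ _ hyv => absurd hyv (hL' y hy)),
    mobiusProd_erase hv m, prod_upperGate hm hv hU, Finset.filter_eq_empty_iff.2 (hL' ·),
    Finset.prod_empty]
  ring

theorem GreeneFormula.of_erase_maximal {S : Finset P} {v u : P} (hv : v ∈ S)
    (hU : NoUpper S {v}) (hL : LowerGate S {v} u) (h : GreeneFormula (S.erase v)) :
    GreeneFormula S := by
  classical
  intro m hm
  have hU' : ∀ x ∈ S, ¬ v < x := fun x hx hxv => hU v (by simp) x hx (by simpa using hxv.ne') hxv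
  rw [relPsi_erase_of_lowerGate hv hU hL, h m (hm.erase fun _ _ z hz _ => hU' z hz),
    mobiusProd_erase hv m, prod_lowerGate hm hv hL, Finset.filter_eq_empty_iff.2 (hU' ·),
    Finset.prod_empty]
  ring

theorem GreeneFormula.of_erase_gates [Finite P] {S : Finset P} {v u w : P} (hv : v ∈ S)
    (hL : LowerGate S {v} u) (hU : UpperGate S {v} w) (h : GreeneFormula (S.erase v)) :
    GreeneFormula S := by
  classical
  intro m hm
  have huv : u < v := (hL.2.2 v (by simp) u hL.1 hL.2.1).2 le_rfl
  have hvw : v < w := (hU.2.2 v (by simp) w hU.1 hU.2.1).2 le_rfl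
  have huw := huv.trans hvw
  -- The exponent of x_u - x_w drops by one when `v` is erased; this is the numerator in
  -- `relPsi_erase_of_gates`.
  have h1 : mobiusProd (S.erase v) m = (var u - var w) * mobiusProd (S.erase v)
      (fun y z => m y z - if y = u ∧ z = w then 1 else 0) := by
    have hmem : (u, w) ∈ (S.erase v ×ˢ S.erase v).filter (fun e => e.1 < e.2) := by
      simp [huv.ne, hvw.ne', hL.1, hU.1, huw]
    unfold mobiusProd
    rw [← Finset.mul_prod_erase _ _ hmem, ← Finset.mul_prod_erase _ _ hmem, ← mul_assoc]
    congr 1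
    · simp only [and_self, if_true]
      rw [zpow_sub_one₀ (var_sub_ne_zero huw.ne), mul_comm, inv_mul_cancel_right₀
        (var_sub_ne_zero huw.ne)]
    · refine Finset.prod_congr rfl fun e he => ?_
      have : ¬ (e.1 = u ∧ e.2 = w) := fun h => Finset.ne_of_mem_erase he (Prod.ext h.1 h.2)
      change _ = _ ^ (m e.1 e.2 - if e.1 = u ∧ e.2 = w then 1 else 0)
      rw [if_neg this, sub_zero]
  rw [relPsi_erase_of_gates hv hL hU, h _ (hm.erase_of_gates hv hL hU),
    mobiusProd_erase hv m, prod_upperGate hm hv hU, prod_lowerGate hm hv hL, h1]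
  ring

theorem greeneFormula_singleton (a : P) : GreeneFormula ({a} : Finset P) := by
  classical
  intro m _
  have : (({a} : Finset P) ×ˢ ({a} : Finset P)).filter (fun e => e.1 < e.2) = ∅ := by
    refine Finset.filter_eq_empty_iff.2 fun e he => ?_
    rw [Finset.mem_product, Finset.mem_singleton, Finset.mem_singleton] at he
    rw [he.1, he.2]
    exact lt_irrefl a
  rw [relPsi_singleton, mobiusProd, this, Finset.prod_empty]

end Greene

/-! ### Induced subgraphs of the Hasse diagram and their numerators. -/

section Subgraphs

variable {P : Type*} [Fintype P] [DecidableEq P] [PartialOrder P]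

/-- The subgraph of the Hasse diagram induced on `S`. -/
noncomputable def hasseSub (S : Finset P) : DGraph P := (hasseGraph P).induce S

@[simp] theorem hasseSub_verts (S : Finset P) : (hasseSub S).verts = S := by
  simp [hasseSub, DGraph.induce, hasseGraph]

theorem mem_hasseSub_edges {S : Finset P} {a b : P} :
    (a, b) ∈ (hasseSub S).edges ↔ a ∈ S ∧ b ∈ S ∧ a ⋖ b := by
  simp only [hasseSub, DGraph.induce, Finset.mem_filter, mem_edges_hasseGraph]
  tauto

theorem mem_hasseSub_edges' {S : Finset P} {e : P × P} :
    e ∈ (hasseSub S).edges ↔ e.1 ∈ S ∧ e.2 ∈ S ∧ e.1 ⋖ e.2 := mem_hasseSub_edges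

theorem hasseSub_univ : hasseSub (Finset.univ : Finset P) = hasseGraph P := by
  ext x
  · simp [hasseGraph]
  · simp [mem_hasseSub_edges', hasseGraph]

theorem hasseSub_induce (S T : Finset P) : (hasseSub S).induce T = hasseSub (S ∩ T) := by
  ext x
  · simp [DGraph.induce]
  · simp only [DGraph.induce, Finset.mem_filter, mem_hasseSub_edges', Finset.mem_inter]
    tauto

theorem hasseSub_erase (S T : Finset P) : (hasseSub S).erase T = hasseSub (S \ T) := by
  rw [DGraph.erase, hasseSub_induce, hasseSub_verts,
    Finset.inter_eq_right.2 Finset.sdiff_subset]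

theorem hasseSub_erase_singleton (S : Finset P) (v : P) :
    (hasseSub S).erase {v} = hasseSub (S.erase v) := by
  rw [hasseSub_erase, Finset.sdiff_singleton_eq_erase]

theorem hasseSub_Psi (S : Finset P) : (hasseSub S).Psi = relPsi (· ⋖ ·) S := by
  refine Finset.sum_congr (Finset.ext fun w => ?_) fun _ _ => rfl
  simp only [DGraph.linExt, Finset.mem_filter, mem_words, hasseSub_verts, mem_extensions_iff_idxOf,
    mem_hasseSub_edges']
  exact and_congr_right fun _ => ⟨fun h a ha b hb hab => h (a, b) ⟨ha, hb, hab⟩,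
    fun h e he => h e.1 he.1 e.2 he.2.1 he.2.2⟩

omit [DecidableEq P] in
theorem Saturated.reflTransGen {S : Finset P} (hS : Saturated S) {x y : P} (hx : x ∈ S)
    (hy : y ∈ S) (hxy : x ≤ y) :
    Relation.ReflTransGen (fun a b => a ∈ S ∧ b ∈ S ∧ a ⋖ b) x y := by
  induction x using WellFoundedGT.induction with
  | _ x ih =>
  rcases hxy.eq_or_lt with rfl | hxy
  · exact Relation.ReflTransGen.refl
  · obtain ⟨z, hz, h1, h2⟩ := hS.exists_covBy_right x hx y hy hxy
    exact (ih z h1.lt hz h2).head ⟨hx, hz, h1⟩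

/-- Saturation says that the covers inside `S` generate the induced order, so graph and order have
the same linear extensions. This is the passage between the graph-theoretic N and the
order-theoretic erasing lemmas. -/
theorem Saturated.relPsi_eq {S : Finset P} (hS : Saturated S) :
    relPsi (· ⋖ ·) S = relPsi (· < ·) S :=
  relPsi_congr (fun _ _ _ _ h => h.lt) fun _ ha _ hb hab => hS.reflTransGen ha hb hab.le

/-- The product of the factors `x_{α(e)} - x_{ω(e)}` over the covering relations inside `S`. -/
noncomputable def edgeProd (S : Finset P) : RatFun P :=
  ∏ e ∈ (hasseSub S).edges, (var e.1 - var e.2)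

theorem hasseSub_N (S : Finset P) : (hasseSub S).N = relPsi (· ⋖ ·) S * edgeProd S := by
  rw [DGraph.N, hasseSub_Psi, edgeProd]

omit [Fintype P] [DecidableEq P] in
theorem Saturated.covBy_of_upperGate {S : Finset P} (hS : Saturated S) {v w : P} (hv : v ∈ S)
    (hU : UpperGate S {v} w) : v ⋖ w := by
  have hvw : v < w := (hU.2.2 v (by simp) w hU.1 hU.2.1).2 le_rfl
  obtain ⟨z, hz, h1, h2⟩ := hS.exists_covBy_right v hv w hU.1 hvw
  have := (hU.2.2 v (by simp) z hz (by simpa using h1.lt.ne')).1 h1.lt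
  exact le_antisymm h2 this ▸ h1

omit [Fintype P] [DecidableEq P] in
theorem Saturated.covBy_of_lowerGate {S : Finset P} (hS : Saturated S) {v u : P} (hv : v ∈ S)
    (hL : LowerGate S {v} u) : u ⋖ v := by
  have huv : u < v := (hL.2.2 v (by simp) u hL.1 hL.2.1).2 le_rfl
  obtain ⟨z, hz, h1, h2⟩ := hS.exists_covBy_left u hL.1 v hv huv
  have := (hL.2.2 v (by simp) z hz (by simpa using h2.lt.ne)).1 h2.lt
  exact le_antisymm this h1 ▸ h2

theorem Saturated.edges_of_upperGate {S : Finset P} (hS : Saturated S) {v w : P} (hv : v ∈ S)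
    (hL : NoLower S {v}) (hU : UpperGate S {v} w) :
    (hasseSub S).edges = insert (v, w) (hasseSub (S.erase v)).edges := by
  have hvw := hS.covBy_of_upperGate hv hU
  ext ⟨a, b⟩
  simp only [Finset.mem_insert, mem_hasseSub_edges, Finset.mem_erase, Prod.mk.injEq]
  constructor
  · rintro ⟨ha, hb, hab⟩
    have hbv : b ≠ v := by
      rintro rfl
      exact hL b (by simp) a ha (by simpa using hab.ne) hab.lt
    by_cases hav : a = v
    · subst hav
      have := (hU.2.2 a (by simp) b hb (by simpa using hbv)).1 hab.lt
      refine Or.inl ⟨rfl, ?_⟩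
      by_contra hne
      exact hab.2 hvw.lt (lt_of_le_of_ne this (Ne.symm hne))
    · exact Or.inr ⟨⟨hav, ha⟩, ⟨hbv, hb⟩, hab⟩
  · rintro (⟨rfl, rfl⟩ | ⟨⟨-, ha⟩, ⟨-, hb⟩, hab⟩)
    exacts [⟨hv, hU.1, hvw⟩, ⟨ha, hb, hab⟩]

theorem Saturated.edges_of_lowerGate {S : Finset P} (hS : Saturated S) {v u : P} (hv : v ∈ S)
    (hU : NoUpper S {v}) (hL : LowerGate S {v} u) :
    (hasseSub S).edges = insert (u, v) (hasseSub (S.erase v)).edges := by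
  have huv := hS.covBy_of_lowerGate hv hL
  ext ⟨a, b⟩
  simp only [Finset.mem_insert, mem_hasseSub_edges, Finset.mem_erase, Prod.mk.injEq]
  constructor
  · rintro ⟨ha, hb, hab⟩
    have hav : a ≠ v := by
      rintro rfl
      exact hU a (by simp) b hb (by simpa using hab.ne') hab.lt
    by_cases hbv : b = v
    · subst hbv
      have := (hL.2.2 b (by simp) a ha (by simpa using hav)).1 hab.lt
      refine Or.inl ⟨?_, rfl⟩
      by_contra hne
      exact hab.2 (lt_of_le_of_ne this hne) huv.lt
    · exact Or.inr ⟨⟨hav, ha⟩, ⟨hbv, hb⟩, hab⟩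
  · rintro (⟨rfl, rfl⟩ | ⟨⟨-, ha⟩, ⟨-, hb⟩, hab⟩)
    exacts [⟨hL.1, hv, huv⟩, ⟨ha, hb, hab⟩]

theorem notMem_edges_erase_left {S : Finset P} {v w : P} :
    (v, w) ∉ (hasseSub (S.erase v)).edges := by
  simp [mem_hasseSub_edges]

theorem notMem_edges_erase_right {S : Finset P} {u v : P} :
    (u, v) ∉ (hasseSub (S.erase v)).edges := by
  simp [mem_hasseSub_edges]

theorem valence_eq_one {S : Finset P} {v : P} {e : P × P} (he : e.1 = v ∨ e.2 = v)
    (h : (hasseSub S).edges = insert e (hasseSub (S.erase v)).edges) :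
    (hasseSub S).valence v = 1 := by
  rw [DGraph.valence, Finset.card_eq_one]
  refine ⟨e, Finset.ext fun f => ?_⟩
  rw [Finset.mem_filter, Finset.mem_singleton, h, Finset.mem_insert, mem_hasseSub_edges',
    Finset.mem_erase, Finset.mem_erase]
  constructor
  · rintro ⟨h1 | h1, h2⟩
    · exact h1
    · exact (h2.elim h1.1.1 h1.2.1.1).elim
  · rintro rfl
    exact ⟨Or.inl rfl, he⟩

/-- Pruning invariance: the factor gained by Ψ is cancelled by that of the pending edge, the only
edge at `v`. -/
theorem Saturated.N_of_upperGate {S : Finset P} (hS : Saturated S) {v w : P} (hv : v ∈ S)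
    (hL : NoLower S {v}) (hU : UpperGate S {v} w) :
    (hasseSub S).N = (hasseSub (S.erase v)).N := by
  have hvw := hS.covBy_of_upperGate hv hU
  rw [hasseSub_N, hasseSub_N, hS.relPsi_eq, (hS.erase_minimal hL).relPsi_eq,
    relPsi_erase_of_upperGate hv hL hU, edgeProd, hS.edges_of_upperGate hv hL hU,
    Finset.prod_insert notMem_edges_erase_left, edgeProd]
  have := var_sub_ne_zero hvw.ne
  field_simp

theorem Saturated.N_of_lowerGate {S : Finset P} (hS : Saturated S) {v u : P} (hv : v ∈ S)
    (hU : NoUpper S {v}) (hL : LowerGate S {v} u) :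
    (hasseSub S).N = (hasseSub (S.erase v)).N := by
  have huv := hS.covBy_of_lowerGate hv hL
  rw [hasseSub_N, hasseSub_N, hS.relPsi_eq, (hS.erase_maximal hU).relPsi_eq,
    relPsi_erase_of_lowerGate hv hU hL, edgeProd, hS.edges_of_lowerGate hv hU hL,
    Finset.prod_insert notMem_edges_erase_right, edgeProd]
  have := var_sub_ne_zero huv.ne
  field_simp

omit [Fintype P] in
/-- Induction on saturated chains, erasing the minimal element. -/
theorem saturated_chain_induction {motive : Finset P → Prop} (base : ∀ a, motive {a})
    (step : ∀ (S : Finset P) (v w : P), Saturated S → v ∈ S → NoLower S {v} → UpperGate S {v} w →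
      motive (S.erase v) → motive S)
    {T : Finset P} (hT : Saturated T) (hc : IsChain (· ≤ ·) (T : Set P)) (hne : T.Nonempty) :
    motive T := by
  obtain ⟨w, hw, hmax⟩ := exists_max_of_isChain hne hc
  -- A chain is its top element `w` with everything else hanging below it.
  refine lower_tail_induction step hT (Finset.erase_subset w T) (hc.mono (by simp)) (w := w)
    ?_ ?_ ?_
  · intro v hv x hx hxA hxv
    have : x = w := by
      by_contra h
      exact hxA (Finset.mem_erase.2 ⟨h, hx⟩)
    exact absurd hxv (this ▸ (hmax v (Finset.mem_of_mem_erase hv)).not_gt)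
  · refine ⟨hw, by simp, fun v hv x hx hxA => ?_⟩
    have : x = w := by
      by_contra h
      exact hxA (Finset.mem_erase.2 ⟨h, hx⟩)
    subst this
    rw [Finset.mem_erase] at hv
    simpa using lt_of_le_of_ne (hmax v hv.2) hv.1
  · have : T \ T.erase w = {w} := by
      ext x
      simp only [Finset.mem_sdiff, Finset.mem_erase, Finset.mem_singleton]
      constructor
      · rintro ⟨h1, h2⟩
        by_contra h
        exact h2 ⟨h, h1⟩
      · rintro rfl
        exact ⟨hw, fun h => h.1 rfl⟩
    rw [this]
    exact base w

theorem hasseSub_singleton_edges (a : P) : (hasseSub ({a} : Finset P)).edges = ∅ := by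
  refine Finset.eq_empty_of_forall_notMem fun e he => ?_
  rw [mem_hasseSub_edges', Finset.mem_singleton, Finset.mem_singleton] at he
  exact he.2.2.ne (he.1.trans he.2.1.symm)

theorem hasseSub_singleton_N (a : P) : (hasseSub ({a} : Finset P)).N = 1 := by
  rw [hasseSub_N, relPsi_singleton, edgeProd, hasseSub_singleton_edges, Finset.prod_empty, mul_one]

theorem Saturated.N_of_isChain {T : Finset P} (hT : Saturated T)
    (hc : IsChain (· ≤ ·) (T : Set P)) (hne : T.Nonempty) : (hasseSub T).N = 1 :=
  saturated_chain_induction (motive := fun T => (hasseSub T).N = 1) hasseSub_singleton_N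
    (fun _ _ _ hS hv hL hU h => (hS.N_of_upperGate hv hL hU).trans h) hT hc hne

theorem Saturated.card_edges_of_isChain {T : Finset P} (hT : Saturated T)
    (hc : IsChain (· ≤ ·) (T : Set P)) (hne : T.Nonempty) :
    (hasseSub T).edges.card + 1 = T.card := by
  refine saturated_chain_induction (motive := fun T => (hasseSub T).edges.card + 1 = T.card)
    (fun a => by simp [hasseSub_singleton_edges]) (fun S v w hS hv hL hU h => ?_) hT hc hne
  rw [hS.edges_of_upperGate hv hL hU, Finset.card_insert_of_notMem notMem_edges_erase_left, h,
    Finset.card_erase_of_mem hv, Nat.sub_add_cancel (Finset.card_pos.2 ⟨v, hv⟩)]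

omit [Fintype P] in
/-- A saturated chain is enumerated by a list of successive covering relations. -/
theorem Saturated.exists_list {T : Finset P} (hT : Saturated T)
    (hc : IsChain (· ≤ ·) (T : Set P)) (hne : T.Nonempty) :
    ∃ l : List P, l.toFinset = T ∧ l.Nodup ∧ l.IsChain (· ⋖ ·) := by
  have key : IsChain (· ≤ ·) (T : Set P) → ∃ (a : P) (l : List P), (a :: l).toFinset = T ∧
      (a :: l).Nodup ∧ (a :: l).IsChain (· ⋖ ·) ∧ ∀ x ∈ T, a ≤ x := by
    refine saturated_chain_induction (motive := fun T => IsChain (· ≤ ·) (T : Set P) →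
      ∃ (a : P) (l : List P), (a :: l).toFinset = T ∧ (a :: l).Nodup ∧
        (a :: l).IsChain (· ⋖ ·) ∧ ∀ x ∈ T, a ≤ x)
      (fun a _ => ⟨a, [], by simp⟩) (fun S v w hS hv hL hU ih hc => ?_) hT hc hne
    obtain ⟨a, l, h1, h2, h3, h4⟩ := ih (hc.mono (by simp))
    have hvw := hS.covBy_of_upperGate hv hU
    have hmin : ∀ x ∈ S, x ≠ v → v < x := by
      intro x hx hxv
      rcases hc.total hv hx with h | h
      · exact lt_of_le_of_ne h hxv.symm
      · exact absurd (lt_of_le_of_ne h hxv) (hL v (by simp) x hx (by simpa using hxv))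
    have haS : a ∈ S.erase v := by
      rw [← h1]
      simp
    rw [Finset.mem_erase] at haS
    have haw : a = w := le_antisymm (h4 w (Finset.mem_erase.2 ⟨hvw.ne', hU.1⟩))
      ((hU.2.2 v (by simp) a haS.2 (by simpa using haS.1)).1 (hmin a haS.2 haS.1))
    subst haw
    refine ⟨v, a :: l, ?_, List.nodup_cons.2 ⟨fun h => ?_, h2⟩,
      List.isChain_cons_cons.2 ⟨hvw, h3⟩, fun x hx => ?_⟩
    · rw [List.toFinset_cons, h1, Finset.insert_erase hv]
    · rw [← List.mem_toFinset, h1] at h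
      simp at h
    · by_cases hxv : x = v
      exacts [hxv.ge, (hmin x hx hxv).le]
  obtain ⟨a, l, h1, h2, h3, -⟩ := key hc
  exact ⟨_, h1, h2, h3⟩

end Subgraphs

/-! ### Diamonds made of two chains, and the factorization property. -/

section Diamonds

set_option linter.unusedSectionVars false

variable {P : Type*} [Fintype P] [DecidableEq P] [PartialOrder P]

/-- The edges of a glued set. -/
theorem hasseSub_edges_union {S T : Finset P}
    (h₁ : ∀ a ∈ S, ∀ b ∈ T, a ∉ T → b ∉ S → ¬ a ⋖ b)
    (h₂ : ∀ a ∈ S, ∀ b ∈ T, a ∉ T → b ∉ S → ¬ b ⋖ a) :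
    (hasseSub (S ∪ T)).edges = (hasseSub S).edges ∪ (hasseSub T).edges := by
  ext ⟨a, b⟩
  simp only [Finset.mem_union, mem_hasseSub_edges]
  constructor
  · rintro ⟨ha, hb, hab⟩
    by_cases haS : a ∈ S <;> by_cases hbS : b ∈ S
    · exact Or.inl ⟨haS, hbS, hab⟩
    · have hbT := hb.resolve_left hbS
      by_cases haT : a ∈ T
      exacts [Or.inr ⟨haT, hbT, hab⟩, absurd hab (h₁ a haS b hbT haT hbS)]
    · have haT := ha.resolve_left haS
      by_cases hbT : b ∈ T
      exacts [Or.inr ⟨haT, hbT, hab⟩, absurd hab (h₂ b hbS a haT hbT haS)]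
    · exact Or.inr ⟨ha.resolve_left haS, hb.resolve_left hbS, hab⟩
  · rintro (⟨ha, hb, hab⟩ | ⟨ha, hb, hab⟩)
    exacts [⟨Or.inl ha, Or.inl hb, hab⟩, ⟨Or.inr ha, Or.inr hb, hab⟩]

theorem hasseSub_edges_inter (S T : Finset P) :
    (hasseSub S).edges ∩ (hasseSub T).edges = (hasseSub (S ∩ T)).edges := by
  ext ⟨a, b⟩
  simp only [Finset.mem_inter, mem_hasseSub_edges]
  tauto

theorem skeleton_reachable {S : Finset P} {a b : P}
    (h : Relation.ReflTransGen (fun x y => x ∈ S ∧ y ∈ S ∧ x ⋖ y) a b) :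
    (hasseSub S).skeleton.Reachable a b := by
  induction h with
  | refl => exact SimpleGraph.Reachable.refl _
  | tail _ hxy ih =>
    refine ih.trans (SimpleGraph.Adj.reachable ?_)
    rw [DGraph.skeleton, SimpleGraph.fromRel_adj]
    exact ⟨hxy.2.2.ne, Or.inl (mem_hasseSub_edges.2 hxy)⟩

/-- A saturated set made of two chains with the same extremities. -/
structure TwoChains (d A : Finset P) (u w t : P) : Prop where
  disjoint : ∀ x ∈ A, x ∉ d
  saturated : Saturated (d ∪ A)
  saturated_left : Saturated d
  chain_left : IsChain (· ≤ ·) (d : Set P)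
  chain_right : IsChain (· ≤ ·) (A : Set P)
  nonempty : A.Nonempty
  u_mem : u ∈ d
  w_mem : w ∈ d
  t_mem : t ∈ d
  u_lt_t : u < t
  t_lt_w : t < w
  u_le : ∀ x ∈ d, u ≤ x
  le_w : ∀ x ∈ d, x ≤ w
  lower : ∀ v ∈ A, ∀ x ∈ d, x < v ↔ x ≤ u
  upper : ∀ v ∈ A, ∀ x ∈ d, v < x ↔ w ≤ x

namespace TwoChains

variable {d A : Finset P} {u w t : P} (h : TwoChains d A u w t)

include h

theorem u_lt_w : u < w := h.u_lt_t.trans h.t_lt_w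

theorem u_lt {v : P} (hv : v ∈ A) : u < v := (h.lower v hv u h.u_mem).2 le_rfl

theorem lt_w {v : P} (hv : v ∈ A) : v < w := (h.upper v hv w h.w_mem).2 le_rfl

theorem u_le_all {x : P} (hx : x ∈ d ∪ A) : u ≤ x :=
  (Finset.mem_union.1 hx).elim (h.u_le x) fun hx => (h.u_lt hx).le

theorem le_w_all {x : P} (hx : x ∈ d ∪ A) : x ≤ w :=
  (Finset.mem_union.1 hx).elim (h.le_w x) fun hx => (h.lt_w hx).le

/-- The elements of `d` below an element of `A` are already below `u`, and those above it are above
`w`; so a covering step towards or from `A` cannot stray into the interior of `d`. -/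
theorem saturated_right : Saturated (insert u (insert w A)) := by
  have hsub : ∀ x ∈ insert u (insert w A), x ∈ d ∪ A := by
    intro x hx
    simp only [Finset.mem_insert] at hx
    rcases hx with rfl | rfl | hx
    exacts [Finset.mem_union_left _ h.u_mem, Finset.mem_union_left _ h.w_mem,
      Finset.mem_union_right _ hx]
  obtain ⟨a, ha⟩ := h.nonempty
  refine ⟨fun x hx y hy hxy => ?_, fun x hx y hy hxy => ?_⟩
  · have key : ∀ y ∈ A, x < y → ∃ z ∈ insert u (insert w A), x ⋖ z ∧ z ≤ y := by
      intro y hy hxy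
      obtain ⟨z, hz, h1, h2⟩ := h.saturated.exists_covBy_right x (hsub x hx) y
        (Finset.mem_union_right _ hy) hxy
      refine ⟨z, ?_, h1, h2⟩
      rcases Finset.mem_union.1 hz with hz | hz
      · have hzy : z < y := lt_of_le_of_ne h2 fun e => h.disjoint y hy (e ▸ hz)
        exact absurd ((h.lower y hy z hz).1 hzy) fun h3 =>
          (h1.lt.trans_le h3).not_ge (h.u_le_all (hsub x hx))
      · simp [hz]
    have hx' := hx
    simp only [Finset.mem_insert] at hx hy
    rcases hy with rfl | rfl | hy
    · exact absurd hxy (h.u_le_all (hsub x hx')).not_gt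
    · rcases hx with rfl | rfl | hx
      · obtain ⟨z, hz, h1, h2⟩ := key a ha (h.u_lt ha)
        exact ⟨z, hz, h1, h2.trans (h.lt_w ha).le⟩
      · exact absurd hxy (lt_irrefl _)
      · obtain ⟨z, hz, h1, h2⟩ := h.saturated.exists_covBy_right x (hsub x hx') y
          (Finset.mem_union_left _ h.w_mem) hxy
        refine ⟨z, ?_, h1, h2⟩
        rcases Finset.mem_union.1 hz with hz | hz
        · have := le_antisymm h2 ((h.upper x hx z hz).1 h1.lt)
          simp [this]
        · simp [hz]
    · exact key y hy hxy
  · have key : ∀ x ∈ A, x < y → ∃ z ∈ insert u (insert w A), x ≤ z ∧ z ⋖ y := by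
      intro x hx hxy
      obtain ⟨z, hz, h1, h2⟩ := h.saturated.exists_covBy_left x
        (Finset.mem_union_right _ hx) y (hsub y hy) hxy
      refine ⟨z, ?_, h1, h2⟩
      rcases Finset.mem_union.1 hz with hz | hz
      · have hzy : x < z := lt_of_le_of_ne h1 fun e => h.disjoint x hx (e ▸ hz)
        exact absurd ((h.upper x hx z hz).1 hzy) fun h3 =>
          (h3.trans_lt h2.lt).not_ge (h.le_w_all (hsub y hy))
      · simp [hz]
    have hy' := hy
    simp only [Finset.mem_insert] at hx hy
    rcases hx with rfl | rfl | hx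
    · rcases hy with rfl | rfl | hy
      · exact absurd hxy (lt_irrefl _)
      · obtain ⟨z, hz, h1, h2⟩ := key a ha (h.lt_w ha)
        exact ⟨z, hz, (h.u_lt ha).le.trans h1, h2⟩
      · obtain ⟨z, hz, h1, h2⟩ := h.saturated.exists_covBy_left x
          (Finset.mem_union_left _ h.u_mem) y (hsub y hy') hxy
        refine ⟨z, ?_, h1, h2⟩
        rcases Finset.mem_union.1 hz with hz | hz
        · have := le_antisymm h1 ((h.lower y hy z hz).1 h2.lt)
          simp [← this]
        · simp [hz]
    · exact absurd hxy (h.le_w_all (hsub y hy')).not_gt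
    · exact key x hx hxy

theorem isChain_right : IsChain (· ≤ ·) ((insert u (insert w A) : Finset P) : Set P) := by
  intro x hx y hy hxy
  simp only [Finset.coe_insert, Set.mem_insert_iff, Finset.mem_coe] at hx hy
  rcases hx with rfl | rfl | hx <;> rcases hy with rfl | rfl | hy
  · exact absurd rfl hxy
  · exact Or.inl h.u_lt_w.le
  · exact Or.inl (h.u_lt hy).le
  · exact Or.inr h.u_lt_w.le
  · exact absurd rfl hxy
  · exact Or.inr (h.lt_w hy).le
  · exact Or.inr (h.u_lt hx).le
  · exact Or.inl (h.lt_w hx).le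
  · exact h.chain_right hx hy hxy

theorem union_eq : insert u (insert w A) ∪ d = d ∪ A := by
  have h1 := h.u_mem
  have h2 := h.w_mem
  ext x
  simp only [Finset.mem_union, Finset.mem_insert]
  constructor
  · rintro ((rfl | rfl | hx) | hx)
    exacts [Or.inl h1, Or.inl h2, Or.inr hx, Or.inl hx]
  · tauto

theorem mem_inter_iff (x : P) : x ∈ insert u (insert w A) ∧ x ∈ d ↔ x = u ∨ x = w := by
  simp only [Finset.mem_insert]
  constructor
  · rintro ⟨hx | hx | hx, hxd⟩
    exacts [Or.inl hx, Or.inr hx, absurd hxd (h.disjoint x hx)]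
  · rintro (rfl | rfl)
    exacts [⟨Or.inl rfl, h.u_mem⟩, ⟨Or.inr (Or.inl rfl), h.w_mem⟩]

theorem inter_eq : insert u (insert w A) ∩ d = {u, w} := by
  ext x
  rw [Finset.mem_inter, h.mem_inter_iff, Finset.mem_insert, Finset.mem_singleton]

theorem not_covBy_right {a b : P} (ha : a ∈ insert u (insert w A)) (hb : b ∈ d) (had : a ∉ d)
    (hbA : b ∉ insert u (insert w A)) : ¬ a < b ∧ ¬ b < a := by
  simp only [Finset.mem_insert, not_or] at ha hbA
  have haA : a ∈ A := by
    rcases ha with rfl | rfl | ha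
    exacts [absurd h.u_mem had, absurd h.w_mem had, ha]
  exact ⟨fun hab => hbA.2.1 (le_antisymm (h.le_w b hb) ((h.upper a haA b hb).1 hab)),
    fun hab => hbA.1 (le_antisymm ((h.lower a haA b hb).1 hab) (h.u_le b hb))⟩

theorem edges_eq : (hasseSub (d ∪ A)).edges =
    (hasseSub (insert u (insert w A))).edges ∪ (hasseSub d).edges := by
  rw [← h.union_eq]
  exact hasseSub_edges_union
    (fun a ha b hb ha' hb' hab => (h.not_covBy_right ha hb ha' hb').1 hab.lt)
    (fun a ha b hb ha' hb' hab => (h.not_covBy_right ha hb ha' hb').2 hab.lt)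

/-- A common edge would go from `u` to `w`, which `t` prevents from being a cover. -/
theorem edges_disjoint :
    Disjoint (hasseSub (insert u (insert w A))).edges (hasseSub d).edges := by
  rw [Finset.disjoint_iff_inter_eq_empty, hasseSub_edges_inter, h.inter_eq]
  refine Finset.eq_empty_of_forall_notMem ?_
  rintro ⟨a, b⟩ he
  simp only [mem_hasseSub_edges, Finset.mem_insert, Finset.mem_singleton] at he
  rcases he with ⟨rfl | rfl, rfl | rfl, hab⟩
  · exact hab.ne rfl
  · exact hab.2 h.u_lt_t h.t_lt_w
  · exact h.u_lt_w.asymm hab.lt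
  · exact hab.ne rfl

/-- Each path has one edge fewer than vertices, and the two share two vertices and no edge. -/
theorem card_edges : (hasseSub (d ∪ A)).edges.card = (d ∪ A).card := by
  have h1 := h.saturated_right.card_edges_of_isChain h.isChain_right ⟨u, by simp⟩
  have h2 := h.saturated_left.card_edges_of_isChain h.chain_left ⟨u, h.u_mem⟩
  have h3 := Finset.card_union_add_card_inter (insert u (insert w A)) d
  rw [h.union_eq, h.inter_eq, Finset.card_pair h.u_lt_w.ne] at h3
  rw [h.edges_eq, Finset.card_union_of_disjoint h.edges_disjoint]
  omega

/-- A set made of two chains from `u` to `w` has numerator `x_u - x_w`. -/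
theorem N_eq : (hasseSub (d ∪ A)).N = var u - var w := by
  -- The relation u < w is not a cover, but it is implied on both paths. Adding it makes u, w a
  -- chain for `R`, along which the paths are glued; ψ_{uw} supplies the factor x_u - x_w.
  let R : P → P → Prop := fun a b => a ⋖ b ∨ (a = u ∧ b = w)
  have hR : ∀ S : Finset P, Saturated S → u ∈ S → w ∈ S →
      relPsi (· ⋖ ·) S = relPsi R S := by
    intro S hS hu hw
    refine relPsi_congr (fun _ _ _ _ h => Or.inl h) ?_
    rintro a ha b hb (hab | ⟨rfl, rfl⟩)
    exacts [hS.reflTransGen ha hb hab.le, hS.reflTransGen ha hb h.u_lt_w.le]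
  have hnot : ∀ a ∈ insert u (insert w A), ∀ b ∈ d, a ∉ d → b ∉ insert u (insert w A) →
      ¬ R a b ∧ ¬ R b a := by
    intro a ha b hb ha' hb'
    obtain ⟨h1, h2⟩ := h.not_covBy_right ha hb ha' hb'
    refine ⟨?_, ?_⟩
    · rintro (h3 | ⟨rfl, -⟩)
      exacts [h1 h3.lt, ha' h.u_mem]
    · rintro (h3 | ⟨-, rfl⟩)
      exacts [h2 h3.lt, ha' h.w_mem]
  have hg : Glued R (insert u (insert w A)) d [u, w] :=
    ⟨fun a => by rw [h.mem_inter_iff]; simp, by simpa using h.u_lt_w.ne,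
      by simpa using Or.inr ⟨rfl, rfl⟩, fun a ha b hb ha' hb' => (hnot a ha b hb ha' hb').1,
      fun a ha b hb ha' hb' => (hnot a ha b hb ha' hb').2⟩
  have h1 := hg.relPsi_union ⟨u, by simp⟩ ⟨u, h.u_mem⟩
  have h2 := h.saturated_right.N_of_isChain h.isChain_right ⟨u, by simp⟩
  have h3 := h.saturated_left.N_of_isChain h.chain_left ⟨u, h.u_mem⟩
  rw [hasseSub_N, hR _ h.saturated_right (by simp) (by simp)] at h2
  rw [hasseSub_N, hR _ h.saturated_left h.u_mem h.w_mem] at h3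
  have h4 : edgeProd (d ∪ A) = edgeProd (insert u (insert w A)) * edgeProd d := by
    rw [edgeProd, h.edges_eq, Finset.prod_union h.edges_disjoint, edgeProd, edgeProd]
  rw [h.union_eq] at h1
  rw [hasseSub_N, hR _ h.saturated (Finset.mem_union_left _ h.u_mem)
    (Finset.mem_union_left _ h.w_mem), h1, h4]
  simp only [List.cons_ne_nil, if_false, wordPsi_cons_cons, wordPsi_singleton, mul_one, inv_inv]
  linear_combination (var u - var w) * (relPsi R d * edgeProd d) * h2 + (var u - var w) * h3

theorem minimals_eq : (hasseSub (d ∪ A)).minimals = {u} := by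
  ext x
  simp only [DGraph.minimals, Finset.mem_filter, hasseSub_verts, Finset.mem_singleton]
  constructor
  · rintro ⟨hx, hmin⟩
    by_contra hne
    obtain ⟨z, hz, -, h1⟩ := h.saturated.exists_covBy_left u (Finset.mem_union_left _ h.u_mem) x hx
      (lt_of_le_of_ne (h.u_le_all hx) (Ne.symm hne))
    exact hmin (z, x) (mem_hasseSub_edges.2 ⟨hz, hx, h1⟩) rfl
  · rintro rfl
    refine ⟨Finset.mem_union_left _ h.u_mem, ?_⟩
    rintro ⟨a, b⟩ he rfl
    rw [mem_hasseSub_edges] at he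
    exact he.2.2.lt.not_ge (h.u_le_all he.1)

theorem maximals_eq : (hasseSub (d ∪ A)).maximals = {w} := by
  ext x
  simp only [DGraph.maximals, Finset.mem_filter, hasseSub_verts, Finset.mem_singleton]
  constructor
  · rintro ⟨hx, hmax⟩
    by_contra hne
    obtain ⟨z, hz, h1, -⟩ := h.saturated.exists_covBy_right x hx w
      (Finset.mem_union_left _ h.w_mem) (lt_of_le_of_ne (h.le_w_all hx) hne)
    exact hmax (x, z) (mem_hasseSub_edges.2 ⟨hx, hz, h1⟩) rfl
  · rintro rfl
    refine ⟨Finset.mem_union_left _ h.w_mem, ?_⟩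
    rintro ⟨a, b⟩ he rfl
    rw [mem_hasseSub_edges] at he
    exact he.2.2.lt.not_ge (h.le_w_all he.2.1)

/-- The ends `u` and `w` have an edge on each path, and any other vertex has one edge below it and
one above. -/
theorem exists_two_edges {x : P} (hx : x ∈ d ∪ A) : ∃ e ∈ (hasseSub (d ∪ A)).edges,
    ∃ f ∈ (hasseSub (d ∪ A)).edges, e ≠ f ∧ (e.1 = x ∨ e.2 = x) ∧ (f.1 = x ∨ f.2 = x) := by
  have hu := Finset.mem_union_left A h.u_mem
  have hw := Finset.mem_union_left A h.w_mem
  obtain ⟨a, ha⟩ := h.nonempty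
  have haS := Finset.mem_union_right d ha
  by_cases hxu : x = u
  · subst hxu
    obtain ⟨z, hz, h1, h2⟩ := h.saturated.exists_covBy_right x hx a haS (h.u_lt ha)
    obtain ⟨y, hy, h3, h4⟩ := h.saturated_left.exists_covBy_right x h.u_mem t h.t_mem h.u_lt_t
    refine ⟨(x, z), mem_hasseSub_edges.2 ⟨hx, hz, h1⟩, (x, y),
      mem_hasseSub_edges.2 ⟨hx, Finset.mem_union_left _ hy, h3⟩, fun e => ?_, Or.inl rfl,
      Or.inl rfl⟩
    obtain rfl : z = y := (Prod.mk.inj e).2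
    have hza : z < a := lt_of_le_of_ne h2 fun e => h.disjoint a ha (e ▸ hy)
    exact h3.lt.not_ge ((h.lower a ha z hy).1 hza)
  by_cases hxw : x = w
  · subst hxw
    obtain ⟨z, hz, h2, h1⟩ := h.saturated.exists_covBy_left a haS x hx (h.lt_w ha)
    obtain ⟨y, hy, h4, h3⟩ := h.saturated_left.exists_covBy_left t h.t_mem x h.w_mem h.t_lt_w
    refine ⟨(z, x), mem_hasseSub_edges.2 ⟨hz, hx, h1⟩, (y, x),
      mem_hasseSub_edges.2 ⟨Finset.mem_union_left _ hy, hx, h3⟩, fun e => ?_, Or.inr rfl,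
      Or.inr rfl⟩
    obtain rfl : z = y := (Prod.mk.inj e).1
    have hza : a < z := lt_of_le_of_ne h2 fun e => h.disjoint a ha (e ▸ hy)
    exact h3.lt.not_ge ((h.upper a ha z hy).1 hza)
  · obtain ⟨z, hz, -, h1⟩ := h.saturated.exists_covBy_left u hu x hx
      (lt_of_le_of_ne (h.u_le_all hx) (Ne.symm hxu))
    obtain ⟨y, hy, h2, -⟩ := h.saturated.exists_covBy_right x hx w hw
      (lt_of_le_of_ne (h.le_w_all hx) hxw)
    refine ⟨(z, x), mem_hasseSub_edges.2 ⟨hz, hx, h1⟩, (x, y),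
      mem_hasseSub_edges.2 ⟨hx, hy, h2⟩, fun e => ?_, Or.inr rfl, Or.inl rfl⟩
    exact h1.ne (Prod.mk.inj e).1

theorem isDiamond : (hasseSub (d ∪ A)).IsDiamond where
  connected := by
    have hu := Finset.mem_union_left A h.u_mem
    have key : ∀ x ∈ d ∪ A, (hasseSub (d ∪ A)).skeleton.Reachable u x := fun x hx =>
      skeleton_reachable (h.saturated.reflTransGen hu hx (h.u_le_all hx))
    refine ⟨⟨u, by simpa using Or.inl h.u_mem⟩, fun x hx y hy => ?_⟩
    rw [hasseSub_verts] at hx hy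
    exact (key x hx).symm.trans (key y hy)
  one_cycle := by rw [h.card_edges, hasseSub_verts]
  valence_ne_one x hx := by
    rw [hasseSub_verts] at hx
    obtain ⟨e, he, f, hf, hef, he', hf'⟩ := h.exists_two_edges hx
    exact (Finset.one_lt_card.2 ⟨e, Finset.mem_filter.2 ⟨he, he'⟩, f,
      Finset.mem_filter.2 ⟨hf, hf'⟩, hef⟩).ne'
  unique_min := by rw [h.minimals_eq, Finset.card_singleton]
  unique_max := by rw [h.maximals_eq, Finset.card_singleton]

end TwoChains

/-- The graph is decomposed by chain factorizations and prunings into diamonds, and its numerator is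
the product of theirs. -/
def DiamondFactored (G : DGraph P) : Prop :=
  ∃ s : Multiset (DGraph P), G.ChainFactors s ∧ (∀ D ∈ s, D.IsDiamond) ∧
    G.N = (s.map DGraph.N).prod ∧
    ∀ D ∈ s, ∃ a b : P, D.minimals = {a} ∧ D.maximals = {b} ∧ D.N = var a - var b

theorem TwoChains.diamondFactored {d A : Finset P} {u w t : P} (h : TwoChains d A u w t) :
    DiamondFactored (hasseSub (d ∪ A)) := by
  refine ⟨{hasseSub (d ∪ A)}, .diamond _ h.isDiamond, ?_, by simp, ?_⟩ <;>
    simp only [Multiset.mem_singleton, forall_eq]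
  exacts [h.isDiamond, ⟨u, w, h.minimals_eq, h.maximals_eq, h.N_eq⟩]

theorem diamondFactored_singleton (a : P) : DiamondFactored (hasseSub ({a} : Finset P)) :=
  ⟨0, .point _ (by simp) (hasseSub_singleton_edges a), by simp,
    by simp [hasseSub_singleton_N], by simp⟩

theorem diamondFactored_of_prune {S : Finset P} {v : P} (hv : v ∈ S)
    (h₁ : (hasseSub S).valence v = 1) (hN : (hasseSub S).N = (hasseSub (S.erase v)).N)
    (h : DiamondFactored (hasseSub (S.erase v))) : DiamondFactored (hasseSub S) := by
  obtain ⟨s, h2, h3, h4, h5⟩ := h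
  refine ⟨s, .prune _ v s (by simpa using hv) h₁ ?_, h3, hN.trans h4, h5⟩
  rwa [hasseSub_erase_singleton]

theorem diamondFactored_of_minimal (S : Finset P) (v w : P) (hS : Saturated S) (hv : v ∈ S)
    (hL : NoLower S {v}) (hU : UpperGate S {v} w) (h : DiamondFactored (hasseSub (S.erase v))) :
    DiamondFactored (hasseSub S) :=
  diamondFactored_of_prune hv (valence_eq_one (Or.inl rfl) (hS.edges_of_upperGate hv hL hU))
    (hS.N_of_upperGate hv hL hU) h

theorem diamondFactored_of_maximal (S : Finset P) (v u : P) (hS : Saturated S) (hv : v ∈ S)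
    (hU : NoUpper S {v}) (hL : LowerGate S {v} u) (h : DiamondFactored (hasseSub (S.erase v))) :
    DiamondFactored (hasseSub S) :=
  diamondFactored_of_prune hv (valence_eq_one (Or.inr rfl) (hS.edges_of_lowerGate hv hU hL))
    (hS.N_of_lowerGate hv hU hL) h

end Diamonds

/-! ### Maximal chains, components of their complement, and multiplicativity over regions. -/

section Regions

variable {P : Type*} [PartialOrder P]

/-- The finite set `c` is a maximal chain of the order induced on `S`. -/
structure IsMaximalChain (S c : Finset P) : Prop where
  subset : c ⊆ S
  isChain : IsChain (· ≤ ·) (c : Set P)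
  mem : ∀ x ∈ S, (∀ y ∈ c, x ≤ y ∨ y ≤ x) → x ∈ c

theorem exists_isMaximalChain {S c₀ : Finset P} (hS : c₀ ⊆ S)
    (hc : IsChain (· ≤ ·) (c₀ : Set P)) : ∃ c, c₀ ⊆ c ∧ IsMaximalChain S c := by
  classical
  obtain ⟨c, hc₀, hmax⟩ := (S.powerset.filter
    (fun c : Finset P => IsChain (· ≤ ·) (c : Set P))).exists_le_maximal
    (Finset.mem_filter.2 ⟨Finset.mem_powerset.2 hS, hc⟩)
  obtain ⟨h1, h2⟩ := Finset.mem_filter.1 hmax.prop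
  rw [Finset.mem_powerset] at h1
  refine ⟨c, hc₀, h1, h2, fun x hx hxc => ?_⟩
  have h3 : insert x c ∈ S.powerset.filter (fun c : Finset P => IsChain (· ≤ ·) (c : Set P)) := by
    refine Finset.mem_filter.2 ⟨Finset.mem_powerset.2 (Finset.insert_subset hx h1), ?_⟩
    rw [Finset.coe_insert]
    exact h2.insert fun y hy _ => hxc y hy
  exact hmax.le_of_ge h3 (Finset.subset_insert x c) (Finset.mem_insert_self x c)

theorem Saturated.of_convex {S F : Finset P} (hS : Saturated S) (hF : F ⊆ S)
    (h : ∀ x ∈ F, ∀ y ∈ F, ∀ z ∈ S, x ≤ z → z ≤ y → z ∈ F) : Saturated F := by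
  refine ⟨fun x hx y hy hxy => ?_, fun x hx y hy hxy => ?_⟩
  · obtain ⟨z, hz, h1, h2⟩ := hS.exists_covBy_right x (hF hx) y (hF hy) hxy
    exact ⟨z, h x hx y hy z hz h1.le h2, h1, h2⟩
  · obtain ⟨z, hz, h1, h2⟩ := hS.exists_covBy_left x (hF hx) y (hF hy) hxy
    exact ⟨z, h x hx y hy z hz h1 h2.le, h1, h2⟩

namespace IsMaximalChain

variable {S c : Finset P} (hc : IsMaximalChain S c)

include hc

/-- A cover in `S` towards the next element of the chain is comparable to the whole chain, hence
belongs to it by maximality. -/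
theorem saturated (hS : Saturated S) : Saturated c := by
  classical
  refine ⟨fun x hx y hy hxy => ?_, fun x hx y hy hxy => ?_⟩
  · obtain ⟨m, hm, hmin⟩ := exists_min_of_isChain (A := c.filter (x < ·))
      ⟨y, Finset.mem_filter.2 ⟨hy, hxy⟩⟩ (hc.isChain.mono (Finset.coe_subset.2 (Finset.filter_subset _ _)))
    rw [Finset.mem_filter] at hm
    obtain ⟨z, hz, h1, h2⟩ := hS.exists_covBy_right x (hc.subset hx) m (hc.subset hm.1) hm.2
    refine ⟨z, hc.mem z hz fun y' hy' => ?_, h1, h2.trans (hmin y (Finset.mem_filter.2 ⟨hy, hxy⟩))⟩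
    rcases hc.isChain.total hx hy' with h | h
    · rcases h.eq_or_lt with rfl | h
      exacts [Or.inr h1.le, Or.inl (h2.trans (hmin y' (Finset.mem_filter.2 ⟨hy', h⟩)))]
    · exact Or.inr (h.trans h1.le)
  · obtain ⟨m, hm, hmax⟩ := exists_max_of_isChain (A := c.filter (· < y))
      ⟨x, Finset.mem_filter.2 ⟨hx, hxy⟩⟩ (hc.isChain.mono (Finset.coe_subset.2 (Finset.filter_subset _ _)))
    rw [Finset.mem_filter] at hm
    obtain ⟨z, hz, h1, h2⟩ := hS.exists_covBy_left m (hc.subset hm.1) y (hc.subset hy) hm.2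
    refine ⟨z, hc.mem z hz fun y' hy' => ?_, (hmax x (Finset.mem_filter.2 ⟨hx, hxy⟩)).trans h1, h2⟩
    rcases hc.isChain.total hy' hy with h | h
    · rcases h.eq_or_lt with rfl | h
      exacts [Or.inl h2.le, Or.inr ((hmax y' (Finset.mem_filter.2 ⟨hy', h⟩)).trans h1)]
    · exact Or.inl (h2.le.trans h)

theorem not_lt_of_minimal {x : P} (hx : x ∈ c) (h : ∀ y ∈ c, ¬ y < x) : ∀ y ∈ S, ¬ y < x := by
  intro y hy hyx
  refine h y (hc.mem y hy fun z hz => Or.inl ?_) hyx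
  rcases hc.isChain.total hx hz with h' | h'
  · exact hyx.le.trans h'
  · rcases h'.eq_or_lt with rfl | h'
    exacts [hyx.le, absurd h' (h z hz)]

theorem not_lt_of_maximal {x : P} (hx : x ∈ c) (h : ∀ y ∈ c, ¬ x < y) : ∀ y ∈ S, ¬ x < y := by
  intro y hy hyx
  refine h y (hc.mem y hy fun z hz => Or.inr ?_) hyx
  rcases hc.isChain.total hx hz with h' | h'
  · rcases h'.eq_or_lt with rfl | h'
    exacts [hyx.le, absurd h' (h z hz)]
  · exact h'.trans hyx.le

end IsMaximalChain

/-- A union of connected components of `S \ c`. -/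
structure IsBlock (S c C : Finset P) : Prop where
  subset : C ⊆ S
  notMem : ∀ x ∈ C, x ∉ c
  closed : ∀ x ∈ C, ∀ y ∈ S, y ∉ c → x ⋖ y ∨ y ⋖ x → y ∈ C

variable [DecidableEq P]

namespace IsBlock

variable [Finite P] {S c C : Finset P} (hC : IsBlock S c C)

include hC

/-- A path of covers that leaves a block can only enter `c`, by closedness. -/
theorem exists_between (hS : Saturated S) {x y : P} (hx : x ∈ C) (hy : y ∈ S) (hyC : y ∉ C)
    (hyc : y ∉ c) : (x < y → ∃ z ∈ c, x < z ∧ z < y) ∧ (y < x → ∃ z ∈ c, y < z ∧ z < x) := by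
  constructor
  · intro hxy
    obtain ⟨x₁, hx₁, y₁, hy₁, hy₁C, h1, h2, h3⟩ := hS.exists_exit_right hC.subset hx hy hyC hxy
    have h4 : y₁ ∈ c := by
      by_contra h
      exact hy₁C (hC.closed x₁ hx₁ y₁ hy₁ h (Or.inl h2))
    exact ⟨y₁, h4, h1.trans_lt h2.lt, lt_of_le_of_ne h3 fun e => hyc (e ▸ h4)⟩
  · intro hyx
    obtain ⟨x₁, hx₁, y₁, hy₁, hy₁C, h1, h2, h3⟩ :=
      hS.exists_exit_left hx (hC.subset hx) hy hyC hyx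
    have h4 : y₁ ∈ c := by
      by_contra h
      exact hy₁C (hC.closed x₁ hx₁ y₁ hy₁ h (Or.inr h2))
    exact ⟨y₁, h4, lt_of_le_of_ne h3 fun e => hyc (e ▸ h4), h2.lt.trans_le h1⟩

omit [Finite P] in
theorem mem_union_of_covBy {x y : P} (hx : x ∈ C) (hy : y ∈ S) (h : x ⋖ y ∨ y ⋖ x) :
    y ∈ c ∪ C := by
  by_cases hyc : y ∈ c
  · exact Finset.mem_union_left _ hyc
  · exact Finset.mem_union_right _ (hC.closed x hx y hy hyc h)

theorem saturated_union (hS : Saturated S) (hc : Saturated c) (hcS : c ⊆ S) :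
    Saturated (c ∪ C) := by
  refine ⟨fun x hx y hy hxy => ?_, fun x hx y hy hxy => ?_⟩
  · rcases Finset.mem_union.1 hx with hxc | hxC
    · rcases Finset.mem_union.1 hy with hyc | hyC
      · obtain ⟨z, hz, h1, h2⟩ := hc.exists_covBy_right x hxc y hyc hxy
        exact ⟨z, Finset.mem_union_left _ hz, h1, h2⟩
      · obtain ⟨x₁, hx₁, y₁, hy₁, hy₁C, h1, h2, h3⟩ := hS.exists_exit_left hyC (hC.subset hyC)
          (hcS hxc) (fun h => hC.notMem x h hxc) hxy
        have h4 : y₁ ∈ c := by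
          by_contra h
          exact hy₁C (hC.closed x₁ hx₁ y₁ hy₁ h (Or.inr h2))
        rcases h3.eq_or_lt with rfl | h3
        · exact ⟨x₁, Finset.mem_union_right _ hx₁, h2, h1⟩
        · obtain ⟨z, hz, h5, h6⟩ := hc.exists_covBy_right x hxc y₁ h4 h3
          exact ⟨z, Finset.mem_union_left _ hz, h5, h6.trans (h2.le.trans h1)⟩
    · have hyS : y ∈ S := (Finset.mem_union.1 hy).elim (fun h => hcS h) fun h => hC.subset h
      obtain ⟨z, hz, h1, h2⟩ := hS.exists_covBy_right x (hC.subset hxC) y hyS hxy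
      exact ⟨z, hC.mem_union_of_covBy hxC hz (Or.inl h1), h1, h2⟩
  · rcases Finset.mem_union.1 hy with hyc | hyC
    · rcases Finset.mem_union.1 hx with hxc | hxC
      · obtain ⟨z, hz, h1, h2⟩ := hc.exists_covBy_left x hxc y hyc hxy
        exact ⟨z, Finset.mem_union_left _ hz, h1, h2⟩
      · obtain ⟨x₁, hx₁, y₁, hy₁, hy₁C, h1, h2, h3⟩ := hS.exists_exit_right hC.subset hxC
          (hcS hyc) (fun h => hC.notMem y h hyc) hxy
        have h4 : y₁ ∈ c := by
          by_contra h
          exact hy₁C (hC.closed x₁ hx₁ y₁ hy₁ h (Or.inl h2))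
        rcases h3.eq_or_lt with rfl | h3
        · exact ⟨x₁, Finset.mem_union_right _ hx₁, h1, h2⟩
        · obtain ⟨z, hz, h5, h6⟩ := hc.exists_covBy_left y₁ h4 y hyc h3
          exact ⟨z, Finset.mem_union_left _ hz, (h1.trans h2.le).trans h5, h6⟩
    · have hxS : x ∈ S := (Finset.mem_union.1 hx).elim (fun h => hcS h) fun h => hC.subset h
      obtain ⟨z, hz, h1, h2⟩ := hS.exists_covBy_left x hxS y (hC.subset hyC) hxy
      exact ⟨z, hC.mem_union_of_covBy hyC hz (Or.inr h2), h1, h2⟩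

/-- Together with `orderConnected_union`, this makes regions of a maximal chain eligible for the
induction hypothesis. -/
theorem spanning_union (hS : Spanning S) (hc : IsMaximalChain S c) : Spanning (c ∪ C) := by
  refine ⟨hC.saturated_union hS.toSaturated (hc.saturated hS.toSaturated) hc.subset,
    fun x hx h => ?_, fun x hx h => ?_⟩
  · rcases Finset.mem_union.1 hx with hxc | hxC
    · exact hS.isMin x (hc.subset hxc)
        (hc.not_lt_of_minimal hxc fun y hy => h y (Finset.mem_union_left _ hy))
    · refine hS.isMin x (hC.subset hxC) fun y hy hyx => ?_
      obtain ⟨z, hz, -, h2⟩ := hS.exists_covBy_left y hy x (hC.subset hxC) hyx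
      exact h z (hC.mem_union_of_covBy hxC hz (Or.inr h2)) h2.lt
  · rcases Finset.mem_union.1 hx with hxc | hxC
    · exact hS.isMax x (hc.subset hxc)
        (hc.not_lt_of_maximal hxc fun y hy => h y (Finset.mem_union_left _ hy))
    · refine hS.isMax x (hC.subset hxC) fun y hy hyx => ?_
      obtain ⟨z, hz, h2, -⟩ := hS.exists_covBy_right x (hC.subset hxC) y hy hyx
      exact h z (hC.mem_union_of_covBy hxC hz (Or.inl h2)) h2.lt

/-- A comparability between a subset of a block and the outside goes through `c` or through the
rest of the block. -/
theorem exists_comparable (hS : Saturated S) (hconn : OrderConnected S) {T : Finset P}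
    (hT : T ⊆ C) (hne : T.Nonempty) (hcS : c ⊆ S) (hcne : c.Nonempty) :
    ∃ x ∈ T, ∃ y ∈ c ∪ C, y ∉ T ∧ (x < y ∨ y < x) := by
  obtain ⟨x₀, hx₀⟩ := hcne
  obtain ⟨x, hx, y, hy, hyT, hxy⟩ := hconn.2 T (hT.trans hC.subset) hne fun e =>
    hC.notMem x₀ (hT (e ▸ hcS hx₀)) hx₀
  by_cases hyU : y ∈ c ∪ C
  · exact ⟨x, hx, y, hyU, hyT, hxy⟩
  · rw [Finset.mem_union, not_or] at hyU
    have h1 := hC.exists_between hS (hT hx) hy hyU.2 hyU.1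
    rcases hxy with hxy | hxy
    · obtain ⟨z, hz, h2, -⟩ := h1.1 hxy
      exact ⟨x, hx, z, Finset.mem_union_left _ hz, fun h => hC.notMem z (hT h) hz, Or.inl h2⟩
    · obtain ⟨z, hz, -, h2⟩ := h1.2 hxy
      exact ⟨x, hx, z, Finset.mem_union_left _ hz, fun h => hC.notMem z (hT h) hz, Or.inr h2⟩

/-- If a part separates two elements of `c`, the chain itself provides the relation. Otherwise the
part or its complement lies inside the block; connectedness of `S` gives a relation leaving it,
which can be chosen to stop in the region. -/
theorem orderConnected_union (hS : Saturated S) (hconn : OrderConnected S)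
    (hc : IsMaximalChain S c) (hcne : c.Nonempty) : OrderConnected (c ∪ C) := by
  refine ⟨hcne.mono Finset.subset_union_left, fun T hT hTne hTS => ?_⟩
  by_cases h1 : ∃ x ∈ c, x ∈ T
  · by_cases h2 : ∃ y ∈ c, y ∉ T
    · obtain ⟨x, hx, hxT⟩ := h1
      obtain ⟨y, hy, hyT⟩ := h2
      have hne : x ≠ y := fun e => hyT (e ▸ hxT)
      refine ⟨x, hxT, y, Finset.mem_union_left _ hy, hyT, ?_⟩
      rcases hc.isChain hx hy hne with h | h
      exacts [Or.inl (lt_of_le_of_ne h hne), Or.inr (lt_of_le_of_ne h hne.symm)]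
    · push Not at h2
      have hsub : (c ∪ C) \ T ⊆ C := by
        intro x hx
        rw [Finset.mem_sdiff, Finset.mem_union] at hx
        exact hx.1.resolve_left fun h => hx.2 (h2 x h)
      have hne : ((c ∪ C) \ T).Nonempty := by
        rw [Finset.sdiff_nonempty]
        exact fun h => hTS (Finset.Subset.antisymm hT h)
      obtain ⟨x, hx, y, hy, hyT, hxy⟩ := hC.exists_comparable hS hconn hsub hne hc.subset hcne
      rw [Finset.mem_sdiff] at hx
      have hyT' : y ∈ T := by
        by_contra h
        exact hyT (Finset.mem_sdiff.2 ⟨hy, h⟩)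
      exact ⟨y, hyT', x, hx.1, hx.2, hxy.symm⟩
  · push Not at h1
    have hsub : T ⊆ C := fun x hx =>
      (Finset.mem_union.1 (hT hx)).resolve_left fun h => h1 x h hx
    exact hC.exists_comparable hS hconn hsub hTne hc.subset hcne

end IsBlock

variable [Fintype P]

/-- The numerator of a set glued along a saturated chain. -/
theorem Glued.hasseSub_N {S T : Finset P} {l : List P} (h : Glued (· ⋖ ·) S T l) (hl : l ≠ [])
    (hs : Saturated l.toFinset) (hc : IsChain (· ≤ ·) (l.toFinset : Set P)) :
    (hasseSub (S ∪ T)).N = (hasseSub S).N * (hasseSub T).N := by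
  obtain ⟨a, ha⟩ := List.exists_mem_of_ne_nil l hl
  have haST := (h.inter a).2 ha
  have h1 := h.relPsi_union ⟨a, haST.1⟩ ⟨a, haST.2⟩
  rw [if_neg hl] at h1
  have hinter : S ∩ T = l.toFinset := by
    ext x
    rw [Finset.mem_inter, h.inter, List.mem_toFinset]
  have h2 := hs.N_of_isChain hc ⟨a, List.mem_toFinset.2 ha⟩
  have hp : l.Pairwise (fun a b => ¬ b ⋖ a) := by
    have h3 : l.IsChain (· < ·) := h.chain.imp fun _ _ h => h.lt
    exact h3.pairwise.imp fun h h' => h.asymm h'.lt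
  rw [GreenePlanar.hasseSub_N, relPsi_of_isChain h.nodup h.chain hp] at h2
  -- The common edges are exactly those of the chain, by `hasseSub_edges_inter`.
  have h3 : edgeProd (S ∪ T) * edgeProd l.toFinset = edgeProd S * edgeProd T := by
    rw [edgeProd, edgeProd, hasseSub_edges_union h.not_rel₁₂ h.not_rel₂₁, ← hinter,
      ← hasseSub_edges_inter, Finset.prod_union_inter, edgeProd, edgeProd]
  -- The numerator of a chain is 1, so its edge product is 1/ψ_c, the factor that appears in the
  -- gluing formula.
  have h4 : (wordPsi l)⁻¹ = edgeProd l.toFinset :=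
    inv_eq_of_mul_eq_one_right h2
  rw [GreenePlanar.hasseSub_N, GreenePlanar.hasseSub_N, GreenePlanar.hasseSub_N, h1, h4]
  linear_combination relPsi (· ⋖ ·) S * relPsi (· ⋖ ·) T * h3

/-- The blocks are attached one at a time, each glued along `c` to the union of the previous ones.
-/
theorem hasseSub_N_biUnion {S c : Finset P} (hs : Saturated c)
    (hc : IsChain (· ≤ ·) (c : Set P)) (hne : c.Nonempty) (𝒯 : Finset (Finset P))
    (hB : ∀ C ∈ 𝒯, IsBlock S c C)
    (hd : ∀ C ∈ 𝒯, ∀ C' ∈ 𝒯, C ≠ C' → Disjoint C C') :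
    (hasseSub (c ∪ 𝒯.biUnion id)).N = ∏ C ∈ 𝒯, (hasseSub (c ∪ C)).N := by
  obtain ⟨l, hl, hn, hch⟩ := hs.exists_list hc hne
  induction 𝒯 using Finset.induction_on with
  | empty => simp [hs.N_of_isChain hc hne]
  | insert C 𝒯 hC ih =>
    have ih' := ih (fun C' hC' => hB C' (Finset.mem_insert_of_mem hC'))
      fun C' hC' C'' hC'' => hd C' (Finset.mem_insert_of_mem hC') C'' (Finset.mem_insert_of_mem hC'')
    have hBC := hB C (Finset.mem_insert_self _ _)
    have hnot : ∀ x ∈ C, ∀ C' ∈ 𝒯, x ∉ C' := fun x hx C' hC' hx' =>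
      Finset.disjoint_left.1 (hd C (Finset.mem_insert_self _ _) C' (Finset.mem_insert_of_mem hC')
        fun e => hC (e ▸ hC')) hx hx'
    have hcross : ∀ a ∈ c ∪ C, ∀ b ∈ c ∪ 𝒯.biUnion id, a ∉ c ∪ 𝒯.biUnion id → b ∉ c ∪ C →
        ¬ (a ⋖ b ∨ b ⋖ a) := by
      intro a ha b hb ha' hb' hab
      rw [Finset.mem_union, not_or] at ha' hb'
      obtain ⟨C', hC', hbC'⟩ := Finset.mem_biUnion.1 ((Finset.mem_union.1 hb).resolve_left hb'.1)
      exact hb'.2 (hBC.closed a ((Finset.mem_union.1 ha).resolve_left ha'.1) b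
        ((hB C' (Finset.mem_insert_of_mem hC')).subset hbC') hb'.1 hab)
    have hg : Glued (· ⋖ ·) (c ∪ C) (c ∪ 𝒯.biUnion id) l := by
      refine ⟨fun x => ?_, hn, hch, fun a ha b hb ha' hb' h => hcross a ha b hb ha' hb' (Or.inl h),
        fun a ha b hb ha' hb' h => hcross a ha b hb ha' hb' (Or.inr h)⟩
      rw [← List.mem_toFinset, hl, Finset.mem_union, Finset.mem_union]
      constructor
      · rintro ⟨h1 | h1, h2 | h2⟩
        · exact h1
        · exact h1
        · exact h2
        · obtain ⟨C', hC', hxC'⟩ := Finset.mem_biUnion.1 h2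
          exact absurd hxC' (hnot x h1 C' hC')
      · exact fun h => ⟨Or.inl h, Or.inl h⟩
    have hl' : l ≠ [] := by
      rintro rfl
      rw [← hl] at hne
      simp at hne
    rw [Finset.prod_insert hC, ← ih', ← hg.hasseSub_N hl' (hl ▸ hs) (hl ▸ hc), Finset.biUnion_insert]
    congr 2
    ext x
    simp only [Finset.mem_union, id]
    tauto

/-- The vertices of the connected component of `v` in `S \ c`. -/
noncomputable def blockOf (S c : Finset P) (v : P) : Finset P := (hasseSub (S \ c)).component v

theorem mem_blockOf {S c : Finset P} {v x : P} :
    x ∈ blockOf S c v ↔ (x ∈ S ∧ x ∉ c) ∧ (hasseSub (S \ c)).skeleton.Reachable v x := by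
  simp only [blockOf, DGraph.component, Finset.mem_filter, hasseSub_verts, Finset.mem_sdiff]

theorem isBlock_blockOf (S c : Finset P) (v : P) : IsBlock S c (blockOf S c v) := by
  refine ⟨fun x hx => (mem_blockOf.1 hx).1.1, fun x hx => (mem_blockOf.1 hx).1.2,
    fun x hx y hy hyc hxy => mem_blockOf.2 ⟨⟨hy, hyc⟩, ?_⟩⟩
  obtain ⟨⟨hxS, hxc⟩, hr⟩ := mem_blockOf.1 hx
  refine hr.trans (SimpleGraph.Adj.reachable ?_)
  rw [DGraph.skeleton, SimpleGraph.fromRel_adj]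
  simp only [mem_hasseSub_edges, Finset.mem_sdiff]
  rcases hxy with h | h
  exacts [⟨h.ne, Or.inl ⟨⟨hxS, hxc⟩, ⟨hy, hyc⟩, h⟩⟩, ⟨h.ne', Or.inr ⟨⟨hy, hyc⟩, ⟨hxS, hxc⟩, h⟩⟩]

/-- The component of `v` is the smallest block containing `v`. -/
theorem blockOf_subset {S c B : Finset P} {v : P} (hB : IsBlock S c B) (hv : v ∈ B) :
    blockOf S c v ⊆ B := by
  intro x hx
  obtain ⟨p⟩ := (mem_blockOf.1 hx).2
  clear hx
  induction p with
  | nil => exact hv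
  | cons hadj _ ih =>
    refine ih ?_
    rw [DGraph.skeleton, SimpleGraph.fromRel_adj] at hadj
    simp only [mem_hasseSub_edges, Finset.mem_sdiff] at hadj
    rcases hadj with ⟨-, ⟨-, h, h'⟩ | ⟨h, -, h'⟩⟩
    exacts [hB.closed _ hv _ h.1 h.2 (Or.inl h'), hB.closed _ hv _ h.1 h.2 (Or.inr h')]

theorem blockOf_disjoint {S c : Finset P} {v v' : P} (h : blockOf S c v ≠ blockOf S c v') :
    Disjoint (blockOf S c v) (blockOf S c v') := by
  rw [Finset.disjoint_left]
  intro x hx hx'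
  refine h (Finset.ext fun y => ?_)
  rw [mem_blockOf] at hx hx' ⊢
  rw [mem_blockOf]
  have h1 := hx.2.trans hx'.2.symm
  exact and_congr_right fun _ => ⟨fun h => h1.symm.trans h, fun h => h1.trans h⟩

theorem blockOf_eq {S c : Finset P} {v v' : P} (h : v' ∈ blockOf S c v) :
    blockOf S c v = blockOf S c v' := by
  by_contra hne
  have h1 := mem_blockOf.1 h
  exact Finset.disjoint_left.1 (blockOf_disjoint hne) h
    (mem_blockOf.2 ⟨h1.1, SimpleGraph.Reachable.refl _⟩)

theorem multiset_map_sum_prod {ι α M : Type*} [CommMonoid M] (t : Finset ι) (f : ι → Multiset α)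
    (g : α → M) : ((∑ i ∈ t, f i).map g).prod = ∏ i ∈ t, ((f i).map g).prod := by
  classical
  induction t using Finset.induction_on with
  | empty => simp
  | insert i t hi ih =>
    rw [Finset.sum_insert hi, Finset.prod_insert hi, Multiset.map_add, Multiset.prod_add, ih]

/-- A set whose regions with respect to a chain are decomposed into diamonds is so itself. -/
theorem diamondFactored_of_chain {S c : Finset P} (hcS : c ⊆ S) (hs : Saturated c)
    (hc : IsChain (· ≤ ·) (c : Set P)) (hcard : 2 ≤ c.card)
    (h : ∀ v ∈ S, v ∉ c → DiamondFactored (hasseSub (c ∪ blockOf S c v))) :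
    DiamondFactored (hasseSub S) := by
  classical
  have hne : c.Nonempty := Finset.card_pos.1 (by omega)
  obtain ⟨l, hl, hn, hch⟩ := hs.exists_list hc hne
  let 𝒞 : Finset (Finset P) := (S \ c).image (blockOf S c)
  have hreg : (hasseSub S).regions l = 𝒞.image (fun C => hasseSub (c ∪ C)) := by
    rw [DGraph.regions, hl, hasseSub_erase, hasseSub_verts, Finset.image_image]
    refine Finset.image_congr fun v hv => ?_
    rw [hasseSub_induce]
    change hasseSub (S ∩ (c ∪ blockOf S c v)) = _
    rw [Finset.inter_eq_right.2 (Finset.union_subset hcS (isBlock_blockOf S c v).subset)]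
    rfl
  have hblock : ∀ C ∈ 𝒞, IsBlock S c C := by
    intro C hC
    obtain ⟨v, -, rfl⟩ := Finset.mem_image.1 hC
    exact isBlock_blockOf S c v
  -- `regions` is a set of graphs, so distinct components must give distinct regions for the product
  -- to count each of them.
  have hinj : Set.InjOn (fun C => hasseSub (c ∪ C)) (𝒞 : Set (Finset P)) := by
    intro C hC C' hC' he
    have h1 : c ∪ C = c ∪ C' := by simpa using congrArg DGraph.verts he
    have h2 : ∀ C ∈ 𝒞, (c ∪ C) \ c = C := fun C hC => by
      rw [Finset.union_sdiff_left]
      exact Finset.sdiff_eq_self_of_disjoint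
        (Finset.disjoint_left.2 fun x hx => (hblock C hC).notMem x hx)
    rw [← h2 C hC, h1, h2 C' hC']
  have hfac : ∀ R ∈ (hasseSub S).regions l, DiamondFactored R := by
    intro R hR
    rw [hreg] at hR
    obtain ⟨C, hC, rfl⟩ := Finset.mem_image.1 hR
    obtain ⟨v, hv, rfl⟩ := Finset.mem_image.1 hC
    rw [Finset.mem_sdiff] at hv
    exact h v hv.1 hv.2
  have hunion : S = c ∪ 𝒞.biUnion id := by
    ext x
    simp only [Finset.mem_union, Finset.mem_biUnion, id]
    constructor
    · intro hx
      by_cases hxc : x ∈ c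
      · exact Or.inl hxc
      · exact Or.inr ⟨_, Finset.mem_image_of_mem _ (Finset.mem_sdiff.2 ⟨hx, hxc⟩),
          mem_blockOf.2 ⟨⟨hx, hxc⟩, SimpleGraph.Reachable.refl _⟩⟩
    · rintro (hx | ⟨C, hC, hx⟩)
      exacts [hcS hx, (hblock C hC).subset hx]
  have hN : (hasseSub S).N = ∏ R ∈ (hasseSub S).regions l, R.N := by
    rw [hreg, Finset.prod_image hinj]
    conv_lhs => rw [hunion]
    refine hasseSub_N_biUnion hs hc hne 𝒞 hblock fun C hC C' hC' hCC' => ?_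
    obtain ⟨v, -, rfl⟩ := Finset.mem_image.1 hC
    obtain ⟨v', -, rfl⟩ := Finset.mem_image.1 hC'
    exact blockOf_disjoint hCC'
  -- A chosen factorization for each region; the value 0 elsewhere is never consulted by
  -- `ChainFactors.chain`.
  let f : DGraph P → Multiset (DGraph P) := fun R =>
    if hR : DiamondFactored R then hR.choose else 0
  have hf : ∀ R ∈ (hasseSub S).regions l, R.ChainFactors (f R) ∧ (∀ D ∈ f R, D.IsDiamond) ∧
      R.N = ((f R).map DGraph.N).prod ∧
      ∀ D ∈ f R, ∃ a b : P, D.minimals = {a} ∧ D.maximals = {b} ∧ D.N = var a - var b := by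
    intro R hR
    have := (hfac R hR).choose_spec
    simpa only [f, dif_pos (hfac R hR)] using this
  refine ⟨∑ R ∈ (hasseSub S).regions l, f R, .chain _ l f ⟨?_, hn, ?_⟩ fun R hR => (hf R hR).1,
    fun D hD => ?_, ?_, fun D hD => ?_⟩
  · rwa [← List.toFinset_card_of_nodup hn, hl]
  · have hmem : ∀ x ∈ l, x ∈ S := fun x hx => hcS (hl ▸ List.mem_toFinset.2 hx)
    rw [List.isChain_iff_getElem] at hch ⊢
    exact fun i hi => mem_hasseSub_edges.2
      ⟨hmem _ (List.getElem_mem _), hmem _ (List.getElem_mem _), hch i hi⟩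
  · obtain ⟨R, hR, hD⟩ := Multiset.mem_sum.1 hD
    exact (hf R hR).2.1 D hD
  · rw [hN, multiset_map_sum_prod]
    exact Finset.prod_congr rfl fun R hR => (hf R hR).2.2.1
  · obtain ⟨R, hR, hD⟩ := Multiset.mem_sum.1 hD
    exact (hf R hR).2.2.2 D hD

end Regions

/-! ### The ear induction proving both formulas. -/

section Decomposition

variable {P : Type*} [Fintype P] [DecidableEq P] [PartialOrder P]

/-- A maximal chain with an ear attached at two of its elements is decomposed by prunings into a
single diamond. -/
theorem IsMaximalChain.diamondFactored_union {S c A : Finset P} {u w t : P}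
    (hc : IsMaximalChain S c) (hs : Saturated c) (hF : Saturated (c ∪ A)) (hA : A.Nonempty)
    (hAc : IsChain (· ≤ ·) (A : Set P)) (hAd : ∀ x ∈ A, x ∉ c) (huc : u ∈ c) (hwc : w ∈ c)
    (htc : t ∈ c) (hut : u < t) (htw : t < w) (hL : LowerGate S A u) (hU : UpperGate S A w) :
    DiamondFactored (hasseSub (c ∪ A)) := by
  classical
  have huA : ∀ v ∈ A, u < v := fun v hv => (hL.2.2 v hv u hL.1 hL.2.1).2 le_rfl
  have hAw : ∀ v ∈ A, v < w := fun v hv => (hU.2.2 v hv w hU.1 hU.2.1).2 le_rfl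
  have huw : u < w := hut.trans htw
  have hAc' : ∀ x ∈ c, x ∉ A := fun x hx hxA => hAd x hxA hx
  -- `A₁` and `A₂` are the parts of the chain below `u` and above `w`. They are pending and get
  -- pruned; the segment `d` between them and the ear remain, forming a diamond.
  set A₁ := c.filter (· < u) with hA₁
  set F₁ := (c ∪ A) \ A₁ with hF₁
  set A₂ := c.filter (w < ·) with hA₂
  set d := c.filter (fun x => u ≤ x ∧ x ≤ w) with hd
  have mem₁ : ∀ {x}, x ∈ A₁ ↔ x ∈ c ∧ x < u := Finset.mem_filter
  have mem₂ : ∀ {x}, x ∈ A₂ ↔ x ∈ c ∧ w < x := Finset.mem_filter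
  have memd : ∀ {x}, x ∈ d ↔ x ∈ c ∧ u ≤ x ∧ x ≤ w := Finset.mem_filter
  have memF : ∀ {x}, x ∈ F₁ ↔ x ∈ c ∪ A ∧ u ≤ x := by
    intro x
    rw [hF₁, Finset.mem_sdiff, mem₁]
    refine and_congr_right fun hx => ⟨fun h => ?_, fun h h' => h.not_gt h'.2⟩
    rcases Finset.mem_union.1 hx with hx | hx
    · rcases hc.isChain.total huc hx with h' | h'
      · exact h'
      · exact (h'.eq_or_lt.resolve_right fun h'' => h ⟨hx, h''⟩).ge
    · exact (huA x hx).le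
  have hsF₁ : Saturated F₁ := hF.of_convex Finset.sdiff_subset fun x hx _ _ z hz hxz _ =>
    memF.2 ⟨hz, (memF.1 hx).2.trans hxz⟩
  have memdA : ∀ {x}, x ∈ d ∪ A ↔ x ∈ c ∪ A ∧ u ≤ x ∧ x ≤ w := by
    intro x
    rw [Finset.mem_union, Finset.mem_union, memd]
    constructor
    · rintro (h | h)
      exacts [⟨Or.inl h.1, h.2⟩, ⟨Or.inr h, (huA x h).le, (hAw x h).le⟩]
    · rintro ⟨h | h, h'⟩
      exacts [Or.inl ⟨h, h'⟩, Or.inr h]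
  have hF₂ : F₁ \ A₂ = d ∪ A := by
    ext x
    rw [Finset.mem_sdiff, memF, memdA, mem₂, and_assoc]
    refine and_congr_right fun hx => and_congr_right fun _ =>
      ⟨fun h => ?_, fun h h' => h.not_gt h'.2⟩
    rcases Finset.mem_union.1 hx with hx | hx
    · rcases hc.isChain.total hx hwc with h' | h'
      · exact h'
      · exact (h'.eq_or_lt.resolve_right fun h'' => h ⟨hx, h''⟩).ge
    · exact (hAw x hx).le
  have hdiamond : TwoChains d A u w t :=
    { disjoint := fun x hx hxd => hAd x hx (memd.1 hxd).1
      saturated := hF.of_convex (fun x hx => (memdA.1 hx).1) fun x hx y hy z hz hxz hzy =>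
        memdA.2 ⟨hz, (memdA.1 hx).2.1.trans hxz, hzy.trans (memdA.1 hy).2.2⟩
      saturated_left := hs.of_convex (Finset.filter_subset _ _) fun x hx y hy z hz hxz hzy =>
        memd.2 ⟨hz, (memd.1 hx).2.1.trans hxz, hzy.trans (memd.1 hy).2.2⟩
      chain_left := hc.isChain.mono (Finset.coe_subset.2 (Finset.filter_subset _ _))
      chain_right := hAc
      nonempty := hA
      u_mem := memd.2 ⟨huc, le_rfl, huw.le⟩
      w_mem := memd.2 ⟨hwc, huw.le, le_rfl⟩
      t_mem := memd.2 ⟨htc, hut.le, htw.le⟩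
      u_lt_t := hut
      t_lt_w := htw
      u_le := fun x hx => (memd.1 hx).2.1
      le_w := fun x hx => (memd.1 hx).2.2
      lower := fun v hv x hx => hL.2.2 v hv x (hc.subset (memd.1 hx).1) (hAc' x (memd.1 hx).1)
      upper := fun v hv x hx => hU.2.2 v hv x (hc.subset (memd.1 hx).1) (hAc' x (memd.1 hx).1) }
  refine lower_tail_induction (motive := fun S => DiamondFactored (hasseSub S))
    diamondFactored_of_minimal (A := A₁) (w := u) hF
    ((Finset.filter_subset _ _).trans Finset.subset_union_left)
    (hc.isChain.mono (Finset.coe_subset.2 (Finset.filter_subset _ _))) ?_ ?_ ?_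
  · intro v hv x hx hx' hxv
    exact (memF.1 (Finset.mem_sdiff.2 ⟨hx, hx'⟩)).2.not_gt (hxv.trans (mem₁.1 hv).2)
  · refine ⟨Finset.mem_union_left _ huc, fun h => lt_irrefl _ (mem₁.1 h).2, fun v hv x hx hx' => ?_⟩
    exact ⟨fun _ => (memF.1 (Finset.mem_sdiff.2 ⟨hx, hx'⟩)).2, fun h => (mem₁.1 hv).2.trans_le h⟩
  refine upper_tail_induction (motive := fun S => DiamondFactored (hasseSub S))
    diamondFactored_of_maximal (A := A₂) (u := w) hsF₁
    (fun x hx => memF.2 ⟨Finset.mem_union_left _ (mem₂.1 hx).1, (huw.trans (mem₂.1 hx).2).le⟩)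
    (hc.isChain.mono (Finset.coe_subset.2 (Finset.filter_subset _ _))) ?_ ?_ ?_
  · intro v hv x hx hx' hxv
    have h := Finset.mem_sdiff.2 ⟨hx, hx'⟩
    rw [hF₂] at h
    exact (memdA.1 h).2.2.not_gt ((mem₂.1 hv).2.trans hxv)
  · refine ⟨memF.2 ⟨Finset.mem_union_left _ hwc, huw.le⟩, fun h => lt_irrefl _ (mem₂.1 h).2,
      fun v hv x hx hx' => ⟨fun _ => ?_, fun h => h.trans_lt (mem₂.1 hv).2⟩⟩
    have h := Finset.mem_sdiff.2 ⟨hx, hx'⟩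
    rw [hF₂] at h
    exact (memdA.1 h).2.2
  · rw [hF₂]
    exact hdiamond.diamondFactored

omit [Fintype P] in
/-- An ear attached at two elements of a chain is a block with respect to that chain. -/
theorem isBlock_of_gates {S c A : Finset P} {u w : P} (hA : A ⊆ S) (hAd : ∀ x ∈ A, x ∉ c)
    (huc : u ∈ c) (hwc : w ∈ c) (hL : LowerGate S A u) (hU : UpperGate S A w) : IsBlock S c A := by
  refine ⟨hA, hAd, fun x hx y hy hyc hxy => ?_⟩
  by_contra hyA
  rcases hxy with h | h
  · have hwy := (hU.2.2 x hx y hy hyA).1 h.lt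
    have hxw := (hU.2.2 x hx w hU.1 hU.2.1).2 le_rfl
    exact h.2 hxw (lt_of_le_of_ne hwy fun e => hyc (e ▸ hwc))
  · have hyu := (hL.2.2 x hx y hy hyA).1 h.lt
    have hux := (hL.2.2 x hx u hL.1 hL.2.1).2 le_rfl
    exact h.2 (lt_of_le_of_ne hyu fun e => hyc (e ▸ huc)) hux

/-- An ear attached at two elements of a chain is a component of the complement of that chain. -/
theorem blockOf_eq_of_gates {S c A : Finset P} {u w v : P} (hS : Saturated S) (hcS : c ⊆ S)
    (hA : A ⊆ S) (hAc : IsChain (· ≤ ·) (A : Set P)) (hAd : ∀ x ∈ A, x ∉ c) (huc : u ∈ c) (hwc : w ∈ c)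
    (hL : LowerGate S A u) (hU : UpperGate S A w) (hv : v ∈ A) : blockOf S c v = A := by
  have hA' := isBlock_of_gates hA hAd huc hwc hL hU
  have hB := isBlock_blockOf S c v
  have hsub := blockOf_subset hA' hv
  have hvv : v ∈ blockOf S c v :=
    mem_blockOf.2 ⟨⟨hA hv, hAd v hv⟩, SimpleGraph.Reachable.refl _⟩
  refine Finset.Subset.antisymm hsub fun b hb => ?_
  by_contra hbC
  have hne : v ≠ b := fun e => hbC (e ▸ hvv)
  have h := hB.exists_between hS hvv (hA hb) hbC (hAd b hb)
  -- If the ear met two components, an element of `c` would lie strictly between two elements of the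
  -- ear; but being above the lower one puts it above `w`.
  rcases hAc hv hb hne with hvb | hbv
  · obtain ⟨z, hz, h1, h2⟩ := h.1 (lt_of_le_of_ne hvb hne)
    have h3 := (hU.2.2 v hv z (hcS hz) fun h' => hAd z h' hz).1 h1
    exact (h3.trans_lt h2).not_gt ((hU.2.2 b hb w hU.1 hU.2.1).2 le_rfl)
  · obtain ⟨z, hz, h1, h2⟩ := h.2 (lt_of_le_of_ne hbv hne.symm)
    have h3 := (hU.2.2 b hb z (hcS hz) fun h' => hAd z h' hz).1 h1
    exact (h3.trans_lt h2).not_gt ((hU.2.2 v hv w hU.1 hU.2.1).2 le_rfl)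

/-- The decomposition of a connected set with an ear attached at both ends, given that of the
spanning connected sets which do not contain this ear. -/
theorem diamondFactored_of_gates {S A : Finset P} {u w t : P} (hS : Spanning S)
    (hconn : OrderConnected S) (hA : A ⊆ S) (hne : A.Nonempty) (hAc : IsChain (· ≤ ·) (A : Set P))
    (ht : t ∈ S) (htA : t ∉ A) (hL : LowerGate S A u) (hU : UpperGate S A w) (hut : u < t)
    (htw : t < w) (ih : ∀ T ⊆ S, Disjoint A T → Spanning T → OrderConnected T →
      DiamondFactored (hasseSub T)) : DiamondFactored (hasseSub S) := by
  have huw := hut.trans htw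
  -- The chain is taken through `t` as well as through the gates, so that it passes beside the ear:
  -- `t` is incomparable to every element of the ear.
  have hchain : IsChain (· ≤ ·) (({u, t, w} : Finset P) : Set P) := by
    simp only [Finset.coe_insert, Finset.coe_singleton]
    refine (IsChain.singleton.insert ?_).insert ?_
    · rintro b rfl _
      exact Or.inl htw.le
    · rintro b (rfl | rfl) _
      exacts [Or.inl hut.le, Or.inl huw.le]
  have hsub : ({u, t, w} : Finset P) ⊆ S := by
    simp only [Finset.insert_subset_iff, Finset.singleton_subset_iff]
    exact ⟨hL.1, ht, hU.1⟩
  obtain ⟨c, hc₀, hc⟩ := exists_isMaximalChain hsub hchain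
  simp only [Finset.insert_subset_iff, Finset.singleton_subset_iff] at hc₀
  obtain ⟨huc, htc, hwc⟩ := hc₀
  have hAd : ∀ x ∈ A, x ∉ c := by
    intro x hx hxc
    have hxt : x ≠ t := fun e => htA (e ▸ hx)
    rcases hc.isChain hxc htc hxt with h | h
    · exact htw.not_ge ((hU.2.2 x hx t ht htA).1 (lt_of_le_of_ne h hxt))
    · exact hut.not_ge ((hL.2.2 x hx t ht htA).1 (lt_of_le_of_ne h hxt.symm))
  have hs := hc.saturated hS.toSaturated
  refine diamondFactored_of_chain hc.subset hs hc.isChain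
    (Finset.one_lt_card.2 ⟨u, huc, w, hwc, huw.ne⟩) fun v hv hvc => ?_
  have hB := isBlock_blockOf S c v
  -- Regions avoiding the ear are handled by `ih`; the remaining one has the ear as its whole
  -- component and prunes to a diamond.
  by_cases hd : Disjoint A (blockOf S c v)
  · refine ih _ (Finset.union_subset hc.subset hB.subset) ?_ (hB.spanning_union hS hc)
      (hB.orderConnected_union hS.toSaturated hconn hc ⟨u, huc⟩)
    exact Finset.disjoint_union_right.2 ⟨Finset.disjoint_left.2 hAd, hd⟩
  · obtain ⟨a, haA, ha⟩ := Finset.not_disjoint_iff.1 hd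
    rw [blockOf_eq ha,
      blockOf_eq_of_gates hS.toSaturated hc.subset hA hAc hAd huc hwc hL hU haA]
    exact hc.diamondFactored_union hs ((isBlock_of_gates hA hAd huc hwc hL hU).saturated_union
      hS.toSaturated hs hc.subset) hne hAc hAd huc hwc htc hut htw hL hU

/-- Both formulas, for the spanning connected subsets of a planar poset. -/
theorem Spanning.diamondFactored_and_greeneFormula (hP : (hasseGraph P).StronglyPlanar)
    {S : Finset P} (hS : Spanning S) (hconn : OrderConnected S) :
    DiamondFactored (hasseSub S) ∧ GreeneFormula S := by
  induction S using Finset.strongInduction with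
  | H S ih =>
  by_cases hchain : ∃ x ∈ S, ∃ y ∈ S, ¬ x ≤ y ∧ ¬ y ≤ x
  · obtain ⟨A, hA, hne, hAc, t, ht, htA, hL, hU⟩ := hS.exists_ear hP hchain
    obtain ⟨ih₁, ih₂⟩ := ih (S \ A) (Finset.sdiff_ssubset hA hne) (hS.sdiff ht htA hL hU)
      (hconn.sdiff hA ht htA hL hU)
    -- The four ways of attaching the ear: at both ends, only below (pruned from its top), only
    -- above (pruned from its bottom), or nowhere, which connectedness forbids.
    rcases hL with ⟨u, hL, hut⟩ | hL <;> rcases hU with ⟨w, hU, htw⟩ | hU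
    · refine ⟨diamondFactored_of_gates hS hconn hA hne hAc ht htA hL hU hut htw
        fun T hT hAT hT' hTc => (ih T ?_ hT' hTc).1,
        ear_induction (motive := GreeneFormula)
          (fun _ _ _ _ hv h h' h'' => GreeneFormula.of_erase_gates hv h h' h'') hA hAc hL hU ih₂⟩
      obtain ⟨a, ha⟩ := hne
      exact (Finset.ssubset_iff_of_subset hT).2 ⟨a, hA ha, Finset.disjoint_left.1 hAT ha⟩
    · exact ⟨upper_tail_induction (motive := fun S => DiamondFactored (hasseSub S))
          diamondFactored_of_maximal hS.toSaturated hA hAc hU hL ih₁,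
        upper_tail_induction (motive := GreeneFormula)
          (fun _ _ _ _ hv h h' h'' => GreeneFormula.of_erase_maximal hv h h' h'')
          hS.toSaturated hA hAc hU hL ih₂⟩
    · exact ⟨lower_tail_induction (motive := fun S => DiamondFactored (hasseSub S))
          diamondFactored_of_minimal hS.toSaturated hA hAc hL hU ih₁,
        lower_tail_induction (motive := GreeneFormula)
          (fun _ _ _ _ hv h h' h'' => GreeneFormula.of_erase_minimal hv h h' h'')
          hS.toSaturated hA hAc hL hU ih₂⟩
    · exact (hconn.not_isolated hA hne ht htA hL hU).elim
  · push Not at hchain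
    have hSc : IsChain (· ≤ ·) (S : Set P) := fun x hx y hy _ =>
      or_iff_not_imp_left.2 (hchain x hx y hy)
    exact ⟨saturated_chain_induction (motive := fun S => DiamondFactored (hasseSub S))
        diamondFactored_singleton diamondFactored_of_minimal hS.toSaturated hSc hconn.1,
      saturated_chain_induction (motive := GreeneFormula) greeneFormula_singleton
        (fun _ _ _ _ hv h h' h'' => GreeneFormula.of_erase_minimal hv h h' h'')
        hS.toSaturated hSc hconn.1⟩

end Decomposition

/-! ### Specialization to the whole poset, and the disconnected case. -/

section WholePoset

variable (P : Type*) [Fintype P] [DecidableEq P] [PartialOrder P]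

omit [DecidableEq P] in
theorem spanning_univ : Spanning (Finset.univ : Finset P) where
  exists_covBy_right x _ y _ hxy := by
    obtain ⟨z, h1, h2⟩ := exists_covBy_le_of_lt hxy
    exact ⟨z, Finset.mem_univ _, h1, h2⟩
  exists_covBy_left x _ y _ hxy := by
    obtain ⟨z, h1, h2⟩ := exists_le_covBy_of_lt hxy
    exact ⟨z, Finset.mem_univ _, h1, h2⟩
  isMin x _ h := isMin_iff_forall_not_lt.2 fun y => h y (Finset.mem_univ _)
  isMax x _ h := isMax_iff_forall_not_lt.2 fun y => h y (Finset.mem_univ _)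

variable {P}

omit [DecidableEq P] in
theorem skeleton_hasseGraph_adj {x y : P} :
    (hasseGraph P).skeleton.Adj x y ↔ x ⋖ y ∨ y ⋖ x := by
  rw [DGraph.skeleton, SimpleGraph.fromRel_adj, mem_edges_hasseGraph, mem_edges_hasseGraph]
  refine ⟨fun h => h.2, fun h => ⟨?_, h⟩⟩
  rcases h with h | h
  exacts [h.ne, h.ne']

theorem orderConnected_univ (h : (hasseGraph P).Connected) :
    OrderConnected (Finset.univ : Finset P) := by
  refine ⟨h.1.mono (Finset.subset_univ _), fun T _ ⟨x, hx⟩ hT => ?_⟩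
  by_contra! hcl
  refine hT (Finset.eq_univ_iff_forall.2 fun y => ?_)
  obtain ⟨p⟩ := h.2 x (Finset.mem_univ x) y (Finset.mem_univ y)
  induction p with
  | nil => exact hx
  | @cons a b _ hadj _ ih =>
    refine ih ?_
    by_contra hb
    have hab := hcl a hx b (Finset.mem_univ b) hb
    rcases skeleton_hasseGraph_adj.1 hadj with h | h
    exacts [hab.1 h.lt, hab.2 h.lt]

/-- The function of a non-connected poset is zero. -/
theorem posetPsi_eq_zero [Nonempty P] [LocallyFiniteOrder P] (h : ¬ (hasseGraph P).Connected) :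
    posetPsi P = 0 := by
  classical
  have h' : ∃ a b : P, ¬ (hasseGraph P).skeleton.Reachable a b := by
    by_contra! h'
    exact h ⟨Finset.univ_nonempty, fun a _ b _ => h' a b⟩
  obtain ⟨a, b, hab⟩ := h'
  -- The component of `a` and its complement are two non-empty parts without covering relations
  -- between them.
  let T : Finset P := Finset.univ.filter ((hasseGraph P).skeleton.Reachable a)
  have hT : ∀ {x}, x ∈ T ↔ (hasseGraph P).skeleton.Reachable a x := by simp [T]
  have key : relPsi (· ⋖ ·) (T ∪ Tᶜ) = 0 := by
    refine relPsi_union_eq_zero ⟨a, hT.2 (SimpleGraph.Reachable.refl _)⟩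
      ⟨b, Finset.mem_compl.2 fun hb => hab (hT.1 hb)⟩ disjoint_compl_right fun x hx y hy => ?_
    rw [Finset.mem_compl, hT] at hy
    rw [hT] at hx
    rw [← not_or, ← skeleton_hasseGraph_adj]
    exact fun hxy => hy (hx.trans hxy.reachable)
  rwa [Finset.union_compl, ← hasseSub_Psi, hasseSub_univ, ← posetPsi_eq] at key

theorem isMobius_mu [LocallyFiniteOrder P] :
    IsMobius (Finset.univ : Finset P) (fun a b => IncidenceAlgebra.mu ℤ a b) := by
  classical
  intro y _ z _ _
  refine (Finset.sum_congr (Finset.ext fun x => ?_) fun _ _ => rfl).trans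
    ((IncidenceAlgebra.sum_Icc_mu_right (𝕜 := ℤ) y z).trans ?_)
  · simp
  · split_ifs <;> rfl

theorem mobiusProd_univ_mu [LocallyFiniteOrder P] :
    mobiusProd (Finset.univ : Finset P) (fun a b => IncidenceAlgebra.mu ℤ a b) =
      ∏ e : P × P with e.1 ≠ e.2, (var e.1 - var e.2) ^ (IncidenceAlgebra.mu ℤ e.1 e.2) := by
  classical
  rw [mobiusProd]
  refine Finset.prod_subset (fun e he => ?_) fun e he he' => ?_
  · rw [Finset.mem_filter] at he ⊢
    exact ⟨Finset.mem_univ _, he.2.ne⟩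
  · have hne := (Finset.mem_filter.1 he).2
    have hle : ¬ e.1 ≤ e.2 := fun hle =>
      he' (Finset.mem_filter.2 ⟨by simp, lt_of_le_of_ne hle hne⟩)
    rw [IncidenceAlgebra.apply_eq_zero_of_not_le hle, zpow_zero]

end WholePoset

end GreenePlanar

theorem mainTheorem8 (P : Type*) [Fintype P] [Nonempty P] [DecidableEq P] [PartialOrder P]
    [LocallyFiniteOrder P] (hP : (GreenePlanar.hasseGraph P).StronglyPlanar) :
    ((GreenePlanar.hasseGraph P).Connected →
      (∃ s : Multiset (GreenePlanar.DGraph P),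
        (GreenePlanar.hasseGraph P).ChainFactors s ∧
        (∀ D ∈ s, D.IsDiamond) ∧
        (GreenePlanar.hasseGraph P).N = (s.map GreenePlanar.DGraph.N).prod ∧
        ∀ D ∈ s, ∃ a b : P, D.minimals = {a} ∧ D.maximals = {b} ∧
          D.N = GreenePlanar.var a - GreenePlanar.var b) ∧
      GreenePlanar.posetPsi P = ∏ e : P × P with e.1 ≠ e.2,
        (GreenePlanar.var e.1 - GreenePlanar.var e.2) ^ (IncidenceAlgebra.mu ℤ e.1 e.2)) ∧
    (¬ (GreenePlanar.hasseGraph P).Connected → GreenePlanar.posetPsi P = 0) := by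
  refine ⟨fun hconn => ?_, GreenePlanar.posetPsi_eq_zero⟩
  have hspan := GreenePlanar.spanning_univ P
  obtain ⟨h₁, h₂⟩ := hspan.diamondFactored_and_greeneFormula hP
    (GreenePlanar.orderConnected_univ hconn)
  refine ⟨?_, ?_⟩
  · rw [GreenePlanar.hasseSub_univ] at h₁
    exact h₁
  · rw [← GreenePlanar.mobiusProd_univ_mu, ← h₂ _ GreenePlanar.isMobius_mu,
      ← hspan.relPsi_eq, ← GreenePlanar.hasseSub_Psi, GreenePlanar.hasseSub_univ,
      GreenePlanar.posetPsi_eq]
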